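/- **Notation.** For $|q|<1$ let $(a;q)_\infty=\prod_{j\ge 0}(1-aq^j)$. For $\tau\in\mathbb{C}\setminus\{0\}$ put $q=\exp(2\pi i\tau)$, $\widetilde q=\exp(-2\pi i/\tau)$, and, for $u\in\mathbb{C}$, $q^u=\exp(2\pi i\tau u)$, $\widetilde q^{\,u}=\exp(-2\pi i u/\tau)$. For $\operatorname{Im}(\tau)>0$ the $\tau$-shifted factorial is the meromorphic function of $z\in\mathbb{C}$ $$[z;\tau]_\infty=\frac{\bigl(\exp(-2\pi i z);\widetilde q\,\bigr)_\infty}{\bigl(q^z;q\bigr)_\infty}$$ (removable singularities removed). For $\tau\in\mathbb{R}_{<0}$, $[z;\tau]_\infty$ denotes its extension by continuity in $(z,\tau)$ from $\operatorname{Im}(\tau)>0$, defined for all $z$ other than the poles of the resulting meromorphic function of $z$. Write $[a,b;\tau]_\infty=[a;\tau]_\infty[b;\tau]_\infty$, and let $\sqrt{\cdot}$ be the principal branch of the square root. **Theorem (Hyperbolic Ramanujan integral).** Let $\tau\in\mathbb{C}$ with $\operatorname{Re}(\tau)<0$ and $\operatorname{Im}(\tau)\ge 0$, and let $\alpha,\beta\in\mathbb{C}$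 satisfy $$\operatorname{Re}(\tau\alpha)<0,\quad \operatorname{Re}(\tau\beta)<0,\quad \operatorname{Re}\Bigl(\alpha-\tfrac12+\tfrac1{2\tau}\Bigr)<0,\quad \operatorname{Re}\Bigl(\beta-\tfrac12+\tfrac1{2\tau}\Bigr)<0.$$ Then the following integral along the imaginary axis converges absolutely and $$\int_{-i\infty}^{i\infty}\frac{\bigl[\tfrac12+\tfrac1{2\tau}+z,\ \tfrac12+\tfrac1{2\tau}-z;\tau\bigr]_\infty}{\bigl[\tfrac12+\tfrac1{2\tau}+\alpha+z,\ \tfrac12+\tfrac1{2\tau}+\beta-z;\tau\bigr]_\infty}\,dz=-\frac{q^{-1/24}\,\widetilde q^{\,1/24}}{\sqrt{-i\tau}}\cdot\frac{\bigl[\tfrac1\tau+\alpha,\ \tfrac1\tau+\beta;\tau\bigr]_\infty}{\bigl[\tfrac1\tau+\alpha+\beta;\tau\bigr]_\infty}.$$ This includes the case $\tau\in\mathbb{R}_{<0}$, in which $|q|=|\widetilde q|=1$. -/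

import Mathlib

/-- The infinite `q`-Pochhammer symbol `(a; q)_∞ = ∏_{j ≥ 0} (1 - a q ^ j)`, used for `|q| < 1`. -/
noncomputable def qPochhammerInf (a q : ℂ) : ℂ :=
  ∏' j : ℕ, (1 - a * q ^ j)

/-- The power `q ^ u = exp (2 π i τ u)` of the deformation parameter `q = exp (2 π i τ)`. -/
noncomputable def qPow (τ u : ℂ) : ℂ :=
  Complex.exp (2 * Real.pi * Complex.I * τ * u)

/-- The power `q̃ ^ u = exp (- 2 π i u / τ)` of the deformation parameter
`q̃ = exp (- 2 π i / τ)`. -/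
noncomputable def qTildePow (τ u : ℂ) : ℂ :=
  Complex.exp (-(2 * Real.pi * Complex.I * u / τ))

/-- The numerator `(exp (- 2 π i z); q̃)_∞` of the `τ`-shifted factorial. -/
noncomputable def tauNumerator (z τ : ℂ) : ℂ :=
  qPochhammerInf (Complex.exp (-(2 * Real.pi * Complex.I * z))) (qTildePow τ 1)

/-- The denominator `(q ^ z; q)_∞` of the `τ`-shifted factorial. -/
noncomputable def tauDenominator (z τ : ℂ) : ℂ :=
  qPochhammerInf (qPow τ z) (qPow τ 1)

/-- The pairs `(z, τ)` with `τ` in the upper half plane at which the quotient of infinite products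
defining the `τ`-shifted factorial has a nonzero denominator. -/
def tauProductDomain : Set (ℂ × ℂ) :=
  {p | 0 < p.2.im ∧ tauDenominator p.1 p.2 ≠ 0}

/-- The `τ`-shifted factorial `[z; τ]_∞`, for `τ` in the upper half plane or `τ < 0`: the
extension by continuity, jointly in `(z, τ)`, of the quotient
`(exp (- 2 π i z); q̃)_∞ / (q ^ z; q)_∞` of infinite products. For `Im τ > 0` this is the
meromorphic function of `z` given by the quotient, with its removable singularities (the common
zeros of numerator and denominator) removed. For `τ < 0` (where the products diverge) it is the
limit of the quotient from the upper half plane. At the poles there is no limit, and the value is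
an unspecified one. -/
noncomputable def tauFactorial (z τ : ℂ) : ℂ :=
  extendFrom tauProductDomain (fun p : ℂ × ℂ => tauNumerator p.1 p.2 / tauDenominator p.1 p.2)
    (z, τ)

/-- The integrand
`[1/2 + 1/(2τ) ± z; τ]_∞ / [1/2 + 1/(2τ) + α + z, 1/2 + 1/(2τ) + β - z; τ]_∞`. -/
noncomputable def ramanujanIntegrand (τ α β z : ℂ) : ℂ :=
  tauFactorial (1 / 2 + 1 / (2 * τ) + z) τ * tauFactorial (1 / 2 + 1 / (2 * τ) - z) τ /
    (tauFactorial (1 / 2 + 1 / (2 * τ) + α + z) τ * tauFactorial (1 / 2 + 1 / (2 * τ) + β - z) τ)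

open Complex Filter Topology

/-! Let Im τ > 0 first, and put c = 1/2 + 1/(2τ). By the Jacobi triple product, [c+z;τ][c-z;τ] is a
quotient of theta functions attached to -1/τ and τ, up to the factors (q;q) and (q̃;q̃). The modular
transformations of theta and eta reduce it to a constant times exp(πiτz²); this is the reflection
formula `tauNumerator_mul_tauNumerator`. The integrand is therefore a Gaussian, times the q-products
and divided by the q̃-products at c+α+z and c+β-z.

Along the real line this integral is explicit. The q̃-products have period 1, and multiplying the
Gaussian by a term of the Euler expansions of the q-products only translates it by an integer and
multiplies it by a constant. Hence the q-products split off as a double series in q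
(`integral_gaussianDivNumerators_mul`). Expanding the reciprocal q̃-products leaves Fourier
transforms of the Gaussian, that is a double series in q̃ (`integral_gaussianDivNumerators`). Both
double series are summed by Euler's identities and the q-binomial theorem, and the two results
combine to the τ-shifted factorials of the right-hand side.

For α and β near 1/4 the imaginary axis can be rotated onto the real axis run backwards, which is
the origin of the minus sign (`integral_regularIntegrand_of_isSmallParameter`). Analytic
continuation in one parameter at a time reaches all admissible α, β (`integral_regularIntegrand`).

For τ < 0 the products diverge and the identity is obtained as a limit from Im τ > 0. Continuity of
the factorial and a bound uniform in τ both come from the representation of log [z;τ] as minus the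
integral over ℝ - iε of exp((z-1)t) / ((1-exp(-t))(1-exp(t/τ)) t), valid for Re(1/τ) < Re z < 1
(`tauFactorial_eq_exp_tauLog`). For Im τ > 0 the product and the exponential of this integral
satisfy the same difference equations for the shifts 1 and 1/τ. Their quotient is thus constant
along orbits that zigzag inside the strip towards -i∞, where it tends to 1. Dominated convergence in
τ finishes the proof. -/

/-- The finite `q`-Pochhammer symbol `(a; q)_n`. -/
noncomputable def qPochhammer (a q : ℂ) (n : ℕ) : ℂ := ∏ i ∈ Finset.range n, (1 - a * q ^ i)

/-! ### Infinite q-products, the q-binomial theorem and Euler's expansions. -/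

section QSeries

variable {q : ℂ}

lemma summable_norm_mul_pow (a : ℂ) (hq : ‖q‖ < 1) : Summable fun j : ℕ => ‖-(a * q ^ j)‖ := by
  simpa [norm_mul, norm_pow] using (summable_geometric_of_lt_one (norm_nonneg q) hq).mul_left ‖a‖

lemma multipliable_one_sub_mul_pow (a : ℂ) (hq : ‖q‖ < 1) :
    Multipliable fun j : ℕ => 1 - a * q ^ j := by
  simpa [sub_eq_add_neg] using multipliable_one_add_of_summable (summable_norm_mul_pow a hq)

lemma qPochhammerInf_eq_prod_mul (a : ℂ) (hq : ‖q‖ < 1) (n : ℕ) :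
    qPochhammerInf a q = qPochhammer a q n * qPochhammerInf (a * q ^ n) q := by
  induction n with
  | zero => simp [qPochhammer]
  | succ n ih =>
    have h := (multipliable_one_sub_mul_pow (a * q ^ n) hq)
    rw [ih, qPochhammer, qPochhammer, Finset.prod_range_succ, mul_assoc]
    congr 1
    unfold qPochhammerInf
    rw [tprod_eq_zero_mul']
    · simp only [pow_zero, mul_one]
      congr 1
      refine tprod_congr fun j => ?_
      ring
    · have := multipliable_one_sub_mul_pow (a * q ^ n * q) hq
      refine this.congr fun j => ?_
      ring

lemma qPochhammerInf_eq_one_sub_mul (a : ℂ) (hq : ‖q‖ < 1) :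
    qPochhammerInf a q = (1 - a) * qPochhammerInf (a * q) q := by
  simpa [qPochhammer] using qPochhammerInf_eq_prod_mul a hq 1

@[simp] lemma qPochhammerInf_zero_left (q : ℂ) : qPochhammerInf 0 q = 1 := by
  simp [qPochhammerInf]

lemma qPochhammerInf_ne_zero {a : ℂ} (hq : ‖q‖ < 1) (h : ∀ j : ℕ, a * q ^ j ≠ 1) :
    qPochhammerInf a q ≠ 0 := by
  have := tprod_one_add_ne_zero_of_summable (f := fun j : ℕ => -(a * q ^ j))
    (fun j => by rw [← sub_eq_add_neg, sub_ne_zero]; exact (h j).symm)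
    (summable_norm_mul_pow a hq)
  simpa [qPochhammerInf, sub_eq_add_neg] using this

lemma qPochhammerInf_eq_zero_iff {a : ℂ} (hq : ‖q‖ < 1) :
    qPochhammerInf a q = 0 ↔ ∃ j : ℕ, a * q ^ j = 1 := by
  constructor
  · intro h
    by_contra! h'
    exact qPochhammerInf_ne_zero hq h' h
  · rintro ⟨j, hj⟩
    rw [qPochhammerInf_eq_prod_mul a hq (j + 1), qPochhammer, Finset.prod_range_succ, hj]
    simp

lemma qPochhammerInf_ne_zero_of_norm_lt_one {a : ℂ} (hq : ‖q‖ < 1) (ha : ‖a‖ < 1) :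
    qPochhammerInf a q ≠ 0 := by
  refine qPochhammerInf_ne_zero hq fun j h => ?_
  have h1 : ‖a * q ^ j‖ < 1 := by
    rw [norm_mul, norm_pow]
    exact mul_lt_one_of_nonneg_of_lt_one_left (norm_nonneg a) ha
      (pow_le_one₀ (norm_nonneg q) hq.le)
  rw [h] at h1
  simp at h1

/-- Uniformity jointly in (a, q) is wanted: it yields holomorphy in a as well as the joint
continuity on which the extension by continuity in (z, τ) depends. -/
lemma hasProdLocallyUniformlyOn_qPochhammerInf :
    HasProdLocallyUniformlyOn (fun (j : ℕ) (p : ℂ × ℂ) => 1 - p.1 * p.2 ^ j)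
      (fun p => qPochhammerInf p.1 p.2) {p | ‖p.2‖ < 1} := by
  have ho : IsOpen {p : ℂ × ℂ | ‖p.2‖ < 1} :=
    isOpen_lt (continuous_snd.norm) continuous_const
  simp_rw [sub_eq_add_neg, qPochhammerInf]
  refine hasProdLocallyUniformlyOn_of_forall_compact ho fun K hK hc => ?_
  rcases K.eq_empty_or_nonempty with hN | hN
  · simpa [hasProdUniformlyOn_iff_tendstoUniformlyOn, hN] using tendstoUniformlyOn_empty
  · obtain ⟨p₀, hp₀, HB⟩ := hc.exists_isMaxOn hN
      (show ContinuousOn (fun p : ℂ × ℂ => ‖p.2‖) K by fun_prop)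
    obtain ⟨p₁, hp₁, HA⟩ := hc.exists_isMaxOn hN
      (show ContinuousOn (fun p : ℂ × ℂ => ‖p.1‖) K by fun_prop)
    have hs := (summable_geometric_of_lt_one (norm_nonneg p₀.2) (hK hp₀)).mul_left ‖p₁.1‖
    have := hs.hasProdUniformlyOn_nat_one_add
      (f := fun (j : ℕ) (p : ℂ × ℂ) => -(p.1 * p.2 ^ j)) hc (.of_forall fun n p hp ↦ ?_)
      (fun _ ↦ by fun_prop)
    · simpa [sub_eq_add_neg] using this
    · rw [norm_neg, norm_mul, norm_pow]
      have h1 : ‖p.2‖ ≤ ‖p₀.2‖ := HB hp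
      have h2 : ‖p.1‖ ≤ ‖p₁.1‖ := HA hp
      gcongr

lemma continuousOn_qPochhammerInf :
    ContinuousOn (fun p : ℂ × ℂ => qPochhammerInf p.1 p.2) {p | ‖p.2‖ < 1} := by
  refine (hasProdLocallyUniformlyOn_qPochhammerInf.tendstoLocallyUniformlyOn_finsetRange).continuousOn
    (Eventually.frequently (.of_forall fun n => ?_))
  fun_prop

lemma continuousAt_qPochhammerInf {p : ℂ × ℂ} (hp : ‖p.2‖ < 1) :
    ContinuousAt (fun p : ℂ × ℂ => qPochhammerInf p.1 p.2) p :=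
  continuousOn_qPochhammerInf.continuousAt
    ((isOpen_lt (continuous_snd.norm) continuous_const).mem_nhds hp)

lemma differentiable_qPochhammerInf (hq : ‖q‖ < 1) :
    Differentiable ℂ (fun a => qPochhammerInf a q) := by
  have h : TendstoLocallyUniformlyOn (fun (n : ℕ) (a : ℂ) => qPochhammer a q n)
      (fun a => qPochhammerInf a q) atTop Set.univ :=
    hasProdLocallyUniformlyOn_qPochhammerInf.tendstoLocallyUniformlyOn_finsetRange.comp
      (fun a : ℂ => (a, q)) (fun a _ => hq) (by fun_prop)
  refine differentiableOn_univ.1 (h.differentiableOn (.of_forall fun n => ?_) isOpen_univ)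
  unfold qPochhammer
  fun_prop

lemma continuous_qPochhammerInf (hq : ‖q‖ < 1) : Continuous (fun a => qPochhammerInf a q) :=
  (differentiable_qPochhammerInf hq).continuous

lemma one_sub_pow_succ_ne_zero (hq : ‖q‖ < 1) (n : ℕ) : 1 - q ^ (n + 1) ≠ 0 := by
  intro h
  have h1 : ‖q ^ (n + 1)‖ < 1 := by
    rw [norm_pow]; exact pow_lt_one₀ (norm_nonneg q) hq (by simp)
  rw [← sub_eq_zero.1 h] at h1
  simp at h1

lemma qPochhammer_self_ne_zero (hq : ‖q‖ < 1) (n : ℕ) : qPochhammer q q n ≠ 0 := by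
  refine Finset.prod_ne_zero_iff.2 fun i _ => ?_
  have := one_sub_pow_succ_ne_zero hq i
  rwa [pow_succ'] at this

lemma qPochhammer_succ (a q : ℂ) (n : ℕ) :
    qPochhammer a q (n + 1) = qPochhammer a q n * (1 - a * q ^ n) :=
  Finset.prod_range_succ _ _

lemma qPochhammer_self_succ (q : ℂ) (n : ℕ) :
    qPochhammer q q (n + 1) = qPochhammer q q n * (1 - q ^ (n + 1)) := by
  rw [qPochhammer_succ, pow_succ']

/-- The coefficients `∏_{i < n} (u - v q ^ i) / (1 - q ^ (i + 1))` of the homogeneous form of the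
`q`-binomial series. -/
noncomputable def qBinomialCoeff (u v q : ℂ) (n : ℕ) : ℂ :=
  (∏ i ∈ Finset.range n, (u - v * q ^ i)) / qPochhammer q q n

lemma qBinomialCoeff_succ_mul (u v : ℂ) (hq : ‖q‖ < 1) (n : ℕ) :
    qBinomialCoeff u v q (n + 1) * (1 - q ^ (n + 1)) = qBinomialCoeff u v q n * (u - v * q ^ n) := by
  unfold qBinomialCoeff
  rw [Finset.prod_range_succ, qPochhammer_self_succ]
  have := one_sub_pow_succ_ne_zero hq n
  have := qPochhammer_self_ne_zero hq n
  field_simp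

/-- Ratio test: since q^n → 0, the ratio of consecutive terms tends to u x. -/
lemma summable_norm_qBinomialCoeff {u v x : ℂ} (hq : ‖q‖ < 1) (hx : ‖u * x‖ < 1) :
    Summable fun n => ‖qBinomialCoeff u v q n * x ^ n‖ := by
  obtain ⟨r, hr1, hr2⟩ := exists_between hx
  have hpow : Tendsto (fun n : ℕ => q ^ n) atTop (𝓝 0) := tendsto_pow_atTop_nhds_zero_of_norm_lt_one hq
  have hlim : Tendsto (fun n : ℕ => ‖(u - v * q ^ n) / (1 - q ^ (n + 1)) * x‖) atTop
      (𝓝 ‖(u - v * 0) / (1 - 0) * x‖) := by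
    refine (Tendsto.mul_const _ (Tendsto.div ?_ ?_ (by simp))).norm
    · exact tendsto_const_nhds.sub (hpow.const_mul v)
    · exact tendsto_const_nhds.sub (hpow.comp (tendsto_add_atTop_nat 1))
  have hev := hlim.eventually_le_const (u := r) (by
    simp only [mul_zero, sub_zero, div_one]; exact hr1)
  refine summable_of_ratio_norm_eventually_le hr2 (hev.mono fun n hn => ?_)
  have h := qBinomialCoeff_succ_mul u v hq n
  rw [← eq_div_iff (one_sub_pow_succ_ne_zero hq n)] at h
  rw [h, norm_norm, norm_norm, pow_succ' x]
  calc ‖qBinomialCoeff u v q n * (u - v * q ^ n) / (1 - q ^ (n + 1)) * (x * x ^ n)‖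
      = ‖(u - v * q ^ n) / (1 - q ^ (n + 1)) * x‖ * ‖qBinomialCoeff u v q n * x ^ n‖ := by
        rw [← norm_mul]; congr 1; ring
    _ ≤ r * ‖qBinomialCoeff u v q n * x ^ n‖ := by gcongr

/-- The **`q`-binomial theorem**, in a homogeneous form. -/
theorem hasSum_qBinomialCoeff {u v x : ℂ} (hq : ‖q‖ < 1) (hx : ‖u * x‖ < 1) :
    HasSum (fun n => qBinomialCoeff u v q n * x ^ n)
      (qPochhammerInf (v * x) q / qPochhammerInf (u * x) q) := by
  have hsum : ∀ k : ℕ, Summable fun n => ‖qBinomialCoeff u v q n * (x * q ^ k) ^ n‖ := by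
    refine fun k => summable_norm_qBinomialCoeff hq ?_
    rw [← mul_assoc, norm_mul, norm_pow]
    exact mul_lt_one_of_nonneg_of_lt_one_left (norm_nonneg _) hx (pow_le_one₀ (norm_nonneg q) hq.le)
  set F : ℕ → ℂ := fun k => ∑' n, qBinomialCoeff u v q n * (x * q ^ k) ^ n with hF
  -- F k is the series evaluated at x q^k. The coefficient recursion becomes the q-difference
  -- equation (1 - ux) F(x) = (1 - vx) F(qx), which is iterated; the evaluation point then tends to
  -- 0, where the series is 1.
  have hrec : ∀ k, (1 - u * x * q ^ k) * F k = (1 - v * x * q ^ k) * F (k + 1) := by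
    intro k
    have h1 := (hsum k).of_norm
    have h2 := (hsum (k + 1)).of_norm
    have h3 : F k - F (k + 1) = x * q ^ k * (u * F k - v * F (k + 1)) := by
      simp only [hF]
      rw [← h1.tsum_sub h2, ← tsum_mul_left, ← tsum_mul_left,
        ← (h1.mul_left u).tsum_sub (h2.mul_left v), ← tsum_mul_left, (h1.sub h2).tsum_eq_zero_add]
      simp only [pow_zero, mul_one, sub_self, zero_add]
      refine tsum_congr fun n => ?_
      have h := qBinomialCoeff_succ_mul u v hq n
      linear_combination (x * q ^ k) ^ (n + 1) * h
    linear_combination h3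
  have hiter : ∀ k, qPochhammer (u * x) q k * F 0 = qPochhammer (v * x) q k * F k := by
    intro k
    induction k with
    | zero => simp [qPochhammer]
    | succ k ih =>
      rw [qPochhammer_succ, qPochhammer_succ]
      linear_combination (1 - u * x * q ^ k) * ih + qPochhammer (v * x) q k * hrec k
  have hlimF : Tendsto F atTop (𝓝 1) := by
    have h0 : (∑' n, qBinomialCoeff u v q n * (0 : ℂ) ^ n) = 1 := by
      rw [tsum_eq_single 0 (by intro n hn; simp [hn])]
      simp [qBinomialCoeff, qPochhammer]
    rw [← h0]
    refine tendsto_tsum_of_dominated_convergence (summable_norm_qBinomialCoeff (v := v) hq hx)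
      (fun n => ?_) (.of_forall fun k n => ?_)
    · refine Tendsto.const_mul _ (Tendsto.pow ?_ n)
      simpa using (tendsto_pow_atTop_nhds_zero_of_norm_lt_one hq).const_mul x
    · rw [norm_mul, norm_mul, norm_pow, norm_pow, norm_mul, norm_pow]
      gcongr
      exact mul_le_of_le_one_right (norm_nonneg x) (pow_le_one₀ (norm_nonneg q) hq.le)
  have hP : ∀ a : ℂ, Tendsto (fun k => qPochhammer a q k) atTop (𝓝 (qPochhammerInf a q)) :=
    fun a => (multipliable_one_sub_mul_pow a hq).hasProd.tendsto_prod_nat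
  have hlim := tendsto_nhds_unique ((hP (u * x)).mul_const (F 0))
    (((hP (v * x)).mul hlimF).congr fun k => (hiter k).symm)
  have hval : F 0 = qPochhammerInf (v * x) q / qPochhammerInf (u * x) q := by
    rw [eq_div_iff (qPochhammerInf_ne_zero_of_norm_lt_one hq hx)]
    linear_combination hlim
  rw [← hval]
  simpa [hF] using (hsum 0).of_norm.hasSum

/-- The homogeneous form contains both Euler expansions: (u, v) = (1, 0) here and (0, 1) in
`hasSum_qPochhammerInf`. The usual q-binomial theorem is (1, a). -/
lemma hasSum_pow_div_qPochhammer {x : ℂ} (hq : ‖q‖ < 1) (hx : ‖x‖ < 1) :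
    HasSum (fun n => x ^ n / qPochhammer q q n) (qPochhammerInf x q)⁻¹ := by
  have := hasSum_qBinomialCoeff (u := 1) (v := 0) (x := x) hq (by simpa using hx)
  simpa [qBinomialCoeff, div_eq_mul_inv, mul_comm] using this

lemma summable_norm_pow_div_qPochhammer {x : ℂ} (hq : ‖q‖ < 1) (hx : ‖x‖ < 1) :
    Summable (fun n => ‖x ^ n / qPochhammer q q n‖) := by
  have := summable_norm_qBinomialCoeff (u := 1) (v := 0) (x := x) hq (by simpa using hx)
  simpa [qBinomialCoeff, div_eq_mul_inv, mul_comm] using this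

lemma qBinomialCoeff_zero_one (q : ℂ) (n : ℕ) :
    qBinomialCoeff 0 1 q n = (-1) ^ n * q ^ (n.choose 2) / qPochhammer q q n := by
  have : (∏ i ∈ Finset.range n, ((0 : ℂ) - 1 * q ^ i)) = (-1) ^ n * q ^ (n.choose 2) := by
    induction n with
    | zero => simp
    | succ n ih =>
      rw [Finset.prod_range_succ, ih, Nat.choose_succ_succ' n 1, Nat.choose_one_right]
      ring
  rw [qBinomialCoeff, this]

lemma hasSum_qPochhammerInf (x : ℂ) (hq : ‖q‖ < 1) :
    HasSum (fun n => (-1) ^ n * q ^ (n.choose 2) / qPochhammer q q n * x ^ n)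
      (qPochhammerInf x q) := by
  have := hasSum_qBinomialCoeff (u := 0) (v := 1) (x := x) hq (by simp)
  simpa [qBinomialCoeff_zero_one] using this

lemma summable_norm_qPochhammerInf (x : ℂ) (hq : ‖q‖ < 1) :
    Summable (fun n => ‖(-1) ^ n * q ^ (n.choose 2) / qPochhammer q q n * x ^ n‖) := by
  have := summable_norm_qBinomialCoeff (u := 0) (v := 1) (x := x) hq (by simp)
  simpa [qBinomialCoeff_zero_one] using this

lemma hasSum_qBinomial {a x : ℂ} (hq : ‖q‖ < 1) (hx : ‖x‖ < 1) :
    HasSum (fun n => qPochhammer a q n / qPochhammer q q n * x ^ n)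
      (qPochhammerInf (a * x) q / qPochhammerInf x q) := by
  have := hasSum_qBinomialCoeff (u := 1) (v := a) (x := x) hq (by simpa using hx)
  simpa [qBinomialCoeff, qPochhammer] using this

end QSeries

/-! ### The Jacobi triple product for `jacobiTheta₂`. -/

section JacobiTriple

lemma norm_exp_two_pi_I_mul_lt_one {σ : ℂ} (hσ : 0 < σ.im) : ‖cexp (2 * Real.pi * I * σ)‖ < 1 := by
  rw [norm_exp, Real.exp_lt_one_iff]
  simp
  positivity

/-- The factor of index -(n+1) is 1 - 1. In the triple product this cuts a sum over ℤ down to ℕ. -/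
lemma qPochhammerInf_zpow_eq_zero {q : ℂ} (hq : ‖q‖ < 1) (hq0 : q ≠ 0) {n : ℤ} (hn : n < 0) :
    qPochhammerInf (q ^ (n + 1)) q = 0 := by
  obtain ⟨m, hm⟩ := Int.exists_eq_neg_ofNat (a := n + 1) (by omega)
  rw [qPochhammerInf_eq_zero_iff hq]
  refine ⟨m, ?_⟩
  rw [hm, zpow_neg, zpow_natCast, inv_mul_cancel₀ (pow_ne_zero _ hq0)]

lemma HasSum.mul_of_summable_norm {ι κ : Type*} {f : ι → ℂ} {g : κ → ℂ} {s t : ℂ}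
    (hf : HasSum f s) (hg : HasSum g t) (hf' : Summable fun i => ‖f i‖)
    (hg' : Summable fun k => ‖g k‖) : HasSum (fun p : ι × κ => f p.1 * g p.2) (s * t) :=
  hf.mul hg (summable_mul_of_summable_norm hf' hg')

/-- Theta is multiplied by Euler's series for 1/(y;q), which needs |y| < 1. After shearing the index
lattice, the inner sum is Euler's series for (q^(n+1);q), which vanishes for n < 0. For n ≥ 0 it
equals (q;q)/(q;q)_n, and the outer sum is again an Euler series. -/
lemma jacobiTheta₂_eq_of_norm_lt_one {w σ : ℂ} (hσ : 0 < σ.im)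
    (h : ‖cexp (Real.pi * I * σ - 2 * Real.pi * I * w)‖ < 1) :
    jacobiTheta₂ w σ = qPochhammerInf (cexp (2 * Real.pi * I * σ)) (cexp (2 * Real.pi * I * σ)) *
      qPochhammerInf (-cexp (Real.pi * I * σ + 2 * Real.pi * I * w)) (cexp (2 * Real.pi * I * σ)) *
      qPochhammerInf (-cexp (Real.pi * I * σ - 2 * Real.pi * I * w))
        (cexp (2 * Real.pi * I * σ)) := by
  have hq : ‖cexp (2 * Real.pi * I * σ)‖ < 1 := norm_exp_two_pi_I_mul_lt_one hσ
  have hq0 : cexp (2 * Real.pi * I * σ) ≠ 0 := exp_ne_zero _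
  generalize hqdef : cexp (2 * Real.pi * I * σ) = q at hq hq0 ⊢
  generalize hy : -cexp (Real.pi * I * σ - 2 * Real.pi * I * w) = y
  have hy1 : ‖y‖ < 1 := by rwa [← hy, norm_neg]
  have hθ : Summable fun k : ℤ => ‖jacobiTheta₂_term k w σ‖ :=
    ((summable_jacobiTheta₂_term_iff w σ).2 hσ).norm
  have hg := (hasSum_jacobiTheta₂_term w hσ).mul_of_summable_norm
    (hasSum_pow_div_qPochhammer hq hy1) hθ (summable_norm_pow_div_qPochhammer hq hy1)
  let e : ℤ × ℕ ≃ ℤ × ℕ :=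
    { toFun := fun p => (p.1 + p.2, p.2)
      invFun := fun p => (p.1 - p.2, p.2)
      left_inv := fun p => by simp
      right_inv := fun p => by simp }
  have hf : HasSum (fun p : ℤ × ℕ => jacobiTheta₂_term (p.1 + p.2) w σ *
      (y ^ p.2 / qPochhammer q q p.2)) (jacobiTheta₂ w σ * (qPochhammerInf y q)⁻¹) :=
    (Equiv.hasSum_iff e).2 hg
  have hterm : ∀ (n : ℤ) (m : ℕ), jacobiTheta₂_term n w σ *
      ((-1) ^ m * q ^ (m.choose 2) / qPochhammer q q m * (q ^ (n + 1)) ^ m) =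
      jacobiTheta₂_term (n + m) w σ * (y ^ m / qPochhammer q q m) := by
    intro n m
    have hch : q ^ (m.choose 2) * (q ^ (n + 1)) ^ m =
        cexp (Real.pi * I * σ * (m ^ 2 + m + 2 * n * m)) := by
      have h2 : ((m.choose 2 : ℕ) : ℂ) = m * (m - 1) / 2 := by
        rw [Nat.cast_choose_two]
      rw [← hqdef, ← exp_nat_mul, ← exp_int_mul, ← exp_nat_mul, ← exp_add, h2]
      congr 1
      push_cast
      ring
    have hym : y ^ m = (-1) ^ m * cexp (m * (Real.pi * I * σ - 2 * Real.pi * I * w)) := by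
      rw [← hy, neg_eq_neg_one_mul, mul_pow, exp_nat_mul]
    have : jacobiTheta₂_term n w σ * cexp (Real.pi * I * σ * (m ^ 2 + m + 2 * n * m)) =
        jacobiTheta₂_term (n + m) w σ * cexp (m * (Real.pi * I * σ - 2 * Real.pi * I * w)) := by
      rw [jacobiTheta₂_term, jacobiTheta₂_term, ← exp_add, ← exp_add]
      congr 1
      push_cast
      ring
    rw [hym]
    calc _ = (jacobiTheta₂_term n w σ * (q ^ (m.choose 2) * (q ^ (n + 1)) ^ m)) *
        ((-1) ^ m / qPochhammer q q m) := by ring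
      _ = _ := by rw [hch, this]; ring
  have hinner : ∀ n : ℤ, HasSum (fun m : ℕ => jacobiTheta₂_term (n + m) w σ *
      (y ^ m / qPochhammer q q m)) (jacobiTheta₂_term n w σ * qPochhammerInf (q ^ (n + 1)) q) :=
    fun n => by
      simp_rw [← hterm]
      exact (hasSum_qPochhammerInf (q ^ (n + 1)) hq).mul_left _
  have hZ : HasSum (fun n : ℤ => jacobiTheta₂_term n w σ * qPochhammerInf (q ^ (n + 1)) q)
      (jacobiTheta₂ w σ * (qPochhammerInf y q)⁻¹) := hf.prod_fiberwise hinner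
  have hN : HasSum (fun n : ℕ => jacobiTheta₂_term n w σ * qPochhammerInf (q ^ ((n : ℤ) + 1)) q)
      (jacobiTheta₂ w σ * (qPochhammerInf y q)⁻¹) := by
    refine (Function.Injective.hasSum_iff (g := fun n : ℕ => (n : ℤ))
      Nat.cast_injective fun n hn => ?_).2 hZ
    have hn0 : n < 0 := by
      by_contra! h0
      exact hn ⟨n.toNat, by simpa using h0⟩
    rw [qPochhammerInf_zpow_eq_zero hq hq0 hn0, mul_zero]
  have hE := (hasSum_qPochhammerInf (-cexp (Real.pi * I * σ + 2 * Real.pi * I * w)) hq).mul_left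
    (qPochhammerInf q q)
  have hcongr : ∀ n : ℕ, qPochhammerInf q q * ((-1) ^ n * q ^ (n.choose 2) / qPochhammer q q n *
      (-cexp (Real.pi * I * σ + 2 * Real.pi * I * w)) ^ n) =
      jacobiTheta₂_term n w σ * qPochhammerInf (q ^ ((n : ℤ) + 1)) q := by
    intro n
    have h1 := qPochhammerInf_eq_prod_mul q hq n
    have h2 : q ^ ((n : ℤ) + 1) = q * q ^ n := by
      rw [← pow_succ']; exact_mod_cast rfl
    have hne := qPochhammer_self_ne_zero hq n
    have h3 : jacobiTheta₂_term n w σ = (-1) ^ n * q ^ (n.choose 2) *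
        (-cexp (Real.pi * I * σ + 2 * Real.pi * I * w)) ^ n := by
      have h2 : ((n.choose 2 : ℕ) : ℂ) = n * (n - 1) / 2 := by
        rw [Nat.cast_choose_two]
      have hs : ((-1 : ℂ) ^ n) * (-1) ^ n = 1 := by rw [← mul_pow]; simp
      have hE : jacobiTheta₂_term n w σ = q ^ (n.choose 2) *
          cexp (Real.pi * I * σ + 2 * Real.pi * I * w) ^ n := by
        rw [← exp_nat_mul, ← hqdef, ← exp_nat_mul, ← exp_add, jacobiTheta₂_term, h2]
        congr 1
        push_cast
        ring
      rw [neg_pow (cexp _) n, hE]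
      linear_combination -(q ^ (n.choose 2) *
          cexp (Real.pi * I * σ + 2 * Real.pi * I * w) ^ n) * hs
    rw [h2, h3, h1]
    field_simp
  simp_rw [hcongr] at hE
  have heq := hN.unique hE
  rw [← heq, mul_assoc, inv_mul_cancel₀ (qPochhammerInf_ne_zero_of_norm_lt_one hq hy1), mul_one]

/-- The **Jacobi triple product** identity. -/
theorem jacobiTheta₂_eq_qPochhammerInf (w : ℂ) {σ : ℂ} (hσ : 0 < σ.im) :
    jacobiTheta₂ w σ = qPochhammerInf (cexp (2 * Real.pi * I * σ)) (cexp (2 * Real.pi * I * σ)) *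
      qPochhammerInf (-cexp (Real.pi * I * σ + 2 * Real.pi * I * w)) (cexp (2 * Real.pi * I * σ)) *
      qPochhammerInf (-cexp (Real.pi * I * σ - 2 * Real.pi * I * w))
        (cexp (2 * Real.pi * I * σ)) := by
  -- Theta is even and the right-hand side is symmetric under w ↦ -w; the smallness condition holds
  -- for at least one of w and -w.
  rcases le_total 0 (-w.im) with hw | hw
  · refine jacobiTheta₂_eq_of_norm_lt_one hσ ?_
    rw [norm_exp, Real.exp_lt_one_iff]
    simp
    nlinarith [Real.pi_pos]
  · have := jacobiTheta₂_eq_of_norm_lt_one (w := -w) hσ (by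
      rw [norm_exp, Real.exp_lt_one_iff]
      simp
      nlinarith [Real.pi_pos])
    rw [← jacobiTheta₂_neg_left, this, mul_right_comm]
    congr 4 <;> ring_nf

end JacobiTriple
-- The reflection formula of the τ-shifted factorial.
section Reflection

/-- The midpoint `1/2 + 1/(2τ)` of the strip of holomorphy of the `τ`-shifted factorial. -/
noncomputable def tauCenter (τ : ℂ) : ℂ := 1 / 2 + 1 / (2 * τ)

/-- The constant `q ^ (-1/24) q̃ ^ (1/24)`. -/
noncomputable def tauConst (τ : ℂ) : ℂ := qPow τ (-1 / 24) * qTildePow τ (1 / 24)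

variable {τ : ℂ}

lemma ne_zero_of_im_pos (hτ : 0 < τ.im) : τ ≠ 0 := by
  rintro rfl; simp at hτ

lemma neg_one_div_im_pos (hτ : 0 < τ.im) : 0 < (-1 / τ).im := by
  rw [neg_div, neg_im, one_div, inv_im, neg_div, neg_neg]
  exact div_pos hτ (normSq_pos.2 (ne_zero_of_im_pos hτ))

lemma qPow_one_eq (τ : ℂ) : qPow τ 1 = cexp (2 * Real.pi * I * τ) := by
  rw [qPow, mul_one]

lemma qTildePow_one_eq (τ : ℂ) : qTildePow τ 1 = cexp (2 * Real.pi * I * (-1 / τ)) := by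
  rw [qTildePow]; congr 1; ring

lemma norm_qPow_one_lt_one (hτ : 0 < τ.im) : ‖qPow τ 1‖ < 1 := by
  rw [qPow_one_eq]; exact norm_exp_two_pi_I_mul_lt_one hτ

lemma norm_qTildePow_one_lt_one (hτ : 0 < τ.im) : ‖qTildePow τ 1‖ < 1 := by
  rw [qTildePow_one_eq]; exact norm_exp_two_pi_I_mul_lt_one (neg_one_div_im_pos hτ)

lemma qPow_add (τ u v : ℂ) : qPow τ (u + v) = qPow τ u * qPow τ v := by
  rw [qPow, qPow, qPow, ← exp_add]; congr 1; ring

lemma qPow_ne_zero (τ u : ℂ) : qPow τ u ≠ 0 := exp_ne_zero _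

lemma qTildePow_ne_zero (τ u : ℂ) : qTildePow τ u ≠ 0 := exp_ne_zero _

lemma tauConst_ne_zero (τ : ℂ) : tauConst τ ≠ 0 :=
  mul_ne_zero (qPow_ne_zero _ _) (qTildePow_ne_zero _ _)

/-- As arg τ lies in [0, π], dividing by i does not cross the branch cut, so the logarithms simply
subtract. -/
lemma sqrt_I_inv_mul_sqrt (hτ : 0 < τ.im) :
    (sqrt I)⁻¹ * sqrt τ = (-I * τ) ^ (1 / 2 : ℂ) := by
  have hτ0 := ne_zero_of_im_pos hτ
  have hlog : log (-I * τ) = -(Real.pi / 2 * I) + log τ := by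
    rw [Complex.log_mul (by simp) hτ0, Complex.log_neg_I]
    · ring
    · rw [Complex.arg_neg_I]
      have h1 := Complex.arg_nonneg_iff.2 hτ.le
      have h2 := Complex.arg_le_pi τ
      constructor <;> linarith [Real.pi_pos]
  rw [sqrt_eq_exp I_ne_zero, sqrt_eq_exp hτ0, cpow_def_of_ne_zero (by simp [hτ0]), hlog, log_I,
    ← exp_neg, ← exp_add]
  congr 1
  ring

lemma eta_eq_exp_mul_qPochhammerInf (σ : ℂ) :
    ModularForm.eta σ = cexp (2 * Real.pi * I * σ / 24) *
      qPochhammerInf (cexp (2 * Real.pi * I * σ)) (cexp (2 * Real.pi * I * σ)) := by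
  rw [ModularForm.eta, Function.Periodic.qParam, qPochhammerInf]
  congr 1
  refine tprod_congr fun n => ?_
  rw [ModularForm.eta_q_eq_pow, pow_succ']

/-- The modular transformation of `(q; q)_∞`. -/
lemma qPochhammerInf_qTildePow_one (hτ : 0 < τ.im) :
    tauConst τ * qPochhammerInf (qTildePow τ 1) (qTildePow τ 1) =
      (-I * τ) ^ (1 / 2 : ℂ) * qPochhammerInf (qPow τ 1) (qPow τ 1) := by
  have h := ModularForm.eta_comp_eq_csqrt_I_inv (x := τ) hτ
  simp only [Function.comp, Pi.smul_apply, Pi.mul_apply, smul_eq_mul] at h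
  rw [← mul_assoc, sqrt_I_inv_mul_sqrt hτ, eta_eq_exp_mul_qPochhammerInf,
    eta_eq_exp_mul_qPochhammerInf, ← qTildePow_one_eq, ← qPow_one_eq] at h
  have h1 : qTildePow τ (1 / 24) = cexp (2 * Real.pi * I * (-1 / τ) / 24) := by
    rw [qTildePow]; congr 1; ring
  have h2 : qPow τ (-1 / 24) * cexp (2 * Real.pi * I * τ / 24) = 1 := by
    rw [qPow, ← exp_add]; convert exp_zero using 2; ring
  rw [tauConst, h1, mul_assoc, h]
  linear_combination (-I * τ) ^ (1 / 2 : ℂ) * qPochhammerInf (qPow τ 1) (qPow τ 1) * h2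

/-- The centre is chosen so that the arguments of the products become those of the triple product,
with modulus -1/τ and variable z here, and with modulus τ and variable τz in `qPow_center_add`. -/
lemma exp_center_add (hτ : 0 < τ.im) (z : ℂ) :
    cexp (-(2 * Real.pi * I * (tauCenter τ + z))) =
      -cexp (Real.pi * I * (-1 / τ) - 2 * Real.pi * I * z) := by
  have hτ0 := ne_zero_of_im_pos hτ
  have h : -(2 * Real.pi * I * (tauCenter τ + z)) =
      (Real.pi * I * (-1 / τ) - 2 * Real.pi * I * z) - Real.pi * I := by
    rw [tauCenter]; field_simp; ring
  rw [h, exp_sub, exp_pi_mul_I]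
  ring

lemma qPow_center_add (hτ : 0 < τ.im) (z : ℂ) :
    qPow τ (tauCenter τ + z) = -cexp (Real.pi * I * τ + 2 * Real.pi * I * (τ * z)) := by
  have hτ0 := ne_zero_of_im_pos hτ
  have h : 2 * Real.pi * I * τ * (tauCenter τ + z) =
      (Real.pi * I * τ + 2 * Real.pi * I * (τ * z)) + Real.pi * I := by
    rw [tauCenter]; field_simp; ring
  rw [qPow, h, exp_add, exp_pi_mul_I]
  ring

/-- The reflection formula for the `τ`-shifted factorial, with denominators cleared. -/
theorem tauNumerator_mul_tauNumerator (hτ : 0 < τ.im) (z : ℂ) :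
    tauNumerator (tauCenter τ + z) τ * tauNumerator (tauCenter τ - z) τ =
      tauConst τ * cexp (Real.pi * I * τ * z ^ 2) *
        (tauDenominator (tauCenter τ + z) τ * tauDenominator (tauCenter τ - z) τ) := by
  have hτ0 := ne_zero_of_im_pos hτ
  -- At the argument τz the functional equation compares modulus τ at τz with modulus -1/τ at z. The
  -- triple product turns the two sides into denominators and numerators, and the remaining quotient
  -- of (q;q) and (q̃;q̃) is known from eta.
  have hfe := jacobiTheta₂_functional_equation (τ * z) τ
  rw [jacobiTheta₂_eq_qPochhammerInf _ hτ, mul_div_cancel_left₀ _ hτ0,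
    jacobiTheta₂_eq_qPochhammerInf _ (neg_one_div_im_pos hτ)] at hfe
  have hN := qPochhammerInf_qTildePow_one hτ
  have e1 := exp_center_add hτ z
  have e2 := exp_center_add hτ (-z)
  have e3 := qPow_center_add hτ z
  have e4 := qPow_center_add hτ (-z)
  rw [← sub_eq_add_neg] at e2 e4
  have s2 : Real.pi * I * (-1 / τ) - 2 * Real.pi * I * -z =
    Real.pi * I * (-1 / τ) + 2 * Real.pi * I * z := by ring
  have s4 : Real.pi * I * τ + 2 * Real.pi * I * (τ * -z) =
    Real.pi * I * τ - 2 * Real.pi * I * (τ * z) := by ring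
  rw [s2] at e2
  rw [s4] at e4
  rw [← e1, ← e2, ← e3, ← e4, ← qTildePow_one_eq, ← qPow_one_eq] at hfe
  have hsq : (-I * τ) ^ (1 / 2 : ℂ) ≠ 0 := by
    rw [cpow_def_of_ne_zero (by simp [hτ0])]; exact exp_ne_zero _
  have hqq := qPochhammerInf_ne_zero_of_norm_lt_one (norm_qPow_one_lt_one hτ)
    (norm_qPow_one_lt_one hτ)
  have hqt := qPochhammerInf_ne_zero_of_norm_lt_one (norm_qTildePow_one_lt_one hτ)
    (norm_qTildePow_one_lt_one hτ)
  have hexp : cexp (-Real.pi * I * (τ * z) ^ 2 / τ) * cexp (Real.pi * I * τ * z ^ 2) = 1 := by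
    rw [← exp_add, ← exp_zero]; congr 1; field_simp; ring
  change qPochhammerInf (qPow τ 1) (qPow τ 1) * tauDenominator (tauCenter τ + z) τ *
    tauDenominator (tauCenter τ - z) τ = 1 / (-I * τ) ^ (1 / 2 : ℂ) *
    cexp (-Real.pi * I * (τ * z) ^ 2 / τ) * (qPochhammerInf (qTildePow τ 1) (qTildePow τ 1) *
    tauNumerator (tauCenter τ - z) τ * tauNumerator (tauCenter τ + z) τ) at hfe
  generalize qPochhammerInf (qPow τ 1) (qPow τ 1) = A at *
  generalize qPochhammerInf (qTildePow τ 1) (qTildePow τ 1) = B at *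
  generalize (-I * τ) ^ (1 / 2 : ℂ) = s at *
  generalize tauNumerator (tauCenter τ - z) τ = n1 at *
  generalize tauNumerator (tauCenter τ + z) τ = n2 at *
  generalize tauDenominator (tauCenter τ - z) τ = d1 at *
  generalize tauDenominator (tauCenter τ + z) τ = d2 at *
  generalize cexp (-Real.pi * I * (τ * z) ^ 2 / τ) = x at *
  generalize cexp (Real.pi * I * τ * z ^ 2) = y at *
  field_simp at hfe
  have : s * A * (n2 * n1) = s * A * (tauConst τ * y * (d2 * d1)) := by
    linear_combination -(n2 * n1) * hN - tauConst τ * y * hfe -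
      n1 * n2 * tauConst τ * B * hexp
  exact mul_left_cancel₀ (mul_ne_zero hsq hqq) this

end Reflection

/-! ### Zeros, difference equations and removable singularities of the factorial for Im τ > 0. -/

section ZerosAndShifts

variable {τ : ℂ}

lemma exp_neg_two_pi_I_mul_mul_pow (τ z : ℂ) (j : ℕ) :
    cexp (-(2 * Real.pi * I * z)) * qTildePow τ 1 ^ j =
      cexp (-(2 * Real.pi * I * (z + j / τ))) := by
  rw [qTildePow, ← exp_nat_mul, ← exp_add]; congr 1; ring

lemma qPow_mul_pow (τ z : ℂ) (k : ℕ) : qPow τ z * qPow τ 1 ^ k = qPow τ (z + k) := by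
  rw [qPow, qPow, qPow, ← exp_nat_mul, ← exp_add]; congr 1; ring

lemma exp_neg_two_pi_I_mul_eq_one_iff (w : ℂ) :
    cexp (-(2 * Real.pi * I * w)) = 1 ↔ ∃ m : ℤ, w = m := by
  rw [exp_eq_one_iff]
  have h : (2 * Real.pi * I : ℂ) ≠ 0 := two_pi_I_ne_zero
  constructor
  · rintro ⟨n, hn⟩
    refine ⟨-n, mul_left_cancel₀ h ?_⟩
    push_cast
    linear_combination -hn
  · rintro ⟨m, rfl⟩
    exact ⟨-m, by push_cast; ring⟩

lemma qPow_eq_one_iff (hτ0 : τ ≠ 0) (w : ℂ) : qPow τ w = 1 ↔ ∃ m : ℤ, w = m / τ := by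
  rw [qPow, exp_eq_one_iff]
  have h : (2 * Real.pi * I : ℂ) ≠ 0 := two_pi_I_ne_zero
  constructor
  · rintro ⟨n, hn⟩
    refine ⟨n, ?_⟩
    rw [eq_div_iff hτ0]
    refine mul_left_cancel₀ h ?_
    linear_combination hn
  · rintro ⟨m, rfl⟩
    exact ⟨m, by field_simp⟩

lemma tauNumerator_eq_zero_iff (hτ : 0 < τ.im) (z : ℂ) :
    tauNumerator z τ = 0 ↔ ∃ (j : ℕ) (m : ℤ), z = m - j / τ := by
  rw [tauNumerator, qPochhammerInf_eq_zero_iff (norm_qTildePow_one_lt_one hτ)]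
  simp_rw [exp_neg_two_pi_I_mul_mul_pow, exp_neg_two_pi_I_mul_eq_one_iff, eq_sub_iff_add_eq]

lemma tauDenominator_eq_zero_iff (hτ : 0 < τ.im) (z : ℂ) :
    tauDenominator z τ = 0 ↔ ∃ (k : ℕ) (n : ℤ), z = -k + n / τ := by
  rw [tauDenominator, qPochhammerInf_eq_zero_iff (norm_qPow_one_lt_one hτ)]
  simp_rw [qPow_mul_pow, qPow_eq_one_iff (ne_zero_of_im_pos hτ), neg_add_eq_sub, eq_sub_iff_add_eq]

lemma exp_neg_two_pi_I_mul_add_int (z : ℂ) (m : ℤ) :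
    cexp (-(2 * Real.pi * I * (z + m))) = cexp (-(2 * Real.pi * I * z)) := by
  rw [exp_eq_exp_iff_exists_int]
  exact ⟨-m, by push_cast; ring⟩

lemma qPow_add_int_div (hτ0 : τ ≠ 0) (z : ℂ) (m : ℤ) : qPow τ (z + m / τ) = qPow τ z := by
  rw [qPow, qPow, exp_eq_exp_iff_exists_int]
  exact ⟨m, by field_simp⟩

lemma tauNumerator_add_int (z τ : ℂ) (m : ℤ) : tauNumerator (z + m) τ = tauNumerator z τ := by
  rw [tauNumerator, tauNumerator, exp_neg_two_pi_I_mul_add_int]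

lemma tauDenominator_add_int_div (hτ0 : τ ≠ 0) (z : ℂ) (m : ℤ) :
    tauDenominator (z + m / τ) τ = tauDenominator z τ := by
  rw [tauDenominator, tauDenominator, qPow_add_int_div hτ0]

lemma tauNumerator_eq_mul (hτ : 0 < τ.im) (z : ℂ) :
    tauNumerator z τ = (1 - cexp (-(2 * Real.pi * I * z))) * tauNumerator (z + 1 / τ) τ := by
  have h := exp_neg_two_pi_I_mul_mul_pow τ z 1
  rw [pow_one, Nat.cast_one] at h
  rw [tauNumerator, tauNumerator, qPochhammerInf_eq_one_sub_mul _ (norm_qTildePow_one_lt_one hτ), h]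

lemma tauDenominator_eq_mul (hτ : 0 < τ.im) (z : ℂ) :
    tauDenominator z τ = (1 - qPow τ z) * tauDenominator (z + 1) τ := by
  rw [tauDenominator, tauDenominator, qPochhammerInf_eq_one_sub_mul _ (norm_qPow_one_lt_one hτ),
    qPow_add]

lemma differentiable_tauNumerator (hτ : 0 < τ.im) : Differentiable ℂ (tauNumerator · τ) := by
  refine (differentiable_qPochhammerInf (norm_qTildePow_one_lt_one hτ)).comp ?_
  fun_prop

lemma differentiable_qPow (τ : ℂ) : Differentiable ℂ (qPow τ) := by
  unfold qPow; fun_prop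

lemma differentiable_tauDenominator (hτ : 0 < τ.im) : Differentiable ℂ (tauDenominator · τ) :=
  (differentiable_qPochhammerInf (norm_qPow_one_lt_one hτ)).comp (differentiable_qPow τ)

lemma continuousAt_qTildePow_one {z τ : ℂ} (hτ0 : τ ≠ 0) :
    ContinuousAt (fun p : ℂ × ℂ => qTildePow p.2 1) (z, τ) := by
  unfold qTildePow
  refine ContinuousAt.cexp (ContinuousAt.neg (ContinuousAt.div (by fun_prop) (by fun_prop) hτ0))

lemma continuous_qPow_one : Continuous (fun p : ℂ × ℂ => qPow p.2 1) := by
  unfold qPow; fun_prop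

lemma continuous_qPow : Continuous (fun p : ℂ × ℂ => qPow p.2 p.1) := by
  unfold qPow; fun_prop

lemma continuousAt_tauNumerator (hτ : 0 < τ.im) (z : ℂ) :
    ContinuousAt (fun p : ℂ × ℂ => tauNumerator p.1 p.2) (z, τ) := by
  refine (continuousAt_qPochhammerInf
    (p := (cexp (-(2 * Real.pi * I * z)), qTildePow τ 1)) (norm_qTildePow_one_lt_one hτ)).comp_of_eq
    (f := fun p : ℂ × ℂ => (cexp (-(2 * Real.pi * I * p.1)), qTildePow p.2 1)) ?_ rfl
  exact ContinuousAt.prodMk (by fun_prop) (continuousAt_qTildePow_one (ne_zero_of_im_pos hτ))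

lemma continuousAt_tauDenominator (hτ : 0 < τ.im) (z : ℂ) :
    ContinuousAt (fun p : ℂ × ℂ => tauDenominator p.1 p.2) (z, τ) := by
  refine (continuousAt_qPochhammerInf
    (p := (qPow τ z, qPow τ 1)) (norm_qPow_one_lt_one hτ)).comp_of_eq
    (f := fun p : ℂ × ℂ => (qPow p.2 p.1, qPow p.2 1)) ?_ rfl
  exact ContinuousAt.prodMk continuous_qPow.continuousAt continuous_qPow_one.continuousAt

lemma countable_tauNumerator_eq_zero (hτ : 0 < τ.im) : {z | tauNumerator z τ = 0}.Countable := by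
  refine (Set.countable_range (fun p : ℕ × ℤ => (p.2 - p.1 / τ : ℂ))).mono fun z hz => ?_
  obtain ⟨j, m, h⟩ := (tauNumerator_eq_zero_iff hτ z).1 hz
  exact ⟨(j, m), h.symm⟩

lemma countable_tauDenominator_eq_zero (hτ : 0 < τ.im) :
    {z | tauDenominator z τ = 0}.Countable := by
  refine (Set.countable_range (fun p : ℕ × ℤ => (-p.1 + p.2 / τ : ℂ))).mono fun z hz => ?_
  obtain ⟨j, m, h⟩ := (tauDenominator_eq_zero_iff hτ z).1 hz
  exact ⟨(j, m), h.symm⟩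

lemma eventually_tauDenominator_ne_zero (hτ : 0 < τ.im) (z : ℂ) :
    ∀ᶠ w in 𝓝[≠] z, tauDenominator w τ ≠ 0 := by
  have han : AnalyticOnNhd ℂ (tauDenominator · τ) Set.univ :=
    (differentiable_tauDenominator hτ).differentiableOn.analyticOnNhd isOpen_univ
  rcases (han z trivial).eventually_eq_zero_or_eventually_ne_zero with h | h
  · have h0 := han.eqOn_zero_of_preconnected_of_eventuallyEq_zero isPreconnected_univ trivial h
    have huniv : {z | tauDenominator z τ = 0} = Set.univ :=
      Set.eq_univ_of_forall fun w => h0 (Set.mem_univ w)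
    have := countable_tauDenominator_eq_zero hτ
    rw [huniv] at this
    exact absurd this not_countable_complex
  · exact h

lemma mem_closure_tauProductDomain_of_im_pos (hτ : 0 < τ.im) (z : ℂ) :
    (z, τ) ∈ closure tauProductDomain := by
  have h := ((countable_tauDenominator_eq_zero hτ).dense_compl ℝ) z
  refine map_mem_closure (f := fun w : ℂ => (w, τ)) (by fun_prop) h fun w hw => ⟨hτ, hw⟩

/-- Density of the domain is what makes the value of `extendFrom` determined by a limit; real τ is
reached through upper half plane points, which are themselves limits of the domain. -/
lemma mem_closure_tauProductDomain (hτ : 0 ≤ τ.im) (z : ℂ) :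
    (z, τ) ∈ closure tauProductDomain := by
  have h : τ ∈ closure {σ : ℂ | 0 < σ.im} := by
    rw [closure_setOfPred_lt_im]; exact hτ
  rw [← closure_closure]
  exact map_mem_closure (f := fun σ : ℂ => (z, σ)) (by fun_prop) h
    fun σ hσ => mem_closure_tauProductDomain_of_im_pos hσ z

lemma tauFactorial_eq_of_tendsto (hτ : 0 ≤ τ.im) {z y : ℂ}
    (h : Tendsto (fun p : ℂ × ℂ => tauNumerator p.1 p.2 / tauDenominator p.1 p.2)
      (𝓝[tauProductDomain] (z, τ)) (𝓝 y)) : tauFactorial z τ = y :=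
  extendFrom_eq (mem_closure_tauProductDomain hτ z) h

lemma tauFactorial_eq_div (hτ : 0 < τ.im) {z : ℂ} (hz : tauDenominator z τ ≠ 0) :
    tauFactorial z τ = tauNumerator z τ / tauDenominator z τ :=
  tauFactorial_eq_of_tendsto hτ.le <|
    (((continuousAt_tauNumerator hτ z).div (continuousAt_tauDenominator hτ z) hz).tendsto).mono_left
      nhdsWithin_le_nhds

/-- The poles `-k + n/τ`, `k ≥ 0`, `n ≥ 1`, of the `τ`-shifted factorial. -/
def IsTauPole (z τ : ℂ) : Prop := ∃ k n : ℕ, z = -k + (n + 1) / τ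

/-- `(exp u - 1) / u`, continued to `u = 0`. -/
noncomputable def expSlope (u : ℂ) : ℂ := dslope cexp 0 u

lemma mul_expSlope (u : ℂ) : u * expSlope u = cexp u - 1 := by
  have := sub_smul_dslope cexp 0 u
  simpa [expSlope] using this

lemma differentiable_expSlope : Differentiable ℂ expSlope := by
  rw [← differentiableOn_univ]
  exact (Complex.differentiableOn_dslope (by simp)).2 differentiable_exp.differentiableOn

lemma expSlope_zero : expSlope 0 = 1 := by simp [expSlope]

/-- Near the removable singularity `-k - j/τ` this function agrees with the `τ`-shifted
factorial. -/
noncomputable def tauRegular (k j : ℕ) (p : ℂ × ℂ) : ℂ :=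
  (-1 / p.2) * (expSlope (-(2 * Real.pi * I * (p.1 + k + j / p.2))) /
      expSlope (2 * Real.pi * I * p.2 * (p.1 + k + j / p.2))) *
    (qPochhammer (cexp (-(2 * Real.pi * I * p.1))) (qTildePow p.2 1) j *
      tauNumerator (p.1 + (j + 1) / p.2) p.2) /
    (qPochhammer (qPow p.2 p.1) (qPow p.2 1) k * tauDenominator (p.1 + (k + 1)) p.2)

lemma tauNumerator_eq_prod_mul (hτ : 0 < τ.im) (z : ℂ) (j : ℕ) :
    tauNumerator z τ = qPochhammer (cexp (-(2 * Real.pi * I * z))) (qTildePow τ 1) j *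
      tauNumerator (z + j / τ) τ := by
  rw [tauNumerator, tauNumerator, ← exp_neg_two_pi_I_mul_mul_pow]
  exact qPochhammerInf_eq_prod_mul _ (norm_qTildePow_one_lt_one hτ) j

lemma tauDenominator_eq_prod_mul (hτ : 0 < τ.im) (z : ℂ) (k : ℕ) :
    tauDenominator z τ = qPochhammer (qPow τ z) (qPow τ 1) k * tauDenominator (z + k) τ := by
  rw [tauDenominator, tauDenominator, ← qPow_mul_pow]
  exact qPochhammerInf_eq_prod_mul _ (norm_qPow_one_lt_one hτ) k

/-- At -k - j/τ the j-th factor of the numerator and the k-th factor of the denominator vanish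
together. With w = z + k + j/τ they are, by periodicity, 1 - exp(-2πiw) and 1 - exp(2πiτw), whose
quotient is -1/τ times a quotient of values of `expSlope`. -/
lemma div_eq_tauRegular (hτ : 0 < τ.im) {z : ℂ} (hz : tauDenominator z τ ≠ 0) (k j : ℕ) :
    tauNumerator z τ / tauDenominator z τ = tauRegular k j (z, τ) := by
  have hτ0 := ne_zero_of_im_pos hτ
  have hN : tauNumerator z τ = qPochhammer (cexp (-(2 * Real.pi * I * z))) (qTildePow τ 1) j *
      (-(-(2 * Real.pi * I * (z + k + j / τ)) * expSlope (-(2 * Real.pi * I * (z + k + j / τ)))) *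
        tauNumerator (z + (j + 1) / τ) τ) := by
    have h1 := exp_neg_two_pi_I_mul_add_int (z + j / τ) k
    have h2 : z + j / τ + (k : ℤ) = z + k + j / τ := by push_cast; ring
    rw [h2] at h1
    rw [mul_expSlope, h1, tauNumerator_eq_prod_mul hτ z j, tauNumerator_eq_mul hτ (z + j / τ)]
    congr 2
    · ring
    · congr 1; ring
  have hD : tauDenominator z τ = qPochhammer (qPow τ z) (qPow τ 1) k *
      (-((2 * Real.pi * I * τ * (z + k + j / τ)) * expSlope (2 * Real.pi * I * τ * (z + k + j / τ)))
        * tauDenominator (z + (k + 1)) τ) := by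
    have h1 := qPow_add_int_div hτ0 (z + k) j
    have h2 : z + k + (j : ℤ) / τ = z + k + j / τ := by push_cast; ring
    rw [h2, qPow] at h1
    rw [mul_expSlope, h1, tauDenominator_eq_prod_mul hτ z k, tauDenominator_eq_mul hτ (z + k)]
    congr 2
    · ring
    · congr 1; ring
  have hz' := hz
  rw [hD] at hz'
  simp only [mul_ne_zero_iff, neg_ne_zero] at hz'
  obtain ⟨h1, ⟨⟨⟨⟨-, h2⟩, h3⟩, h4⟩⟩, h5⟩ := hz'
  rw [tauRegular, hN, hD]
  have h6 := two_pi_I_ne_zero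
  simp only
  generalize expSlope (-(2 * Real.pi * I * (z + k + j / τ))) = e1 at *
  generalize expSlope (2 * Real.pi * I * τ * (z + k + j / τ)) = e2 at *
  generalize z + k + j / τ = w at *
  field_simp

lemma isTauPole_or_of_tauDenominator_eq_zero (hτ : 0 < τ.im) {z : ℂ}
    (hz : tauDenominator z τ = 0) (hp : ¬ IsTauPole z τ) : ∃ k j : ℕ, z = -k - j / τ := by
  obtain ⟨k, n, rfl⟩ := (tauDenominator_eq_zero_iff hτ z).1 hz
  rcases le_or_gt n 0 with hn | hn
  · obtain ⟨j, rfl⟩ := Int.exists_eq_neg_ofNat hn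
    exact ⟨k, j, by push_cast; ring⟩
  · obtain ⟨m, rfl⟩ := Int.eq_succ_of_zero_lt hn
    exact absurd ⟨k, m, by push_cast; ring⟩ hp

/-- Here q^(z+k) = 1, so the finite product has the factors 1 - q^(i-k) with i < k, none zero, and
the infinite one is (q;q). -/
lemma tauRegular_denom_ne_zero (hτ : 0 < τ.im) {z : ℂ} {k j : ℕ} (hz : z = -k - j / τ) :
    qPochhammer (qPow τ z) (qPow τ 1) k * tauDenominator (z + (k + 1)) τ ≠ 0 := by
  have hτ0 := ne_zero_of_im_pos hτ
  have hq := norm_qPow_one_lt_one hτ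
  have hone : qPow τ (z + k) = 1 := by
    rw [qPow_eq_one_iff hτ0]; exact ⟨-j, by rw [hz]; push_cast; ring⟩
  have hz' : qPow τ z = qPow τ (-k) := by
    have h1 : qPow τ z * qPow τ k = 1 := by rw [← qPow_add, hone]
    have h2 : qPow τ (-k) * qPow τ k = 1 := by rw [← qPow_add]; simp [qPow]
    exact mul_right_cancel₀ (qPow_ne_zero τ k) (h1.trans h2.symm)
  refine mul_ne_zero (Finset.prod_ne_zero_iff.2 fun i hi h => ?_) ?_
  · have hi' : i < k := Finset.mem_range.1 hi
    rw [qPow_mul_pow, sub_eq_zero] at h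
    have h3 : qPow τ (z + k) = qPow τ (z + i) * qPow τ 1 ^ (k - i) := by
      rw [qPow_mul_pow, Nat.cast_sub hi'.le]; congr 1; ring
    rw [hone, ← h, one_mul] at h3
    have : ‖qPow τ 1 ^ (k - i)‖ < 1 := by
      rw [norm_pow]; exact pow_lt_one₀ (norm_nonneg _) hq (by omega)
    rw [← h3] at this
    simp at this
  · rw [tauDenominator, ← add_assoc, qPow_add, hone, one_mul]
    exact qPochhammerInf_ne_zero_of_norm_lt_one hq hq

lemma differentiable_qPochhammer (q : ℂ) (n : ℕ) : Differentiable ℂ (fun a => qPochhammer a q n) := by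
  unfold qPochhammer; fun_prop

lemma continuous_qPochhammer (n : ℕ) : Continuous (fun p : ℂ × ℂ => qPochhammer p.1 p.2 n) := by
  unfold qPochhammer; fun_prop

lemma continuousAt_tauRegular (hτ : 0 < τ.im) {z : ℂ} {k j : ℕ} (hz : z = -k - j / τ) :
    ContinuousAt (tauRegular k j) (z, τ) := by
  have hτ0 := ne_zero_of_im_pos hτ
  have hw : ContinuousAt (fun p : ℂ × ℂ => p.1 + k + j / p.2) (z, τ) :=
    ContinuousAt.add (by fun_prop) (ContinuousAt.div (by fun_prop) (by fun_prop) hτ0)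
  have hw0 : z + k + j / τ = 0 := by rw [hz]; ring
  unfold tauRegular
  refine ContinuousAt.div (ContinuousAt.mul (ContinuousAt.mul ?_ ?_) (ContinuousAt.mul ?_ ?_))
    (ContinuousAt.mul ?_ ?_) (tauRegular_denom_ne_zero hτ hz)
  · exact ContinuousAt.div (by fun_prop) (by fun_prop) hτ0
  · refine ContinuousAt.div ?_ ?_ ?_
    · exact differentiable_expSlope.continuous.continuousAt.comp (hw.const_mul _).neg
    · refine differentiable_expSlope.continuous.continuousAt.comp ?_
      exact ContinuousAt.mul (by fun_prop) hw
    · simp only [hw0, mul_zero, expSlope_zero]; exact one_ne_zero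
  · exact (continuous_qPochhammer j).continuousAt.comp
      (f := fun p : ℂ × ℂ => (cexp (-(2 * Real.pi * I * p.1)), qTildePow p.2 1))
      (ContinuousAt.prodMk (by fun_prop) (continuousAt_qTildePow_one hτ0))
  · refine (continuousAt_tauNumerator hτ (z + (j + 1) / τ)).comp_of_eq
      (f := fun p : ℂ × ℂ => (p.1 + (j + 1) / p.2, p.2)) ?_ rfl
    exact ContinuousAt.prodMk (ContinuousAt.add (by fun_prop)
      (ContinuousAt.div (by fun_prop) (by fun_prop) hτ0)) (by fun_prop)
  · exact (continuous_qPochhammer k).continuousAt.comp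
      (f := fun p : ℂ × ℂ => (qPow p.2 p.1, qPow p.2 1))
      (ContinuousAt.prodMk continuous_qPow.continuousAt continuous_qPow_one.continuousAt)
  · refine (continuousAt_tauDenominator hτ (z + (k + 1))).comp_of_eq
      (f := fun p : ℂ × ℂ => (p.1 + (k + 1), p.2)) (by fun_prop) rfl

lemma differentiableAt_tauRegular (hτ : 0 < τ.im) {z : ℂ} {k j : ℕ} (hz : z = -k - j / τ) :
    DifferentiableAt ℂ (fun w => tauRegular k j (w, τ)) z := by
  have hw0 : z + k + j / τ = 0 := by rw [hz]; ring
  have h1 : DifferentiableAt ℂ (fun w => expSlope (-(2 * Real.pi * I * (w + k + j / τ)))) z :=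
    (differentiable_expSlope.comp (g := expSlope)
      (f := fun w => -(2 * Real.pi * I * (w + k + j / τ))) (by fun_prop)).differentiableAt
  have h2 : DifferentiableAt ℂ (fun w => expSlope (2 * Real.pi * I * τ * (w + k + j / τ))) z :=
    (differentiable_expSlope.comp (g := expSlope)
      (f := fun w => 2 * Real.pi * I * τ * (w + k + j / τ)) (by fun_prop)).differentiableAt
  have h3 : DifferentiableAt ℂ
      (fun w => qPochhammer (cexp (-(2 * Real.pi * I * w))) (qTildePow τ 1) j) z :=
    ((differentiable_qPochhammer (qTildePow τ 1) j).comp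
      (f := fun w => cexp (-(2 * Real.pi * I * w))) (by fun_prop)).differentiableAt
  have h4 : DifferentiableAt ℂ (fun w => tauNumerator (w + (j + 1) / τ) τ) z :=
    ((differentiable_tauNumerator hτ).comp (f := fun w => w + (j + 1) / τ)
      (by fun_prop)).differentiableAt
  have h5 : DifferentiableAt ℂ (fun w => qPochhammer (qPow τ w) (qPow τ 1) k) z :=
    ((differentiable_qPochhammer (qPow τ 1) k).comp (differentiable_qPow τ)).differentiableAt
  have h6 : DifferentiableAt ℂ (fun w => tauDenominator (w + (k + 1)) τ) z :=
    ((differentiable_tauDenominator hτ).comp (f := fun w => w + ((k : ℂ) + 1))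
      (by fun_prop)).differentiableAt
  have h7 : expSlope (2 * Real.pi * I * τ * (z + k + j / τ)) ≠ 0 := by
    rw [hw0, mul_zero, expSlope_zero]; exact one_ne_zero
  exact ((((h1.div h2 h7).const_mul (-1 / τ)).mul (h3.mul h4)).div (h5.mul h6)
    (tauRegular_denom_ne_zero hτ hz))

lemma tauFactorial_eq_tauRegular (hτ : 0 < τ.im) {z : ℂ} {k j : ℕ} (hz : z = -k - j / τ) :
    tauFactorial z τ = tauRegular k j (z, τ) := by
  refine tauFactorial_eq_of_tendsto hτ.le
    (((continuousAt_tauRegular hτ hz).tendsto.mono_left nhdsWithin_le_nhds).congr' ?_)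
  filter_upwards [self_mem_nhdsWithin] with p hp
  exact (div_eq_tauRegular hp.1 hp.2 k j).symm

/-- The `τ`-shifted factorial is holomorphic away from its poles. -/
theorem differentiableAt_tauFactorial (hτ : 0 < τ.im) {z : ℂ} (hz : ¬ IsTauPole z τ) :
    DifferentiableAt ℂ (tauFactorial · τ) z := by
  by_cases hD : tauDenominator z τ = 0
  · obtain ⟨k, j, hkj⟩ := isTauPole_or_of_tauDenominator_eq_zero hτ hD hz
    refine (differentiableAt_tauRegular hτ hkj).congr_of_eventuallyEq ?_
    filter_upwards [eventually_nhdsWithin_iff.1 (eventually_tauDenominator_ne_zero hτ z)] with w hw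
    by_cases hwz : w = z
    · rw [hwz]; exact tauFactorial_eq_tauRegular hτ hkj
    · rw [tauFactorial_eq_div hτ (hw hwz), div_eq_tauRegular hτ (hw hwz)]
  · refine (((differentiable_tauNumerator hτ) z).div ((differentiable_tauDenominator hτ) z)
      hD).congr_of_eventuallyEq ?_
    filter_upwards [(differentiable_tauDenominator hτ).continuous.continuousAt.eventually_ne hD]
      with w hw
    exact tauFactorial_eq_div hτ hw

end ZerosAndShifts

open Complex Filter Topology MeasureTheory

/-! ### Two double series evaluated by Euler's identities and the q-binomial theorem. -/

section DoubleSums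

lemma HasSum.of_eq {ι : Type*} {f g : ι → ℂ} {s t : ℂ} (h : HasSum f s) (hfg : ∀ i, g i = f i)
    (hst : t = s) : HasSum g t := by
  rw [hst, funext hfg]; exact h

lemma tsum_prod_eq_of_hasSum {f : ℕ × ℕ → ℂ} {g : ℕ → ℂ} {s : ℂ} (hf : Summable f)
    (hg : ∀ m, HasSum (fun n => f (m, n)) (g m)) (hs : HasSum g s) : HasSum f s := by
  have := hf.hasSum.prod_fiberwise hg
  rw [hs.unique this]
  exact hf.hasSum

lemma summable_mul_of_norm_le_one {x y q : ℂ} (hq : ‖q‖ < 1) (hx : ‖x‖ < 1) (hy : ‖y‖ < 1)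
    {u : ℕ × ℕ → ℂ} (hu : ∀ p, ‖u p‖ ≤ 1) :
    Summable fun p : ℕ × ℕ => ‖u p * (x ^ p.1 / qPochhammer q q p.1 *
      (y ^ p.2 / qPochhammer q q p.2))‖ := by
  refine Summable.of_nonneg_of_le (fun p => norm_nonneg _) (fun p => ?_)
    ((summable_norm_pow_div_qPochhammer hq hx).mul_norm (summable_norm_pow_div_qPochhammer hq hy))
  rw [norm_mul]
  exact mul_le_of_le_one_left (norm_nonneg _) (hu p)

/-- The sum over the second index is 1/(y q^m;q) = (y;q)_m/(y;q), after which the q-binomial theorem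
applies in the first index. -/
lemma hasSum_pow_mul_double {x y q : ℂ} (hq : ‖q‖ < 1) (hx : ‖x‖ < 1) (hy : ‖y‖ < 1) :
    HasSum (fun p : ℕ × ℕ => q ^ (p.1 * p.2) * (x ^ p.1 / qPochhammer q q p.1 *
      (y ^ p.2 / qPochhammer q q p.2)))
      (qPochhammerInf (x * y) q / (qPochhammerInf x q * qPochhammerInf y q)) := by
  refine tsum_prod_eq_of_hasSum (g := fun m => qPochhammer y q m / qPochhammer q q m * x ^ m *
    (qPochhammerInf y q)⁻¹) (summable_mul_of_norm_le_one hq hx hy fun p => ?_).of_norm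
    (fun m => ?_) ?_
  · rw [norm_pow]; exact pow_le_one₀ (norm_nonneg q) hq.le
  · have hym : ‖y * q ^ m‖ < 1 := by
      rw [norm_mul, norm_pow]
      exact mul_lt_one_of_nonneg_of_lt_one_left (norm_nonneg _) hy (pow_le_one₀ (norm_nonneg q) hq.le)
    have h := (hasSum_pow_div_qPochhammer hq hym).mul_left (x ^ m / qPochhammer q q m)
    have h2 := qPochhammerInf_eq_prod_mul y hq m
    have h3 := qPochhammerInf_ne_zero_of_norm_lt_one hq hym
    have h4 := qPochhammerInf_ne_zero_of_norm_lt_one hq hy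
    have h5 : (qPochhammerInf (y * q ^ m) q)⁻¹ =
        qPochhammer y q m * (qPochhammerInf y q)⁻¹ := by
      rw [← div_eq_mul_inv, eq_div_iff h4, h2]; field_simp
    rw [h5] at h
    refine h.of_eq (fun n => ?_) (by ring)
    rw [mul_pow, ← pow_mul]; ring
  · have h := (hasSum_qBinomial (a := y) hq hx).mul_right (qPochhammerInf y q)⁻¹
    refine h.of_eq (fun n => rfl) ?_
    rw [mul_comm x y, div_mul_eq_div_div, div_eq_mul_inv _ (qPochhammerInf y q)]

/-- Each further factor is 1 - A Q^(-n) = -A Q^(-n) (1 - Q^n/A): turning the factors round produces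
(1/A;Q)_n, and the leftover powers of Q cancel those on the left. -/
lemma qPochhammerInf_mul_pow_choose {A B Q : ℂ} (hQ : ‖Q‖ < 1) (hQ0 : Q ≠ 0) (hA : A ≠ 0) (n : ℕ) :
    qPochhammerInf (A * Q / Q ^ n) Q * (Q ^ ((n + 1).choose 2) * (-B) ^ n) =
      qPochhammerInf (A * Q) Q * qPochhammer A⁻¹ Q n * (A * B * Q) ^ n := by
  induction n with
  | zero => simp [qPochhammer]
  | succ n ih =>
    have h1 := qPochhammerInf_eq_one_sub_mul (A * Q / Q ^ (n + 1)) hQ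
    have h2 : A * Q / Q ^ (n + 1) * Q = A * Q / Q ^ n := by
      rw [pow_succ]; field_simp
    rw [h2] at h1
    rw [h1, Nat.choose_succ_succ' (n + 1) 1, Nat.choose_one_right, qPochhammer_succ, pow_add,
      pow_succ (-B), pow_succ (A * B * Q)]
    have h3 : (1 - A * Q / Q ^ (n + 1)) * Q ^ (n + 1) * (-B) = A * B * Q * (1 - A⁻¹ * Q ^ n) := by
      field_simp
      ring
    linear_combination (1 - A * Q / Q ^ (n + 1)) * Q ^ (n + 1) * (-B) * ih +
      qPochhammerInf (A * Q) Q * qPochhammer A⁻¹ Q n * (A * B * Q) ^ n * h3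

/-- The inner sum is Euler's series for (AQ/Q^m;Q), rewritten by `qPochhammerInf_mul_pow_choose`;
the outer sum is the q-binomial series with a = 1/A. Summability is a separate hypothesis because
negative powers of Q hide it in this form. -/
lemma hasSum_qPochhammerInf_double {A B Q : ℂ} (hQ : ‖Q‖ < 1) (hQ0 : Q ≠ 0) (hA : A ≠ 0)
    (hAB : ‖A * B * Q‖ < 1) {f : ℕ × ℕ → ℂ} (hf : Summable f)
    (hfe : ∀ m n, f (m, n) = (-1) ^ n * Q ^ (n.choose 2) / qPochhammer Q Q n *
      (A * Q / Q ^ m) ^ n * (Q ^ ((m + 1).choose 2) * (-B) ^ m / qPochhammer Q Q m)) :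
    HasSum f (qPochhammerInf (A * Q) Q * qPochhammerInf (B * Q) Q /
      qPochhammerInf (A * B * Q) Q) := by
  refine tsum_prod_eq_of_hasSum hf (fun m => ?_)
    (g := fun m => qPochhammerInf (A * Q) Q * (qPochhammer A⁻¹ Q m / qPochhammer Q Q m *
      (A * B * Q) ^ m)) ?_
  · simp_rw [hfe]
    refine ((hasSum_qPochhammerInf (A * Q / Q ^ m) hQ).mul_right _).of_eq (fun n => rfl) ?_
    rw [← mul_div_assoc, qPochhammerInf_mul_pow_choose hQ hQ0 hA]
    ring
  · have h := (hasSum_qBinomial (a := A⁻¹) hQ hAB).mul_left (qPochhammerInf (A * Q) Q)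
    have h1 : A⁻¹ * (A * B * Q) = B * Q := by field_simp
    rw [h1] at h
    exact h.of_eq (fun n => rfl) (by ring)

end DoubleSums
-- The integral along the real line for Im τ > 0.
section Horizontal

variable {τ α β : ℂ}

/-- The half period in the centre completes q^(m(m-1)/2) to q^(m²/2), and the signs cancel. Each
term is then of the shape that a translation of the Gaussian produces. -/
lemma qPochhammer_center_add (hτ : 0 < τ.im) (w : ℂ) :
    HasSum (fun m : ℕ => cexp (Real.pi * I * τ * m ^ 2 + 2 * Real.pi * I * τ * w * m) /
      qPochhammer (qPow τ 1) (qPow τ 1) m) (tauDenominator (tauCenter τ + w) τ) := by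
  refine (hasSum_qPochhammerInf (qPow τ (tauCenter τ + w)) (norm_qPow_one_lt_one hτ)).of_eq
    (fun m => ?_) rfl
  have hs : ((-1 : ℂ) ^ m) * (-1) ^ m = 1 := by rw [← mul_pow]; simp
  have he : cexp (Real.pi * I * τ * m ^ 2 + 2 * Real.pi * I * τ * w * m) =
      qPow τ 1 ^ m.choose 2 * cexp (Real.pi * I * τ + 2 * Real.pi * I * (τ * w)) ^ m := by
    rw [qPow_one_eq, ← exp_nat_mul, ← exp_nat_mul, ← exp_add, Nat.cast_choose_two]
    congr 1; ring
  rw [qPow_center_add hτ, neg_pow (cexp _) m, he]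
  linear_combination -(qPow τ 1 ^ m.choose 2 * cexp (Real.pi * I * τ + 2 * Real.pi * I * (τ * w)) ^ m
    / qPochhammer (qPow τ 1) (qPow τ 1) m) * hs

lemma norm_exp_center_lt_one {w : ℂ} (hw : (w + 1 / (2 * τ)).im < 0) :
    ‖-cexp (Real.pi * I * (-1 / τ) - 2 * Real.pi * I * w)‖ < 1 := by
  rw [norm_neg, norm_exp, Real.exp_lt_one_iff]
  have : Real.pi * I * (-1 / τ) - 2 * Real.pi * I * w =
    ((-(2 * Real.pi) : ℝ) : ℂ) * (I * (w + 1 / (2 * τ))) := by push_cast; ring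
  rw [this, re_ofReal_mul, I_mul_re]
  nlinarith [Real.pi_pos]

lemma tauNumerator_center_add_ne_zero (hτ : 0 < τ.im) {w : ℂ} (hw : (w + 1 / (2 * τ)).im < 0) :
    tauNumerator (tauCenter τ + w) τ ≠ 0 := by
  rw [tauNumerator, exp_center_add hτ]
  exact qPochhammerInf_ne_zero_of_norm_lt_one (norm_qTildePow_one_lt_one hτ)
    (norm_exp_center_lt_one hw)

lemma integral_exp_quadratic_int (hτ : 0 < τ.im) (k : ℂ) :
    ∫ x : ℝ, cexp (Real.pi * I * τ * x ^ 2 - 2 * Real.pi * I * k * x) =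
      ((-I * τ) ^ (1 / 2 : ℂ))⁻¹ * cexp (Real.pi * I * (-1 / τ) * k ^ 2) := by
  have hτ0 := ne_zero_of_im_pos hτ
  have hb : (Real.pi * I * τ : ℂ).re < 0 := by
    simp; positivity
  have h := integral_cexp_quadratic hb (-(2 * Real.pi * I * k)) 0
  have hpi : (Real.pi : ℂ) ≠ 0 := by exact_mod_cast Real.pi_ne_zero
  have h1 : (Real.pi / -(Real.pi * I * τ) : ℂ) = (-I * τ)⁻¹ := by field_simp
  have h2 : (0 - (-(2 * Real.pi * I * k)) ^ 2 / (4 * (Real.pi * I * τ)) : ℂ) =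
      Real.pi * I * (-1 / τ) * k ^ 2 := by
    have := I_sq
    field_simp
    ring
  rw [h1, h2, inv_cpow _ _ (fun h => ?_)] at h
  · rw [← h]
    refine integral_congr_ae (.of_forall fun x => ?_)
    simp only
    congr 1; ring
  · rw [arg_eq_pi_iff] at h
    have : (-I * τ).re = τ.im := by simp
    linarith [h.1]

/-- The Gaussian divided by the product of numerators of `τ`-shifted factorials. -/
noncomputable def gaussianDivNumerators (τ α β : ℂ) (x : ℝ) : ℂ :=
  cexp (Real.pi * I * τ * x ^ 2) / (tauNumerator (tauCenter τ + (α + x)) τ *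
    tauNumerator (tauCenter τ + (β - x)) τ)

lemma norm_inv_qPochhammerInf_le {q y : ℂ} (hq : ‖q‖ < 1) (hy : ‖y‖ < 1) :
    ‖(qPochhammerInf y q)⁻¹‖ ≤ ∑' n, ‖y‖ ^ n / ‖qPochhammer q q n‖ := by
  have h := summable_norm_pow_div_qPochhammer hq hy
  rw [← (hasSum_pow_div_qPochhammer hq hy).tsum_eq]
  simpa [norm_div, norm_pow] using norm_tsum_le_tsum_norm h

lemma norm_exp_center_add_ofReal (σ w : ℂ) (x : ℝ) :
    ‖-cexp (Real.pi * I * σ - 2 * Real.pi * I * (w + x))‖ =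
      ‖-cexp (Real.pi * I * σ - 2 * Real.pi * I * w)‖ := by
  rw [norm_neg, norm_neg, norm_exp, norm_exp]
  congr 1
  simp

lemma add_ofReal_add_im_neg {w : ℂ} (hw : (w + 1 / (2 * τ)).im < 0) (x : ℝ) :
    (w + x + 1 / (2 * τ)).im < 0 := by
  have : (w + x + 1 / (2 * τ)).im = (w + 1 / (2 * τ)).im := by simp
  rwa [this]

lemma sub_ofReal_add_im_neg {w : ℂ} (hw : (w + 1 / (2 * τ)).im < 0) (x : ℝ) :
    (w - x + 1 / (2 * τ)).im < 0 := by
  have : (w - x + 1 / (2 * τ)).im = (w + 1 / (2 * τ)).im := by simp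
  rwa [this]

lemma integrable_exp_pi_I_mul_sq (hτ : 0 < τ.im) :
    Integrable (fun x : ℝ => cexp (Real.pi * I * τ * x ^ 2)) := by
  have hb : (Real.pi * I * τ : ℂ).re < 0 := by
    simp; positivity
  simpa using integrable_cexp_quadratic' hb 0 0

lemma hasSum_inv_tauNumerator (hτ : 0 < τ.im) {w : ℂ} (hw : (w + 1 / (2 * τ)).im < 0) :
    HasSum (fun n => (-cexp (Real.pi * I * (-1 / τ) - 2 * Real.pi * I * w)) ^ n /
      qPochhammer (qTildePow τ 1) (qTildePow τ 1) n) (tauNumerator (tauCenter τ + w) τ)⁻¹ := by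
  rw [tauNumerator, exp_center_add hτ]
  exact hasSum_pow_div_qPochhammer (norm_qTildePow_one_lt_one hτ) (norm_exp_center_lt_one hw)

/-- The Gaussian decays, and the reciprocal numerators are bounded on horizontal lines because a
real shift preserves the modulus of their arguments. -/
lemma integrable_gaussianDivNumerators (hτ : 0 < τ.im) (hα : (α + 1 / (2 * τ)).im < 0)
    (hβ : (β + 1 / (2 * τ)).im < 0) : Integrable (gaussianDivNumerators τ α β) := by
  have hQ := norm_qTildePow_one_lt_one hτ
  have hN := (differentiable_tauNumerator hτ).continuous
  have hcont : Continuous (gaussianDivNumerators τ α β) := by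
    unfold gaussianDivNumerators
    refine Continuous.div (by fun_prop) ((hN.comp (by fun_prop)).mul (hN.comp (by fun_prop)))
      fun x => mul_ne_zero ?_ ?_
    · exact tauNumerator_center_add_ne_zero hτ (add_ofReal_add_im_neg hα x)
    · exact tauNumerator_center_add_ne_zero hτ (sub_ofReal_add_im_neg hβ x)
  have hbound : ∀ w : ℂ, (w + 1 / (2 * τ)).im < 0 → ∃ K : ℝ, ∀ x : ℝ,
      ‖(tauNumerator (tauCenter τ + (w + x)) τ)⁻¹‖ ≤ K := by
    intro w hw
    refine ⟨∑' n, ‖-cexp (Real.pi * I * (-1 / τ) - 2 * Real.pi * I * w)‖ ^ n /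
      ‖qPochhammer (qTildePow τ 1) (qTildePow τ 1) n‖, fun x => ?_⟩
    rw [tauNumerator, exp_center_add hτ]
    have := norm_inv_qPochhammerInf_le hQ (norm_exp_center_lt_one (add_ofReal_add_im_neg hw x))
    rwa [norm_exp_center_add_ofReal] at this
  obtain ⟨K₁, h₁⟩ := hbound α hα
  obtain ⟨K₂, h₂⟩ := hbound β hβ
  refine Integrable.mono' ((integrable_exp_pi_I_mul_sq hτ).norm.mul_const (K₁ * K₂))
    hcont.aestronglyMeasurable (.of_forall fun x => ?_)
  rw [gaussianDivNumerators, div_eq_mul_inv, mul_inv, norm_mul, norm_mul]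
  have h3 := h₂ (-x)
  rw [ofReal_neg, ← sub_eq_add_neg] at h3
  exact mul_le_mul_of_nonneg_left (mul_le_mul (h₁ x) h3 (norm_nonneg _)
    ((norm_nonneg _).trans (h₁ x))) (norm_nonneg _)

/-- Both reciprocals are expanded by Euler. The term (m, n) depends on x only through the unimodular
exp(-2πi(m-n)x), so termwise integration is legitimate and gives the Fourier transform of the
Gaussian, q̃^((m-n)²/2). The resulting series is `hasSum_qPochhammerInf_double` with A = exp(-2πiβ)
and B = exp(-2πiα). -/
lemma integral_gaussianDivNumerators (hτ : 0 < τ.im) (hα : (α + 1 / (2 * τ)).im < 0)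
    (hβ : (β + 1 / (2 * τ)).im < 0) :
    ∫ x, gaussianDivNumerators τ α β x = ((-I * τ) ^ (1 / 2 : ℂ))⁻¹ *
      (tauNumerator (1 / τ + α) τ * tauNumerator (1 / τ + β) τ /
        tauNumerator (1 / τ + α + β) τ) := by
  have hτ0 := ne_zero_of_im_pos hτ
  have hQ := norm_qTildePow_one_lt_one hτ
  set Q := qTildePow τ 1 with hQdef
  set x₀ := -cexp (Real.pi * I * (-1 / τ) - 2 * Real.pi * I * α) with hx₀
  set y₀ := -cexp (Real.pi * I * (-1 / τ) - 2 * Real.pi * I * β) with hy₀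
  have hx1 : ‖x₀‖ < 1 := norm_exp_center_lt_one hα
  have hy1 : ‖y₀‖ < 1 := norm_exp_center_lt_one hβ
  let F : ℕ × ℕ → ℝ → ℂ := fun p x => (x₀ ^ p.1 / qPochhammer Q Q p.1 *
    (y₀ ^ p.2 / qPochhammer Q Q p.2)) *
    cexp (Real.pi * I * τ * x ^ 2 - 2 * Real.pi * I * (p.1 - p.2) * x)
  have hexp : ∀ (p : ℕ × ℕ) (x : ℝ), ‖cexp (Real.pi * I * τ * x ^ 2 -
      2 * Real.pi * I * (p.1 - p.2) * x)‖ = ‖cexp (Real.pi * I * τ * x ^ 2)‖ := by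
    intro p x
    rw [norm_exp, norm_exp]
    congr 1
    have : (2 * Real.pi * I * (p.1 - p.2) * x : ℂ) = ((2 * Real.pi * (p.1 - p.2) * x : ℝ) : ℂ) * I := by
      push_cast; ring
    rw [sub_re, this, re_ofReal_mul, I_re, mul_zero, sub_zero]
  have hFint : ∀ p, Integrable (F p) := by
    intro p
    refine Integrable.const_mul ?_ _
    refine (integrable_exp_pi_I_mul_sq hτ).mono
      (Continuous.aestronglyMeasurable (by fun_prop)) (.of_forall fun x => (hexp p x).le)
  have hFnorm : Summable fun p => ∫ x, ‖F p x‖ := by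
    have h := (summable_mul_of_norm_le_one (u := fun _ => 1) hQ hx1 hy1 (by simp)).mul_right
      (∫ x : ℝ, ‖cexp (Real.pi * I * τ * x ^ 2)‖)
    refine h.congr fun p => ?_
    simp only [F, norm_mul, hexp, one_mul]
    rw [integral_const_mul]
  have hsum := hasSum_integral_of_summable_integral_norm hFint hFnorm
  have hG : ∀ x : ℝ, ∑' p, F p x = gaussianDivNumerators τ α β x := by
    intro x
    have h1 := hasSum_inv_tauNumerator hτ (add_ofReal_add_im_neg hα x)
    have h2 := hasSum_inv_tauNumerator hτ (sub_ofReal_add_im_neg hβ x)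
    have hx : ‖-cexp (Real.pi * I * (-1 / τ) - 2 * Real.pi * I * (α + x))‖ < 1 :=
      norm_exp_center_lt_one (add_ofReal_add_im_neg hα x)
    have hy : ‖-cexp (Real.pi * I * (-1 / τ) - 2 * Real.pi * I * (β - x))‖ < 1 :=
      norm_exp_center_lt_one (sub_ofReal_add_im_neg hβ x)
    have h3 := (h1.mul_of_summable_norm h2 (summable_norm_pow_div_qPochhammer hQ hx)
      (summable_norm_pow_div_qPochhammer hQ hy)).mul_left (cexp (Real.pi * I * τ * x ^ 2))
    rw [gaussianDivNumerators, div_eq_mul_inv, mul_inv, ← h3.tsum_eq]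
    refine tsum_congr fun p => ?_
    have e1 : (-cexp (Real.pi * I * (-1 / τ) - 2 * Real.pi * I * (α + x))) ^ p.1 =
        x₀ ^ p.1 * cexp (-(2 * Real.pi * I * p.1 * x)) := by
      have : Real.pi * I * (-1 / τ) - 2 * Real.pi * I * (α + x) =
        (Real.pi * I * (-1 / τ) - 2 * Real.pi * I * α) + -(2 * Real.pi * I * x) := by ring
      rw [this, exp_add, ← neg_mul, mul_pow, ← exp_nat_mul (-(2 * Real.pi * I * x)), hx₀]
      congr 2; ring
    have e2 : (-cexp (Real.pi * I * (-1 / τ) - 2 * Real.pi * I * (β - x))) ^ p.2 =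
        y₀ ^ p.2 * cexp (2 * Real.pi * I * p.2 * x) := by
      have : Real.pi * I * (-1 / τ) - 2 * Real.pi * I * (β - x) =
        (Real.pi * I * (-1 / τ) - 2 * Real.pi * I * β) + (2 * Real.pi * I * x) := by ring
      rw [this, exp_add, ← neg_mul, mul_pow, ← exp_nat_mul (2 * Real.pi * I * x), hy₀]
      congr 2; ring
    have e3 : cexp (Real.pi * I * τ * x ^ 2 - 2 * Real.pi * I * (p.1 - p.2) * x) =
        cexp (Real.pi * I * τ * x ^ 2) * (cexp (-(2 * Real.pi * I * p.1 * x)) *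
          cexp (2 * Real.pi * I * p.2 * x)) := by
      rw [← exp_add, ← exp_add]; congr 1; ring
    rw [e1, e2]
    simp only [F]
    rw [e3]
    ring
  simp_rw [hG] at hsum
  have hFval : ∀ p : ℕ × ℕ, ∫ x, F p x = ((-I * τ) ^ (1 / 2 : ℂ))⁻¹ *
      (cexp (Real.pi * I * (-1 / τ) * (p.1 - p.2) ^ 2) * (x₀ ^ p.1 / qPochhammer Q Q p.1 *
        (y₀ ^ p.2 / qPochhammer Q Q p.2))) := by
    intro p
    simp only [F]
    rw [integral_const_mul, integral_exp_quadratic_int hτ]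
    ring
  simp_rw [hFval] at hsum
  refine hsum.unique (HasSum.mul_left _ ?_)
  have hunorm : ∀ p : ℕ × ℕ, ‖cexp (Real.pi * I * (-1 / τ) * (p.1 - p.2) ^ 2)‖ ≤ 1 := by
    intro p
    rw [norm_exp, Real.exp_le_one_iff]
    have : (Real.pi * I * (-1 / τ) * (p.1 - p.2) ^ 2 : ℂ) =
      ((Real.pi * (p.1 - p.2) ^ 2 : ℝ) : ℂ) * (I * (-1 / τ)) := by push_cast; ring
    rw [this, re_ofReal_mul, I_mul_re]
    have := neg_one_div_im_pos hτ
    have h2 : 0 ≤ Real.pi * ((p.1 : ℝ) - p.2) ^ 2 := by positivity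
    nlinarith
  have hAQ : ∀ w : ℂ, tauNumerator (1 / τ + w) τ =
      qPochhammerInf (cexp (-(2 * Real.pi * I * w)) * Q) Q := by
    intro w
    have := exp_neg_two_pi_I_mul_mul_pow τ w 1
    rw [pow_one, Nat.cast_one, add_comm w] at this
    rw [tauNumerator, ← this]
  have hABe : cexp (-(2 * Real.pi * I * (α + β))) =
      cexp (-(2 * Real.pi * I * β)) * cexp (-(2 * Real.pi * I * α)) := by
    rw [← exp_add]; congr 1; ring
  rw [add_assoc, hAQ, hAQ, hAQ, hABe, mul_comm (qPochhammerInf _ Q)]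
  have hABnorm : ‖cexp (-(2 * Real.pi * I * β)) * cexp (-(2 * Real.pi * I * α)) * Q‖ < 1 := by
    have : cexp (-(2 * Real.pi * I * β)) * cexp (-(2 * Real.pi * I * α)) * Q = x₀ * y₀ := by
      rw [hx₀, hy₀, hQdef, qTildePow, neg_mul_neg, ← exp_add, ← exp_add, ← exp_add]
      congr 1; ring
    rw [this, norm_mul]
    exact mul_lt_one_of_nonneg_of_lt_one_left (norm_nonneg _) hx1 hy1.le
  refine hasSum_qPochhammerInf_double hQ (qTildePow_ne_zero τ 1) (exp_ne_zero _) hABnorm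
    (summable_mul_of_norm_le_one hQ hx1 hy1 hunorm).of_norm fun m n => ?_
  have hx : x₀ ^ m = (-1) ^ m * cexp (m * (Real.pi * I * (-1 / τ) - 2 * Real.pi * I * α)) := by
    rw [hx₀, neg_pow, ← exp_nat_mul]
  have hy : y₀ ^ n = (-1) ^ n * cexp (n * (Real.pi * I * (-1 / τ) - 2 * Real.pi * I * β)) := by
    rw [hy₀, neg_pow, ← exp_nat_mul]
  -- In exponents of q̃: (m-n)²/2 + (m+n)/2 = n(n-1)/2 + n - mn + m(m+1)/2.
  have hkey : cexp (Real.pi * I * (-1 / τ) * (m - n) ^ 2) *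
      cexp (m * (Real.pi * I * (-1 / τ) - 2 * Real.pi * I * α)) *
      cexp (n * (Real.pi * I * (-1 / τ) - 2 * Real.pi * I * β)) =
      Q ^ (n.choose 2) * (cexp (-(2 * Real.pi * I * β)) * Q / Q ^ m) ^ n *
        Q ^ ((m + 1).choose 2) * cexp (-(2 * Real.pi * I * α)) ^ m := by
    rw [hQdef, qTildePow_one_eq, ← exp_nat_mul _ m, ← exp_nat_mul _ m, ← exp_nat_mul _ (n.choose 2),
      ← exp_nat_mul _ ((m + 1).choose 2), ← exp_add (-(2 * Real.pi * I * β)), ← exp_sub,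
      ← exp_nat_mul _ n, ← exp_add, ← exp_add, ← exp_add, ← exp_add, ← exp_add,
      Nat.cast_choose_two, Nat.cast_choose_two]
    congr 1
    push_cast
    ring
  rw [hx, hy, neg_pow (cexp (-(2 * Real.pi * I * α)))]
  simp only
  linear_combination ((-1) ^ m * (-1) ^ n / (qPochhammer Q Q m * qPochhammer Q Q n)) * hkey

/-- The numerators have period 1, so an integer translation is felt by the Gaussian alone. -/
lemma gaussianDivNumerators_add_int (τ α β : ℂ) (x : ℝ) (m n : ℕ) :
    gaussianDivNumerators τ α β (x + ((m : ℝ) - n)) =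
      cexp (Real.pi * I * τ * (x + (m - n)) ^ 2) / (tauNumerator (tauCenter τ + (α + x)) τ *
    tauNumerator (tauCenter τ + (β - x)) τ) := by
  have h1 := tauNumerator_add_int (tauCenter τ + (α + x)) τ (m - n)
  have h2 := tauNumerator_add_int (tauCenter τ + (β - x)) τ (n - m)
  rw [gaussianDivNumerators, ← h1, ← h2]
  push_cast
  ring_nf

lemma norm_qPow_lt_one {w : ℂ} (hw : 0 < (τ * w).im) : ‖qPow τ w‖ < 1 := by
  rw [qPow, mul_assoc]; exact norm_exp_two_pi_I_mul_lt_one hw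

lemma tauDenominator_one_div_add (hτ : 0 < τ.im) (w : ℂ) :
    tauDenominator (1 / τ + w) τ = qPochhammerInf (qPow τ w) (qPow τ 1) := by
  have h := tauDenominator_add_int_div (ne_zero_of_im_pos hτ) w 1
  rw [Int.cast_one, add_comm] at h
  rw [h, tauDenominator]

/-- Each term of the expanded denominators, times the integrand without them, is a constant multiple
of an integer translate of that integrand. Translation invariance makes all the integrals equal, and
the constants sum by `hasSum_pow_mul_double`, which needs |q^α| < 1 and |q^β| < 1. -/
theorem integral_gaussianDivNumerators_mul (hτ : 0 < τ.im) (hα : (α + 1 / (2 * τ)).im < 0)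
    (hβ : (β + 1 / (2 * τ)).im < 0) (hα' : 0 < (τ * α).im) (hβ' : 0 < (τ * β).im) :
    ∫ x, gaussianDivNumerators τ α β x * (tauDenominator (tauCenter τ + (α + x)) τ *
        tauDenominator (tauCenter τ + (β - x)) τ) =
      ((-I * τ) ^ (1 / 2 : ℂ))⁻¹ *
      (tauNumerator (1 / τ + α) τ * tauNumerator (1 / τ + β) τ /
        tauNumerator (1 / τ + α + β) τ) *
      (tauDenominator (1 / τ + α + β) τ /
        (tauDenominator (1 / τ + α) τ * tauDenominator (1 / τ + β) τ)) := by
  have hq := norm_qPow_one_lt_one hτ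
  have hx := norm_qPow_lt_one hα'
  have hy := norm_qPow_lt_one hβ'
  have hG := integrable_gaussianDivNumerators hτ hα hβ
  rw [← integral_gaussianDivNumerators hτ hα hβ, add_assoc, tauDenominator_one_div_add hτ,
    tauDenominator_one_div_add hτ, tauDenominator_one_div_add hτ, qPow_add]
  set q := qPow τ 1 with hqdef
  -- The factor q^(mn) balances the cross term in x²/2 + m²/2 + n²/2 + (m-n)x = (x+m-n)²/2 + mn.
  let a : ℕ × ℕ → ℂ := fun p => q ^ (p.1 * p.2) * (qPow τ α ^ p.1 / qPochhammer q q p.1 *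
      (qPow τ β ^ p.2 / qPochhammer q q p.2))
  have ha : HasSum a (qPochhammerInf (qPow τ α * qPow τ β) q /
      (qPochhammerInf (qPow τ α) q * qPochhammerInf (qPow τ β) q)) := hasSum_pow_mul_double hq hx hy
  have ha' : Summable fun p => ‖a p‖ := by
    refine summable_mul_of_norm_le_one hq hx hy fun p => ?_
    rw [norm_pow]; exact pow_le_one₀ (norm_nonneg q) hq.le
  let F : ℕ × ℕ → ℝ → ℂ := fun p x => a p * gaussianDivNumerators τ α β (x + ((p.1 : ℝ) - p.2))
  have hFint : ∀ p, Integrable (F p) := fun p => (hG.comp_add_right _).const_mul _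
  have hFnorm : Summable fun p => ∫ x, ‖F p x‖ := by
    refine (ha'.mul_right (∫ x, ‖gaussianDivNumerators τ α β x‖)).congr fun p => ?_
    simp only [F, norm_mul]
    rw [integral_const_mul,
      integral_add_right_eq_self (fun x => ‖gaussianDivNumerators τ α β x‖)]
  have hsum := hasSum_integral_of_summable_integral_norm hFint hFnorm
  have hFval : ∀ p, ∫ x, F p x = a p * ∫ x, gaussianDivNumerators τ α β x := by
    intro p
    simp only [F]
    rw [integral_const_mul, integral_add_right_eq_self (fun x => gaussianDivNumerators τ α β x)]
  simp_rw [hFval] at hsum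
  have hpt : ∀ x : ℝ, ∑' p, F p x = gaussianDivNumerators τ α β x *
      (tauDenominator (tauCenter τ + (α + x)) τ * tauDenominator (tauCenter τ + (β - x)) τ) := by
    intro x
    have hsn : ∀ w : ℂ, Summable fun m : ℕ => ‖cexp (Real.pi * I * τ * m ^ 2 +
        2 * Real.pi * I * τ * w * m) / qPochhammer q q m‖ := by
      intro w
      refine (summable_norm_qPochhammerInf (qPow τ (tauCenter τ + w)) hq).congr fun m => ?_
      have he : cexp (Real.pi * I * τ * m ^ 2 + 2 * Real.pi * I * τ * w * m) =
          q ^ m.choose 2 * cexp (Real.pi * I * τ + 2 * Real.pi * I * (τ * w)) ^ m := by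
        rw [hqdef, qPow_one_eq, ← exp_nat_mul, ← exp_nat_mul, ← exp_add, Nat.cast_choose_two]
        congr 1; ring
      rw [he, qPow_center_add hτ]
      simp only [norm_mul, norm_div, norm_pow, norm_neg, norm_one, one_pow, one_mul]
      ring
    have h := ((qPochhammer_center_add hτ (α + x)).mul_of_summable_norm
      (qPochhammer_center_add hτ (β - x)) (hsn _) (hsn _)).mul_left
      (gaussianDivNumerators τ α β x)
    rw [← h.tsum_eq]
    refine tsum_congr fun p => ?_
    simp only [F, a]
    rw [gaussianDivNumerators_add_int, gaussianDivNumerators]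
    have he : q ^ (p.1 * p.2) * (qPow τ α ^ p.1 * qPow τ β ^ p.2) *
        cexp (Real.pi * I * τ * (x + (p.1 - p.2)) ^ 2) = cexp (Real.pi * I * τ * x ^ 2) *
        (cexp (Real.pi * I * τ * p.1 ^ 2 + 2 * Real.pi * I * τ * (α + x) * p.1) *
          cexp (Real.pi * I * τ * p.2 ^ 2 + 2 * Real.pi * I * τ * (β - x) * p.2)) := by
      rw [hqdef, qPow_one_eq, qPow, qPow, ← exp_nat_mul, ← exp_nat_mul, ← exp_nat_mul,
        ← exp_add, ← exp_add, ← exp_add, ← exp_add, ← exp_add]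
      congr 1
      push_cast
      ring
    linear_combination (1 / (tauNumerator (tauCenter τ + (α + x)) τ *
      tauNumerator (tauCenter τ + (β - x)) τ) / (qPochhammer q q p.1 * qPochhammer q q p.2)) * he
  simp_rw [hpt] at hsum
  rw [hsum.unique (ha.mul_right _), mul_comm]

end Horizontal

open Complex Filter Topology MeasureTheory Set

/-! ### Rotation of a contour through the second quadrant. -/

section QuadrantRotation

lemma integrable_exp_neg_mul_abs {η : ℝ} (hη : 0 < η) :
    Integrable (fun x : ℝ => Real.exp (-(η * |x|))) := by
  rw [← integrableOn_univ, ← Iic_union_Ioi (a := (0 : ℝ))]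
  refine IntegrableOn.union ?_ ?_
  · refine (integrableOn_exp_mul_Iic hη 0).congr_fun (fun x hx => ?_) measurableSet_Iic
    simp only [abs_of_nonpos (mem_Iic.1 hx)]
    ring_nf
  · refine (integrableOn_exp_mul_Ioi (neg_lt_zero.2 hη) 0).congr_fun (fun x hx => ?_)
      measurableSet_Ioi
    simp only [abs_of_pos (mem_Ioi.1 hx)]
    ring_nf

lemma integral_eq_integral_Ioi_add {g : ℝ → ℂ} (hg : Integrable g) :
    ∫ x, g x = (∫ x in Ioi 0, g (-x)) + ∫ x in Ioi 0, g x := by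
  rw [← intervalIntegral.integral_Iic_add_Ioi (b := 0) hg.integrableOn hg.integrableOn,
    integral_comp_neg_Ioi, neg_zero]

lemma norm_integral_edge_le {f : ℂ → ℂ} {K η R : ℝ} (hR : 0 ≤ R) {φ : ℝ → ℂ}
    (hφ : ∀ x ∈ uIoc 0 R, ‖f (φ x)‖ ≤ K * Real.exp (-(η * R))) :
    ‖∫ x in (0 : ℝ)..R, f (φ x)‖ ≤ K * Real.exp (-(η * R)) * R := by
  have := intervalIntegral.norm_integral_le_of_norm_le_const hφ
  rwa [sub_zero, abs_of_nonneg hR] at this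

/-- Rotation of the contour from the positive imaginary to the negative real half-axis. -/
lemma integral_imaginary_axis_eq_integral_real_axis {f : ℂ → ℂ} {K η : ℝ} (hη : 0 < η)
    (hf : ∀ z : ℂ, z.re ≤ 0 → 0 ≤ z.im → DifferentiableAt ℂ f z)
    (hb : ∀ z : ℂ, z.re ≤ 0 → 0 ≤ z.im → ‖f z‖ ≤ K * Real.exp (-(η * (|z.re| + |z.im|)))) :
    IntegrableOn (fun y : ℝ => f (I * y)) (Ioi 0) ∧ IntegrableOn (fun x : ℝ => f (-x)) (Ioi 0) ∧
      I * ∫ y : ℝ in Ioi 0, f (I * y) = -∫ x : ℝ in Ioi 0, f (-x) := by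
  have hK : 0 ≤ K := by
    have := (norm_nonneg _).trans (hb 0 (by simp) (by simp))
    simpa using this
  have hint : ∀ c : ℂ, c = I ∨ c = -1 → IntegrableOn (fun y : ℝ => f (c * y)) (Ioi 0) := by
    intro c hc
    have hre : ∀ y ∈ Ioi (0 : ℝ), (c * y).re ≤ 0 ∧ 0 ≤ (c * y).im ∧
        |(c * y).re| + |(c * y).im| = |y| := by
      intro y hy
      have hy : 0 < y := hy
      rcases hc with rfl | rfl <;> simp [hy.le]
    refine Integrable.mono' (((integrable_exp_neg_mul_abs hη).const_mul K).integrableOn) ?_ ?_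
    · refine ContinuousOn.aestronglyMeasurable (fun y hy => ?_) measurableSet_Ioi
      refine ContinuousAt.continuousWithinAt ?_
      exact ((hf _ (hre y hy).1 (hre y hy).2.1).continuousAt).comp
        (f := fun y : ℝ => c * (y : ℂ)) (by fun_prop)
    · refine (ae_restrict_iff' measurableSet_Ioi).2 (.of_forall fun y hy => ?_)
      have := hb _ (hre y hy).1 (hre y hy).2.1
      rwa [(hre y hy).2.2] at this
  have h1 := hint I (Or.inl rfl)
  have h2 : IntegrableOn (fun x : ℝ => f (-x)) (Ioi 0) := by
    simpa only [neg_one_mul] using hint (-1) (Or.inr rfl)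
  refine ⟨h1, h2, ?_⟩
  -- Cauchy's theorem on the square with opposite corners -R and iR: two sides lie on the axes, the
  -- other two contribute O(R exp(-ηR)).
  have hrect : ∀ R : ℝ, 0 ≤ R → (∫ x in (0 : ℝ)..R, f (-x)) + I * (∫ y in (0 : ℝ)..R, f (I * y)) =
      (∫ x in (0 : ℝ)..R, f (-x + I * R)) + I * ∫ y in (0 : ℝ)..R, f (-R + I * y) := by
    intro R hR
    have h := integral_boundary_rect_eq_zero_of_differentiableOn f (-R : ℂ) (I * R) (by
      intro z hz
      rw [mem_reProdIm] at hz
      simp only [neg_re, ofReal_re, I_mul_re, ofReal_im, neg_zero, neg_im, I_mul_im] at hz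
      rw [uIcc_of_le (by linarith), uIcc_of_le hR] at hz
      exact (hf z hz.1.2 hz.2.1).differentiableWithinAt)
    simp only [neg_re, ofReal_re, I_mul_re, ofReal_im, neg_zero, neg_im, I_mul_im, ofReal_zero,
      zero_mul, add_zero, zero_add, smul_eq_mul, ofReal_neg] at h
    have e1 := intervalIntegral.integral_comp_neg (a := 0) (b := R) (fun x : ℝ => f x)
    have e2 := intervalIntegral.integral_comp_neg (a := 0) (b := R) (fun x : ℝ => f (x + R * I))
    simp only [neg_zero, ofReal_neg] at e1 e2
    have e3 : (∫ y in (0 : ℝ)..R, f (I * y)) = ∫ y in (0 : ℝ)..R, f (y * I) := by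
      simp_rw [mul_comm I]
    have e4 : (∫ y in (0 : ℝ)..R, f (-R + I * y)) = ∫ y in (0 : ℝ)..R, f (-R + y * I) := by
      simp_rw [mul_comm I]
    rw [e1, e3, e4, mul_comm I (R : ℂ), e2]
    linear_combination h
  have hlim1 : Tendsto (fun R : ℝ => (∫ x in (0 : ℝ)..R, f (-x)) + I * (∫ y in (0 : ℝ)..R, f (I * y)))
      atTop (𝓝 ((∫ x : ℝ in Ioi 0, f (-x)) + I * ∫ y : ℝ in Ioi 0, f (I * y))) :=
    (intervalIntegral_tendsto_integral_Ioi 0 h2 tendsto_id).add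
      ((intervalIntegral_tendsto_integral_Ioi 0 h1 tendsto_id).const_mul I)
  have hlim2 : Tendsto (fun R : ℝ => (∫ x in (0 : ℝ)..R, f (-x)) + I * (∫ y in (0 : ℝ)..R, f (I * y)))
      atTop (𝓝 0) := by
    have hdec : Tendsto (fun R : ℝ => 2 * K * (R ^ (1 : ℝ) * Real.exp (-η * R))) atTop (𝓝 0) := by
      simpa using (tendsto_rpow_mul_exp_neg_mul_atTop_nhds_zero 1 η hη).const_mul (2 * K)
    refine squeeze_zero_norm' ?_ hdec
    filter_upwards [eventually_ge_atTop (0 : ℝ)] with R hR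
    rw [hrect R hR]
    have b1 := norm_integral_edge_le (f := f) (K := K) (η := η) hR
      (φ := fun x : ℝ => -x + I * R) (by
        intro x hx
        rw [uIoc_of_le hR] at hx
        refine (hb _ (by simpa using hx.1.le) (by simpa using hR)).trans ?_
        gcongr
        simp [abs_of_nonneg hR])
    have b2 := norm_integral_edge_le (f := f) (K := K) (η := η) hR
      (φ := fun x : ℝ => -R + I * x) (by
        intro x hx
        rw [uIoc_of_le hR] at hx
        refine (hb _ (by simpa using hR) (by simpa using hx.1.le)).trans ?_
        gcongr
        simp [abs_of_nonneg hR])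
    refine (norm_add_le _ _).trans ?_
    rw [norm_mul, norm_I, one_mul, Real.rpow_one, neg_mul]
    calc _ ≤ _ := add_le_add b1 b2
      _ = _ := by ring
  have := tendsto_nhds_unique hlim1 hlim2
  linear_combination this

end QuadrantRotation

/-! ### The reciprocal factorial and the regularised integrand. -/

section Reciprocal

variable {τ : ℂ}

/-- The reciprocal of the `τ`-shifted factorial, expressed by the reflection formula. -/
noncomputable def tauReciprocal (w τ : ℂ) : ℂ :=
  tauFactorial (2 * tauCenter τ - w) τ *
    (cexp (-(Real.pi * I * τ * (w - tauCenter τ) ^ 2)) / tauConst τ)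

lemma two_mul_tauCenter (τ : ℂ) : 2 * tauCenter τ = 1 + 1 / τ := by
  rw [tauCenter, mul_add, mul_one_div_cancel two_ne_zero]
  congr 1
  rw [mul_one_div, ← div_div, div_self two_ne_zero]

lemma tauNumerator_eq_zero_of_isTauPole (hτ : 0 < τ.im) {w : ℂ}
    (h : IsTauPole (2 * tauCenter τ - w) τ) : tauNumerator w τ = 0 := by
  obtain ⟨k, n, h⟩ := h
  rw [tauNumerator_eq_zero_iff hτ]
  refine ⟨n, k + 1, ?_⟩
  rw [two_mul_tauCenter] at h
  push_cast
  linear_combination -h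

lemma tauDenominator_eq_zero_of_isTauPole (hτ : 0 < τ.im) {w : ℂ}
    (h : IsTauPole w τ) : tauDenominator w τ = 0 := by
  obtain ⟨k, n, h⟩ := h
  rw [tauDenominator_eq_zero_iff hτ]
  exact ⟨k, n + 1, by rw [h]; push_cast; rfl⟩

/-- Only poles at the reflected point matter. Nothing is asked of `tauFactorial` at w itself, where
its value may be unspecified; this is the reason for defining the reciprocal by reflection. -/
lemma differentiableAt_tauReciprocal (hτ : 0 < τ.im) {w : ℂ}
    (h : ¬ IsTauPole (2 * tauCenter τ - w) τ) : DifferentiableAt ℂ (tauReciprocal · τ) w := by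
  unfold tauReciprocal
  refine DifferentiableAt.mul ?_ (by fun_prop)
  exact DifferentiableAt.comp w (g := (tauFactorial · τ)) (f := fun w => 2 * tauCenter τ - w)
    (differentiableAt_tauFactorial hτ h) (by fun_prop)

lemma eventually_tauNumerator_ne_zero (hτ : 0 < τ.im) (z : ℂ) :
    ∀ᶠ w in 𝓝[≠] z, tauNumerator w τ ≠ 0 := by
  have han : AnalyticOnNhd ℂ (tauNumerator · τ) Set.univ :=
    (differentiable_tauNumerator hτ).differentiableOn.analyticOnNhd isOpen_univ
  rcases (han z trivial).eventually_eq_zero_or_eventually_ne_zero with h | h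
  · have h0 := han.eqOn_zero_of_preconnected_of_eventuallyEq_zero isPreconnected_univ trivial h
    have huniv : {z | tauNumerator z τ = 0} = Set.univ :=
      Set.eq_univ_of_forall fun w => h0 (Set.mem_univ w)
    have := countable_tauNumerator_eq_zero hτ
    rw [huniv] at this
    exact absurd this not_countable_complex
  · exact h

lemma eventually_comp_sub {p : ℂ → Prop} (a z : ℂ) (h : ∀ᶠ w in 𝓝[≠] (a - z), p w) :
    ∀ᶠ w in 𝓝[≠] z, p (a - w) := by
  have : Tendsto (fun w => a - w) (𝓝[≠] z) (𝓝[≠] (a - z)) := by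
    refine tendsto_nhdsWithin_iff.2 ⟨?_, ?_⟩
    · exact (continuous_const.sub continuous_id).continuousAt.tendsto.mono_left nhdsWithin_le_nhds
    · filter_upwards [self_mem_nhdsWithin] with w hw h
      exact hw (sub_right_injective h)
  exact this.eventually h

lemma eq_of_eventually_eq_punctured {f g : ℂ → ℂ} {z : ℂ} (hf : ContinuousAt f z)
    (hg : ContinuousAt g z) (h : ∀ᶠ w in 𝓝[≠] z, f w = g w) : f z = g z :=
  tendsto_nhds_unique_of_eventuallyEq (hf.tendsto.mono_left nhdsWithin_le_nhds)
    (hg.tendsto.mono_left nhdsWithin_le_nhds) h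

lemma reflected_div (hτ : 0 < τ.im) {w : ℂ} (hw : tauNumerator w τ ≠ 0)
    (h : tauDenominator (2 * tauCenter τ - w) τ ≠ 0) :
    tauNumerator (2 * tauCenter τ - w) τ / tauDenominator (2 * tauCenter τ - w) τ *
      (cexp (-(Real.pi * I * τ * (w - tauCenter τ) ^ 2)) / tauConst τ) =
      tauDenominator w τ / tauNumerator w τ := by
  have h1 := tauNumerator_mul_tauNumerator hτ (w - tauCenter τ)
  rw [add_sub_cancel, show tauCenter τ - (w - tauCenter τ) = 2 * tauCenter τ - w by ring] at h1
  have h2 := tauConst_ne_zero τ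
  have h3 : cexp (-(Real.pi * I * τ * (w - tauCenter τ) ^ 2)) *
    cexp (Real.pi * I * τ * (w - tauCenter τ) ^ 2) = 1 := by
    rw [← exp_add, neg_add_cancel, exp_zero]
  field_simp
  linear_combination cexp (-(Real.pi * I * τ * (w - tauCenter τ) ^ 2)) * h1 +
    tauConst τ * tauDenominator w τ * tauDenominator (2 * tauCenter τ - w) τ * h3

/-- The reflection formula gives this on a punctured neighbourhood, and both sides are continuous at
w. -/
lemma tauReciprocal_eq_div (hτ : 0 < τ.im) {w : ℂ} (hw : tauNumerator w τ ≠ 0) :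
    tauReciprocal w τ = tauDenominator w τ / tauNumerator w τ := by
  have hp : ¬ IsTauPole (2 * tauCenter τ - w) τ :=
    fun h => hw (tauNumerator_eq_zero_of_isTauPole hτ h)
  refine eq_of_eventually_eq_punctured (f := (tauReciprocal · τ))
    (g := fun w => tauDenominator w τ / tauNumerator w τ)
    (differentiableAt_tauReciprocal hτ hp).continuousAt
    (((differentiable_tauDenominator hτ) w).div ((differentiable_tauNumerator hτ) w)
      hw).continuousAt ?_
  filter_upwards [eventually_comp_sub _ _
    (eventually_tauDenominator_ne_zero hτ (2 * tauCenter τ - w)),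
    eventually_tauNumerator_ne_zero hτ w] with v hv hv'
  rw [tauReciprocal, tauFactorial_eq_div hτ hv, reflected_div hτ hv' hv]

lemma tauReciprocal_eq_reflected (hτ : 0 < τ.im) {w : ℂ}
    (h : tauDenominator (2 * tauCenter τ - w) τ ≠ 0) :
    tauReciprocal w τ = tauNumerator (2 * tauCenter τ - w) τ /
      tauDenominator (2 * tauCenter τ - w) τ *
      (cexp (-(Real.pi * I * τ * (w - tauCenter τ) ^ 2)) / tauConst τ) := by
  rw [tauReciprocal, tauFactorial_eq_div hτ h]

lemma tauFactorial_mul_tauReciprocal (hτ : 0 < τ.im) {w : ℂ} (hw : ¬ IsTauPole w τ)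
    (hw' : ¬ IsTauPole (2 * tauCenter τ - w) τ) : tauFactorial w τ * tauReciprocal w τ = 1 := by
  refine eq_of_eventually_eq_punctured (f := fun w => tauFactorial w τ * tauReciprocal w τ)
    (g := fun _ => 1) ((differentiableAt_tauFactorial hτ hw).mul
      (differentiableAt_tauReciprocal hτ hw')).continuousAt continuousAt_const ?_
  filter_upwards [eventually_tauDenominator_ne_zero hτ w, eventually_tauNumerator_ne_zero hτ w]
    with v hv hv'
  rw [tauFactorial_eq_div hτ hv, tauReciprocal_eq_div hτ hv']
  field_simp

/-- The integrand of the hyperbolic Ramanujan integral with its removable singularities removed. -/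
noncomputable def regularIntegrand (τ α β z : ℂ) : ℂ :=
  tauConst τ * cexp (Real.pi * I * τ * z ^ 2) * (tauReciprocal (tauCenter τ + (α + z)) τ *
    tauReciprocal (tauCenter τ + (β - z)) τ)

lemma regularIntegrand_neg (τ α β z : ℂ) :
    regularIntegrand τ α β (-z) = regularIntegrand τ β α z := by
  rw [regularIntegrand, regularIntegrand, neg_sq, ← sub_eq_add_neg, sub_neg_eq_add]
  ring

lemma countable_preimage_imaginary_axis {s : Set ℂ} (hs : s.Countable) {g : ℂ → ℂ}
    (hg : Function.Injective g) : {y : ℝ | g (I * y) ∈ s}.Countable := by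
  refine hs.preimage (f := fun y : ℝ => g (I * y)) fun x y h => ?_
  simpa using hg h

/-- The integrand can take unspecified values where a product vanishes. Those points meet the
imaginary axis in a countable set, which the integral does not see. -/
lemma ramanujanIntegrand_ae_eq (hτ : 0 < τ.im) (α β : ℂ) :
    (fun y : ℝ => ramanujanIntegrand τ α β (I * y)) =ᵐ[volume]
      fun y : ℝ => regularIntegrand τ α β (I * y) := by
  have hae : ∀ {f : ℂ → ℂ}, {z | f z = 0}.Countable → ∀ {g : ℂ → ℂ}, Function.Injective g →
      ∀ᵐ y : ℝ, f (g (I * y)) ≠ 0 := by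
    intro f hf g hg
    have := (countable_preimage_imaginary_axis hf hg).measure_zero volume
    filter_upwards [compl_mem_ae_iff.2 this] with y hy using hy
  have hN := countable_tauNumerator_eq_zero hτ
  have hD := countable_tauDenominator_eq_zero hτ
  have i1 : ∀ a : ℂ, Function.Injective (fun z => tauCenter τ + (a + z)) :=
    fun a x y h => by simpa using h
  have i2 : ∀ a : ℂ, Function.Injective (fun z => tauCenter τ + (a - z)) :=
    fun a x y h => by simpa using h
  filter_upwards [hae hD (i1 0), hae hD (i2 0), hae hD (i1 α), hae hD (i2 β), hae hN (i1 α),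
    hae hN (i2 β)] with y h1 h2 h3 h4 h5 h6
  simp only [zero_add, zero_sub] at h1 h2
  rw [← sub_eq_add_neg] at h2
  have hr := tauNumerator_mul_tauNumerator hτ (I * y)
  change tauFactorial (tauCenter τ + I * y) τ * tauFactorial (tauCenter τ - I * y) τ /
    (tauFactorial (tauCenter τ + α + I * y) τ * tauFactorial (tauCenter τ + β - I * y) τ) = _
  rw [regularIntegrand, tauReciprocal_eq_div hτ h5, tauReciprocal_eq_div hτ h6, add_assoc,
    add_sub_assoc, tauFactorial_eq_div hτ h1, tauFactorial_eq_div hτ h2,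
    tauFactorial_eq_div hτ h3, tauFactorial_eq_div hτ h4]
  generalize cexp (Real.pi * I * τ * (I * y) ^ 2) = E at hr ⊢
  field_simp
  linear_combination hr

end Reciprocal
-- Evaluation for parameters that allow the contour to be rotated.
section SmallParameters

variable {τ α β : ℂ}

lemma exists_norm_qPochhammerInf_le {q : ℂ} (hq : ‖q‖ < 1) (R : ℝ) :
    ∃ K : ℝ, ∀ a : ℂ, ‖a‖ ≤ R → ‖qPochhammerInf a q‖ ≤ K := by
  obtain ⟨K, hK⟩ := (isCompact_closedBall (0 : ℂ) R).exists_bound_of_continuousOn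
    (continuous_qPochhammerInf hq).continuousOn
  exact ⟨K, fun a ha => hK a (by simpa using ha)⟩

lemma exists_norm_inv_qPochhammerInf_le {q : ℂ} (hq : ‖q‖ < 1) {r : ℝ} (hr : r < 1) :
    ∃ K : ℝ, ∀ a : ℂ, ‖a‖ ≤ r → ‖(qPochhammerInf a q)⁻¹‖ ≤ K := by
  have hc : ContinuousOn (fun a => (qPochhammerInf a q)⁻¹) (Metric.closedBall (0 : ℂ) r) :=
    (continuous_qPochhammerInf hq).continuousOn.inv₀ fun a ha =>
      qPochhammerInf_ne_zero_of_norm_lt_one hq ((by simpa using ha : ‖a‖ ≤ r).trans_lt hr)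
  obtain ⟨K, hK⟩ := (isCompact_closedBall (0 : ℂ) r).exists_bound_of_continuousOn hc
  exact ⟨K, fun a ha => hK a (by simpa using ha)⟩

lemma norm_exp_center_sub (τ w z : ℂ) :
    ‖-cexp (Real.pi * I * (-1 / τ) - 2 * Real.pi * I * (w - z))‖ =
      Real.exp (2 * Real.pi * ((w + 1 / (2 * τ)).im - z.im)) := by
  rw [norm_neg, norm_exp]
  congr 1
  have : Real.pi * I * (-1 / τ) - 2 * Real.pi * I * (w - z) =
    ((-(2 * Real.pi) : ℝ) : ℂ) * (I * (w + 1 / (2 * τ) - z)) := by push_cast; ring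
  rw [this, re_ofReal_mul, I_mul_re, sub_im]
  ring

lemma norm_qPow_center_sub (τ w z : ℂ) :
    ‖-cexp (Real.pi * I * τ + 2 * Real.pi * I * (τ * (w - z)))‖ =
      Real.exp (-(2 * Real.pi * ((τ * (1 / 2 + w)).im - (τ * z).im))) := by
  rw [norm_neg, norm_exp]
  congr 1
  have : Real.pi * I * τ + 2 * Real.pi * I * (τ * (w - z)) =
    ((2 * Real.pi : ℝ) : ℂ) * (I * (τ * (1 / 2 + w) - τ * z)) := by push_cast; ring
  rw [this, re_ofReal_mul, I_mul_re, sub_im]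
  ring

/-- Conditions on `α` under which the contour can be rotated to the real axis. -/
structure IsSmallParameter (τ α : ℂ) : Prop where
  im_add_lt : (α + 1 / (2 * τ)).im < 0
  re_mul_neg : (τ * α).re < 0
  im_mul_pos : 0 < (τ * α).im
  im_mul_lt : (τ * α).im < τ.im / 2

/-- In the second quadrant both terms of Im(τz) have the right sign; this selects the quadrant
through which the contour is turned. -/
lemma mul_im_nonpos (hτre : τ.re < 0) (hτ : 0 < τ.im) {z : ℂ} (hz : z.re ≤ 0) (hz' : 0 ≤ z.im) :
    (τ * z).im ≤ 0 := by
  rw [mul_im]; nlinarith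

/-- Reflecting the α-factor alone replaces the Gaussian by the pure exponential exp(-2πiταz), since
z² cancels against (α+z)². The remaining products are bounded where the contour moves. -/
lemma regularIntegrand_eq_of_ne_zero (hτ : 0 < τ.im) {z : ℂ}
    (h1 : tauDenominator (tauCenter τ + (-α - z)) τ ≠ 0)
    (h2 : tauNumerator (tauCenter τ + (β - z)) τ ≠ 0) :
    regularIntegrand τ α β z = cexp (-(2 * Real.pi * I * τ * α * z)) *
      cexp (-(Real.pi * I * τ * α ^ 2)) *
      ((tauNumerator (tauCenter τ + (-α - z)) τ / tauDenominator (tauCenter τ + (-α - z)) τ) *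
        (tauDenominator (tauCenter τ + (β - z)) τ / tauNumerator (tauCenter τ + (β - z)) τ)) := by
  have h3 : 2 * tauCenter τ - (tauCenter τ + (α + z)) = tauCenter τ + (-α - z) := by ring
  rw [regularIntegrand, tauReciprocal_eq_div hτ h2, tauReciprocal_eq_reflected hτ (h3 ▸ h1), h3]
  have h4 := tauConst_ne_zero τ
  have h5 : cexp (Real.pi * I * τ * z ^ 2) *
      cexp (-(Real.pi * I * τ * (tauCenter τ + (α + z) - tauCenter τ) ^ 2)) =
      cexp (-(2 * Real.pi * I * τ * α * z)) * cexp (-(Real.pi * I * τ * α ^ 2)) := by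
    rw [← exp_add, ← exp_add]; congr 1; ring
  rw [← h5]
  field_simp

lemma regularIntegrand_eq_left (hτre : τ.re < 0) (hτ : 0 < τ.im) (hα : IsSmallParameter τ α)
    (hβ : IsSmallParameter τ β) {z : ℂ} (hz : z.re ≤ 0) (hz' : 0 ≤ z.im) :
    tauDenominator (tauCenter τ + (-α - z)) τ ≠ 0 ∧ tauNumerator (tauCenter τ + (β - z)) τ ≠ 0 ∧
    regularIntegrand τ α β z = cexp (-(2 * Real.pi * I * τ * α * z)) *
      cexp (-(Real.pi * I * τ * α ^ 2)) *
      ((tauNumerator (tauCenter τ + (-α - z)) τ / tauDenominator (tauCenter τ + (-α - z)) τ) *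
        (tauDenominator (tauCenter τ + (β - z)) τ / tauNumerator (tauCenter τ + (β - z)) τ)) := by
  have h1 : tauDenominator (tauCenter τ + (-α - z)) τ ≠ 0 := by
    rw [tauDenominator, qPow_center_add hτ]
    refine qPochhammerInf_ne_zero_of_norm_lt_one (norm_qPow_one_lt_one hτ) ?_
    rw [norm_qPow_center_sub, Real.exp_lt_one_iff]
    have e : (τ * (1 / 2 + -α)).im = τ.im / 2 - (τ * α).im := by
      have : τ * (1 / 2 + -α) = ((1 / 2 : ℝ) : ℂ) * τ - τ * α := by push_cast; ring
      rw [this, sub_im, im_ofReal_mul]; ring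
    have := mul_im_nonpos hτre hτ hz hz'
    have := hα.im_mul_lt
    rw [e]
    nlinarith [Real.pi_pos]
  have h2 : tauNumerator (tauCenter τ + (β - z)) τ ≠ 0 := by
    refine tauNumerator_center_add_ne_zero hτ ?_
    have := hβ.im_add_lt
    rw [sub_add_eq_add_sub, sub_im]; linarith
  exact ⟨h1, h2, regularIntegrand_eq_of_ne_zero hτ h1 h2⟩

/-- Throughout the quadrant the arguments of the four products stay in fixed discs, of radius below
1 for the two that are inverted. The exponential decays upwards because Re(τα) < 0 and to the left
because Im(τα) > 0. -/
lemma exists_regularIntegrand_bound (hτre : τ.re < 0) (hτ : 0 < τ.im) (hα : IsSmallParameter τ α)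
    (hβ : IsSmallParameter τ β) : ∃ K η : ℝ, 0 < η ∧
    (∀ z : ℂ, z.re ≤ 0 → 0 ≤ z.im → DifferentiableAt ℂ (regularIntegrand τ α β) z) ∧
    ∀ z : ℂ, z.re ≤ 0 → 0 ≤ z.im →
      ‖regularIntegrand τ α β z‖ ≤ K * Real.exp (-(η * (|z.re| + |z.im|))) := by
  have hq := norm_qPow_one_lt_one hτ
  have hQ := norm_qTildePow_one_lt_one hτ
  obtain ⟨K₁, hK₁⟩ := exists_norm_qPochhammerInf_le hQ
    (Real.exp (2 * Real.pi * ((-α + 1 / (2 * τ)).im)))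
  have er : Real.exp (-(2 * Real.pi * (τ * (1 / 2 + -α)).im)) < 1 := by
    rw [Real.exp_lt_one_iff]
    have e : (τ * (1 / 2 + -α)).im = τ.im / 2 - (τ * α).im := by
      have : τ * (1 / 2 + -α) = ((1 / 2 : ℝ) : ℂ) * τ - τ * α := by push_cast; ring
      rw [this, sub_im, im_ofReal_mul]; ring
    have := hα.im_mul_lt
    rw [e]
    nlinarith [Real.pi_pos]
  obtain ⟨K₂, hK₂⟩ := exists_norm_inv_qPochhammerInf_le hq er
  obtain ⟨K₃, hK₃⟩ := exists_norm_qPochhammerInf_le hq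
    (Real.exp (-(2 * Real.pi * (τ * (1 / 2 + β)).im)))
  obtain ⟨K₄, hK₄⟩ := exists_norm_inv_qPochhammerInf_le hQ
    (r := Real.exp (2 * Real.pi * ((β + 1 / (2 * τ)).im))) (by
      rw [Real.exp_lt_one_iff]; nlinarith [Real.pi_pos, hβ.im_add_lt])
  set η := 2 * Real.pi * min (-(τ * α).re) (τ * α).im with hη
  have hmin : 0 < min (-(τ * α).re) (τ * α).im := lt_min (neg_pos.2 hα.re_mul_neg) hα.im_mul_pos
  refine ⟨‖cexp (-(Real.pi * I * τ * α ^ 2))‖ * ((K₁ * K₂) * (K₃ * K₄)), η,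
    by positivity, fun z hz hz' => ?_, fun z hz hz' => ?_⟩
  · obtain ⟨h1, h2, -⟩ := regularIntegrand_eq_left hτre hτ hα hβ hz hz'
    unfold regularIntegrand
    refine DifferentiableAt.mul (by fun_prop) (DifferentiableAt.mul ?_ ?_)
    · refine DifferentiableAt.comp z (g := (tauReciprocal · τ))
        (f := fun z => tauCenter τ + (α + z)) (differentiableAt_tauReciprocal hτ fun h => h1 ?_)
        (by fun_prop)
      have h3 : 2 * tauCenter τ - (tauCenter τ + (α + z)) = tauCenter τ + (-α - z) := by ring
      rw [h3] at h
      exact tauDenominator_eq_zero_of_isTauPole hτ h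
    · exact DifferentiableAt.comp z (g := (tauReciprocal · τ))
        (f := fun z => tauCenter τ + (β - z)) (differentiableAt_tauReciprocal hτ fun h => h2
          (tauNumerator_eq_zero_of_isTauPole hτ h)) (by fun_prop)
  · obtain ⟨h1, h2, h3⟩ := regularIntegrand_eq_left hτre hτ hα hβ hz hz'
    have hpi := Real.pi_pos
    have him := mul_im_nonpos hτre hτ hz hz'
    have b1 : ‖tauNumerator (tauCenter τ + (-α - z)) τ‖ ≤ K₁ := by
      rw [tauNumerator, exp_center_add hτ]
      refine hK₁ _ ?_
      rw [norm_exp_center_sub]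
      gcongr
      linarith
    have b2 : ‖(tauDenominator (tauCenter τ + (-α - z)) τ)⁻¹‖ ≤ K₂ := by
      rw [tauDenominator, qPow_center_add hτ]
      refine hK₂ _ ?_
      rw [norm_qPow_center_sub]
      gcongr
      linarith
    have b3 : ‖tauDenominator (tauCenter τ + (β - z)) τ‖ ≤ K₃ := by
      rw [tauDenominator, qPow_center_add hτ]
      refine hK₃ _ ?_
      rw [norm_qPow_center_sub]
      gcongr
      linarith
    have b4 : ‖(tauNumerator (tauCenter τ + (β - z)) τ)⁻¹‖ ≤ K₄ := by
      rw [tauNumerator, exp_center_add hτ]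
      refine hK₄ _ ?_
      rw [norm_exp_center_sub]
      gcongr
      linarith
    have b5 : ‖cexp (-(2 * Real.pi * I * τ * α * z))‖ ≤ Real.exp (-(η * (|z.re| + |z.im|))) := by
      rw [norm_exp, Real.exp_le_exp]
      have e : -(2 * Real.pi * I * τ * α * z) = ((-(2 * Real.pi) : ℝ) : ℂ) * (I * (τ * α * z)) := by
        push_cast; ring
      rw [e, re_ofReal_mul, I_mul_re, mul_im (τ * α), abs_of_nonpos hz, abs_of_nonneg hz', hη]
      have m1 := min_le_left (-(τ * α).re) (τ * α).im
      have m2 := min_le_right (-(τ * α).re) (τ * α).im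
      generalize min (-(τ * α).re) (τ * α).im = m at *
      have a1 : m * z.im ≤ -(τ * α).re * z.im := mul_le_mul_of_nonneg_right m1 hz'
      have a2 : m * (-z.re) ≤ (τ * α).im * (-z.re) := mul_le_mul_of_nonneg_right m2 (by linarith)
      have a3 : m * (-z.re + z.im) ≤ -((τ * α).re * z.im + (τ * α).im * z.re) := by linarith
      nlinarith
    rw [h3, norm_mul, norm_mul, norm_mul, div_eq_mul_inv, div_eq_mul_inv, norm_mul, norm_mul]
    have p1 := (norm_nonneg _).trans b1
    have p2 := (norm_nonneg _).trans b2
    have p3 := (norm_nonneg _).trans b3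
    calc _ ≤ Real.exp (-(η * (|z.re| + |z.im|))) * ‖cexp (-(Real.pi * I * τ * α ^ 2))‖ *
          ((K₁ * K₂) * (K₃ * K₄)) := by gcongr
      _ = _ := by ring

lemma regularIntegrand_ofReal (hτ : 0 < τ.im) (hα : (α + 1 / (2 * τ)).im < 0)
    (hβ : (β + 1 / (2 * τ)).im < 0) (x : ℝ) :
    regularIntegrand τ α β x = tauConst τ * (gaussianDivNumerators τ α β x *
      (tauDenominator (tauCenter τ + (α + x)) τ * tauDenominator (tauCenter τ + (β - x)) τ)) := by
  rw [regularIntegrand,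
    tauReciprocal_eq_div hτ (tauNumerator_center_add_ne_zero hτ (add_ofReal_add_im_neg hα x)),
    tauReciprocal_eq_div hτ (tauNumerator_center_add_ne_zero hτ (sub_ofReal_add_im_neg hβ x)),
    gaussianDivNumerators]
  ring

/-- The evaluation of the integral, for parameters such that the contour can be rotated. -/
theorem integral_regularIntegrand_of_isSmallParameter (hτre : τ.re < 0) (hτ : 0 < τ.im)
    (hα : IsSmallParameter τ α) (hβ : IsSmallParameter τ β) :
    I * ∫ y : ℝ, regularIntegrand τ α β (I * y) = -(tauConst τ * (((-I * τ) ^ (1 / 2 : ℂ))⁻¹ *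
      (tauNumerator (1 / τ + α) τ * tauNumerator (1 / τ + β) τ /
        tauNumerator (1 / τ + α + β) τ) *
      (tauDenominator (1 / τ + α + β) τ /
        (tauDenominator (1 / τ + α) τ * tauDenominator (1 / τ + β) τ)))) := by
  obtain ⟨K, η, hη, hd, hb⟩ := exists_regularIntegrand_bound hτre hτ hα hβ
  obtain ⟨K', η', hη', hd', hb'⟩ := exists_regularIntegrand_bound hτre hτ hβ hα
  obtain ⟨i1, i2, e1⟩ := integral_imaginary_axis_eq_integral_real_axis hη hd hb
  obtain ⟨i3, i4, e2⟩ := integral_imaginary_axis_eq_integral_real_axis hη' hd' hb'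
  -- The map z ↦ -z exchanges α and β, so the lower half of the imaginary axis is handled by the
  -- same rotation with the parameters exchanged, and lands on the positive real axis.
  have hneg : ∀ y : ℝ, regularIntegrand τ α β (I * ((-y : ℝ) : ℂ)) =
      regularIntegrand τ β α (I * y) := by
    intro y
    rw [← regularIntegrand_neg]; push_cast; ring_nf
  have hneg' : ∀ y : ℝ, regularIntegrand τ β α (-y) = regularIntegrand τ α β y :=
    fun y => regularIntegrand_neg _ _ _ _
  have hintg : ∀ {g : ℝ → ℂ}, IntegrableOn g (Ioi 0) → IntegrableOn (fun x => g (-x)) (Ioi 0) →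
      Integrable g := by
    intro g h1 h2
    rw [← integrableOn_univ, ← Iic_union_Ioi (a := (0 : ℝ))]
    refine IntegrableOn.union ?_ h1
    rw [integrableOn_Iic_iff_integrableOn_Iio]
    have := IntegrableOn.comp_neg_Iio (c := (0 : ℝ)) (f := fun x => g (-x)) (by simpa using h2)
    simpa using this
  have hI : Integrable fun y : ℝ => regularIntegrand τ α β (I * y) := by
    refine hintg i1 ?_
    simp_rw [hneg]
    exact i3
  have hR : Integrable fun x : ℝ => regularIntegrand τ α β x := by
    simp_rw [hneg'] at i4
    refine hintg i4 ?_
    simpa using i2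
  rw [← integral_gaussianDivNumerators_mul hτ hα.im_add_lt hβ.im_add_lt hα.im_mul_pos
    hβ.im_mul_pos, ← integral_const_mul (tauConst τ)]
  simp_rw [← regularIntegrand_ofReal hτ hα.im_add_lt hβ.im_add_lt]
  rw [integral_eq_integral_Ioi_add hI, integral_eq_integral_Ioi_add hR]
  simp_rw [hneg, ofReal_neg]
  rw [mul_add, e1, e2]
  simp_rw [hneg']
  ring

end SmallParameters

/-! ### Holomorphic dependence of an integral on a parameter. -/

section HolomorphicIntegral

/-- An integral depending on a complex parameter is holomorphic if its integrand is, and is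
dominated locally uniformly. The derivative is the integral of the derivative. -/
lemma hasDerivAt_integral_of_dominated {F : ℂ → ℝ → ℂ} {a₀ : ℂ} {r : ℝ} (hr : 0 < r)
    (hmeas : ∀ a ∈ Metric.ball a₀ r, AEStronglyMeasurable (F a))
    (hdiff : ∀ y, DifferentiableOn ℂ (F · y) (Metric.ball a₀ r)) {g : ℝ → ℝ} (hg : Integrable g)
    (hb : ∀ a ∈ Metric.ball a₀ r, ∀ y, ‖F a y‖ ≤ g y) :
    HasDerivAt (fun a => ∫ y, F a y) (∫ y, deriv (F · y) a₀) a₀ := by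
  have hmem : ∀ a ∈ Metric.ball a₀ (r / 2), Metric.closedBall a (r / 3) ⊆ Metric.ball a₀ r := by
    intro a ha
    refine Metric.closedBall_subset_ball' ?_
    have := Metric.mem_ball.1 ha
    linarith
  have hda : ∀ a ∈ Metric.ball a₀ r, ∀ y, HasDerivAt (F · y) (deriv (F · y) a) a :=
    fun a ha y => ((hdiff y).differentiableAt (Metric.isOpen_ball.mem_nhds ha)).hasDerivAt
  have ha₀ : a₀ ∈ Metric.ball a₀ r := Metric.mem_ball_self hr
  have hs : Metric.ball a₀ (r / 2) ∈ 𝓝 a₀ := Metric.ball_mem_nhds _ (by linarith)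
  have hsub : Metric.ball a₀ (r / 2) ⊆ Metric.ball a₀ r := Metric.ball_subset_ball (by linarith)
  refine (hasDerivAt_integral_of_dominated_loc_of_deriv_le (bound := fun y => g y / (r / 3))
    (F' := fun a y => deriv (F · y) a) hs ?_ ?_ ?_ ?_ (hg.div_const _) ?_).2
  · filter_upwards [Metric.ball_mem_nhds a₀ hr] with a ha using hmeas a ha
  · exact hg.mono' (hmeas a₀ ha₀) (.of_forall fun y => hb a₀ ha₀ y)
  -- The derivative is measurable as a limit of difference quotients. The denominators n + 2 keep
  -- every a₀ + t n inside the ball.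
  · let t : ℕ → ℂ := fun n => ((r / ((n : ℝ) + 2) : ℝ) : ℂ)
    have htpos : ∀ n : ℕ, 0 < r / ((n : ℝ) + 2) := fun n => by positivity
    have ht : Tendsto t atTop (𝓝[≠] 0) := by
      refine tendsto_nhdsWithin_iff.2 ⟨?_, .of_forall fun n => ?_⟩
      · have h1 : Tendsto (fun n : ℕ => r / ((n : ℝ) + 2)) atTop (𝓝 0) :=
          tendsto_const_nhds.div_atTop
            (tendsto_atTop_add_const_right _ _ tendsto_natCast_atTop_atTop)
        have h2 := (continuous_ofReal.tendsto 0).comp h1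
        rwa [ofReal_zero] at h2
      · exact ofReal_ne_zero.2 (htpos n).ne'
    have htb : ∀ n, a₀ + t n ∈ Metric.ball a₀ r := by
      intro n
      rw [mem_ball_iff_norm, add_sub_cancel_left, norm_real, Real.norm_of_nonneg (htpos n).le]
      exact div_lt_self hr (by linarith [(Nat.cast_nonneg n : (0 : ℝ) ≤ n)])
    refine aestronglyMeasurable_of_tendsto_ae atTop
      (f := fun n => (t n)⁻¹ • (F (a₀ + t n) - F a₀)) (fun n => ?_) (.of_forall fun y => ?_)
    · exact ((hmeas _ (htb n)).sub (hmeas _ ha₀)).const_smul _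
    · exact (hda a₀ ha₀ y).tendsto_slope_zero.comp ht
  -- Cauchy's estimate on circles of radius r/3; they stay in the ball because r/2 + r/3 < r.
  · refine .of_forall fun y a ha => norm_deriv_le_of_forall_mem_sphere_norm_le (by linarith) ?_ ?_
    · exact ((hdiff y).mono (hmem a ha)).diffContOnCl_ball (subset_refl _)
    · exact fun z hz => hb z (hmem a ha (Metric.sphere_subset_closedBall hz)) y
  · exact .of_forall fun y a ha => hda a (hsub ha) y

end HolomorphicIntegral

/-! ### Continuation to all admissible parameters for Im τ > 0. -/

section Continuation

variable {τ : ℂ}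

/-- The half-planes to which the parameters of the hyperbolic Ramanujan integral are restricted. -/
def parameterDomain (τ : ℂ) : Set ℂ := {α | (τ * α).re < 0 ∧ (α - 1 / 2 + 1 / (2 * τ)).re < 0}

lemma isOpen_parameterDomain (τ : ℂ) : IsOpen (parameterDomain τ) := by
  have h1 : IsOpen {α : ℂ | (τ * α).re < 0} := isOpen_lt (by fun_prop) continuous_const
  have h2 : IsOpen {α : ℂ | (α - 1 / 2 + 1 / (2 * τ)).re < 0} :=
    isOpen_lt (by fun_prop) continuous_const
  exact h1.inter h2

lemma convex_parameterDomain (τ : ℂ) : Convex ℝ (parameterDomain τ) := by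
  refine Convex.inter (s := {α | (τ * α).re < 0}) (t := {α | (α - 1 / 2 + 1 / (2 * τ)).re < 0}) ?_ ?_
  · exact convex_halfSpace_lt (f := fun α => (τ * α).re)
      ⟨fun x y => by rw [mul_add, add_re], fun c x => by simp; ring⟩ 0
  · have : {α : ℂ | (α - 1 / 2 + 1 / (2 * τ)).re < 0} =
        {α : ℂ | α.re < (1 / 2 - 1 / (2 * τ) : ℂ).re} := by
      ext α
      simp only [mem_ofPred_eq, sub_re, add_re]
      constructor <;> intro h <;> linarith
    rw [this]
    exact convex_halfSpace_lt (f := fun α : ℂ => α.re)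
      ⟨fun x y => add_re x y, fun c x => by simp⟩ _

lemma one_div_re_neg (hτre : τ.re < 0) : (1 / τ).re < 0 := by
  rw [one_div, inv_re]
  exact div_neg_of_neg_of_pos hτre (normSq_pos.2 (by rintro rfl; simp at hτre))

lemma one_div_two_mul (τ : ℂ) : 1 / (2 * τ) = ((1 / 2 : ℝ) : ℂ) * (1 / τ) := by
  push_cast; rw [one_div_mul_one_div]

lemma re_of_isTauPole {w τ : ℂ} (hτre : τ.re < 0) (h : IsTauPole w τ) :
    w.re ≤ (1 / τ).re := by
  obtain ⟨k, n, rfl⟩ := h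
  have h1 := one_div_re_neg hτre
  have : (-k + (n + 1) / τ : ℂ) = ((-k : ℝ) : ℂ) + ((n + 1 : ℝ) : ℂ) * (1 / τ) := by push_cast; ring
  rw [this, add_re, ofReal_re, re_ofReal_mul]
  have hn : (0 : ℝ) ≤ n := Nat.cast_nonneg n
  have hk : (0 : ℝ) ≤ k := Nat.cast_nonneg k
  nlinarith

/-- All poles have real part at most Re(1/τ), and the second condition on α says exactly that the
real part of this argument exceeds Re(1/τ). -/
lemma not_isTauPole_of_mem_parameterDomain (hτre : τ.re < 0) {α : ℂ} (hα : α ∈ parameterDomain τ)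
    {z : ℂ} (hz : z.re = 0) : ¬ IsTauPole (tauCenter τ + (-α - z)) τ := by
  intro h
  have h1 := re_of_isTauPole hτre h
  have h2 := hα.2
  rw [tauCenter, one_div_two_mul] at h1
  rw [one_div_two_mul] at h2
  have e : (1 / 2 : ℂ).re = 1 / 2 := by norm_num
  simp only [add_re, sub_re, neg_re, re_ofReal_mul, e, hz] at h1 h2
  linarith

lemma re_mul_of_isTauPole {w τ : ℂ} (hτre : τ.re < 0) (h : IsTauPole w τ) :
    0 ≤ (τ * (w - 1 / τ)).re := by
  obtain ⟨k, n, rfl⟩ := h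
  have hτ0 : τ ≠ 0 := by rintro rfl; simp at hτre
  have : τ * (-k + (n + 1) / τ - 1 / τ) = ((-k : ℝ) : ℂ) * τ + ((n : ℝ) : ℂ) := by
    push_cast; field_simp; ring
  rw [this, add_re, ofReal_re, re_ofReal_mul]
  have hn : (0 : ℝ) ≤ n := Nat.cast_nonneg n
  have hk : (0 : ℝ) ≤ k := Nat.cast_nonneg k
  nlinarith

/-- The first condition on the parameters is the one that keeps the right-hand side free of poles.
-/
lemma not_isTauPole_one_div_add (hτre : τ.re < 0) {α : ℂ} (hα : (τ * α).re < 0) :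
    ¬ IsTauPole (1 / τ + α) τ := by
  intro h
  have := re_mul_of_isTauPole hτre h
  rw [add_sub_cancel_left] at this
  linarith

lemma not_isTauPole_reflected (hτre : τ.re < 0) {α β : ℂ} (hα : α ∈ parameterDomain τ)
    (hβ : β ∈ parameterDomain τ) : ¬ IsTauPole (2 * tauCenter τ - (1 / τ + α + β)) τ := by
  intro h
  have h1 := re_of_isTauPole hτre h
  have h2 := hα.2
  have h3 := hβ.2
  rw [two_mul_tauCenter] at h1
  rw [one_div_two_mul] at h2 h3
  have e : (1 / 2 : ℂ).re = 1 / 2 := by norm_num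
  simp only [add_re, sub_re, re_ofReal_mul, e, one_re] at h1 h2 h3
  linarith

lemma differentiableAt_regularIntegrand (hτre : τ.re < 0) (hτ : 0 < τ.im) {α β : ℂ}
    (hα : α ∈ parameterDomain τ) (hβ : β ∈ parameterDomain τ) {z : ℂ} (hz : z.re = 0) :
    DifferentiableAt ℂ (tauReciprocal · τ) (tauCenter τ + (α + z)) ∧
    DifferentiableAt ℂ (tauReciprocal · τ) (tauCenter τ + (β - z)) := by
  constructor
  · refine differentiableAt_tauReciprocal hτ ?_
    have := not_isTauPole_of_mem_parameterDomain hτre hα hz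
    rwa [show tauCenter τ + (-α - z) = 2 * tauCenter τ - (tauCenter τ + (α + z)) by ring] at this
  · refine differentiableAt_tauReciprocal hτ ?_
    have := not_isTauPole_of_mem_parameterDomain hτre hβ (z := -z) (by simp [hz])
    rwa [show tauCenter τ + (-β - -z) = 2 * tauCenter τ - (tauCenter τ + (β - z)) by ring] at this

lemma exp_neg_two_pi_le : Real.exp (-(2 * Real.pi)) ≤ 1 / 2 := by
  have h1 : Real.exp (-(2 * Real.pi)) ≤ Real.exp (-1) := by
    rw [Real.exp_le_exp]; linarith [Real.pi_gt_three]
  have h2 : (2 : ℝ) ≤ Real.exp 1 := by linarith [Real.add_one_le_exp (1 : ℝ)]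
  refine h1.trans ?_
  rw [Real.exp_neg, one_div]
  exact inv_anti₀ two_pos h2

/-- High on the imaginary axis the arguments of all four products are small, uniformly for bounded
parameters, so only the exponential of `regularIntegrand_eq_of_ne_zero` matters. -/
lemma exists_regularIntegrand_bound_atTop (hτre : τ.re < 0) (hτ : 0 < τ.im) (M : ℝ) :
    ∃ Y K : ℝ, 0 ≤ Y ∧ ∀ α β : ℂ, ‖α‖ ≤ M → ‖β‖ ≤ M → ∀ y : ℝ, Y ≤ y →
      ‖regularIntegrand τ α β (I * y)‖ ≤ K * Real.exp (2 * Real.pi * (τ * α).re * y) := by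
  have hq := norm_qPow_one_lt_one hτ
  have hQ := norm_qTildePow_one_lt_one hτ
  obtain ⟨K₁, hK₁⟩ := exists_norm_qPochhammerInf_le hQ (1 / 2)
  obtain ⟨K₂, hK₂⟩ := exists_norm_inv_qPochhammerInf_le hq (r := 1 / 2) (by norm_num)
  obtain ⟨K₃, hK₃⟩ := exists_norm_qPochhammerInf_le hq (1 / 2)
  obtain ⟨K₄, hK₄⟩ := exists_norm_inv_qPochhammerInf_le hQ (r := 1 / 2) (by norm_num)
  -- The two thresholds push the exponents of the q̃-arguments and of the q-arguments below -2π, and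
  -- exp(-2π) ≤ 1/2.
  refine ⟨max (max 0 (M + ‖1 / (2 * τ)‖ + 1)) ((‖τ‖ * (1 / 2 + M) + 1) / (-τ.re)),
    Real.exp (Real.pi * ‖τ‖ * M ^ 2) * ((K₁ * K₂) * (K₃ * K₄)),
    (le_max_left _ _).trans (le_max_left _ _), fun α β hα hβ y hy => ?_⟩
  have hpi := Real.pi_pos
  have hy1 : M + ‖1 / (2 * τ)‖ + 1 ≤ y := ((le_max_right _ _).trans (le_max_left _ _)).trans hy
  have hy2 : ‖τ‖ * (1 / 2 + M) + 1 ≤ -τ.re * y := by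
    have := (le_max_right _ _).trans hy
    rw [div_le_iff₀ (by linarith)] at this
    linarith
  have him : (I * (y : ℂ)).im = y := by simp
  have him' : (τ * (I * (y : ℂ))).im = τ.re * y := by simp
  have hN : ∀ w : ℂ, ‖w‖ ≤ M → ‖cexp (-(2 * Real.pi * I * (tauCenter τ + (w - I * y))))‖ ≤ 1 / 2 := by
    intro w hw
    rw [exp_center_add hτ, norm_exp_center_sub, him]
    refine le_trans (Real.exp_le_exp.2 ?_) exp_neg_two_pi_le
    have h1 : (w + 1 / (2 * τ)).im ≤ M + ‖1 / (2 * τ)‖ :=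
      (le_abs_self _).trans ((abs_im_le_norm _).trans ((norm_add_le _ _).trans (by linarith)))
    nlinarith
  have hD : ∀ w : ℂ, ‖w‖ ≤ M → ‖qPow τ (tauCenter τ + (w - I * y))‖ ≤ 1 / 2 := by
    intro w hw
    rw [qPow_center_add hτ, norm_qPow_center_sub, him']
    refine le_trans (Real.exp_le_exp.2 ?_) exp_neg_two_pi_le
    have h1 : -(τ * (1 / 2 + w)).im ≤ ‖τ‖ * (1 / 2 + M) := by
      refine (neg_le_abs _).trans ((abs_im_le_norm _).trans ?_)
      rw [norm_mul]
      gcongr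
      refine (norm_add_le _ _).trans (add_le_add ?_ hw)
      norm_num
    nlinarith
  have hα' : ‖-α‖ ≤ M := by rwa [norm_neg]
  have h1 : tauDenominator (tauCenter τ + (-α - I * y)) τ ≠ 0 :=
    qPochhammerInf_ne_zero_of_norm_lt_one hq ((hD _ hα').trans_lt (by norm_num))
  have h2 : tauNumerator (tauCenter τ + (β - I * y)) τ ≠ 0 :=
    qPochhammerInf_ne_zero_of_norm_lt_one hQ ((hN _ hβ).trans_lt (by norm_num))
  have b1 : ‖tauNumerator (tauCenter τ + (-α - I * y)) τ‖ ≤ K₁ := hK₁ _ (hN _ hα')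
  have b2 : ‖(tauDenominator (tauCenter τ + (-α - I * y)) τ)⁻¹‖ ≤ K₂ := hK₂ _ (hD _ hα')
  have b3 : ‖tauDenominator (tauCenter τ + (β - I * y)) τ‖ ≤ K₃ := hK₃ _ (hD _ hβ)
  have b4 : ‖(tauNumerator (tauCenter τ + (β - I * y)) τ)⁻¹‖ ≤ K₄ := hK₄ _ (hN _ hβ)
  have b5 : ‖cexp (-(2 * Real.pi * I * τ * α * (I * y)))‖ =
      Real.exp (2 * Real.pi * (τ * α).re * y) := by
    rw [norm_exp]
    congr 1
    have e : -(2 * Real.pi * I * τ * α * (I * y)) = ((2 * Real.pi * y : ℝ) : ℂ) * (τ * α) := by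
      push_cast; linear_combination -(2 * Real.pi * τ * α * y) * I_sq
    rw [e, re_ofReal_mul]
    ring
  have b6 : ‖cexp (-(Real.pi * I * τ * α ^ 2))‖ ≤ Real.exp (Real.pi * ‖τ‖ * M ^ 2) := by
    refine (norm_exp_le_exp_norm _).trans (Real.exp_le_exp.2 ?_)
    rw [norm_neg, norm_mul, norm_mul, norm_mul, norm_I, mul_one, norm_pow, norm_real,
      Real.norm_of_nonneg hpi.le]
    gcongr
  rw [regularIntegrand_eq_of_ne_zero hτ h1 h2, norm_mul, norm_mul, norm_mul, div_eq_mul_inv,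
    div_eq_mul_inv, norm_mul, norm_mul, b5]
  have p1 := (norm_nonneg _).trans b1
  have p2 := (norm_nonneg _).trans b2
  have p3 := (norm_nonneg _).trans b3
  calc _ ≤ Real.exp (2 * Real.pi * (τ * α).re * y) * Real.exp (Real.pi * ‖τ‖ * M ^ 2) *
        ((K₁ * K₂) * (K₃ * K₄)) := by gcongr
    _ = _ := by ring

/-- On the upper tail Re(τα) < Re(τα₀)/2 gives a uniform rate; the lower tail follows by exchanging
α and β, with rate from β; the middle is compact. -/
lemma exists_regularIntegrand_dominated (hτre : τ.re < 0) (hτ : 0 < τ.im) {α₀ β : ℂ}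
    (hα₀ : α₀ ∈ parameterDomain τ) (hβ : β ∈ parameterDomain τ) :
    ∃ r > 0, ∃ g : ℝ → ℝ, Integrable g ∧ Metric.ball α₀ r ⊆ parameterDomain τ ∧
      ∀ α ∈ Metric.ball α₀ r, ∀ y : ℝ, ‖regularIntegrand τ α β (I * y)‖ ≤ g y := by
  have hs : {α | α ∈ parameterDomain τ ∧ (τ * α).re < (τ * α₀).re / 2} ∈ 𝓝 α₀ := by
    refine inter_mem ((isOpen_parameterDomain τ).mem_nhds hα₀) ?_
    refine (isOpen_lt (f := fun α => (τ * α).re) (by fun_prop) continuous_const).mem_nhds ?_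
    have := hα₀.1
    change (τ * α₀).re < (τ * α₀).re / 2
    linarith
  obtain ⟨r, hr, hrs⟩ := Metric.nhds_basis_closedBall.mem_iff.1 hs
  have hball := (Metric.ball_subset_closedBall (x := α₀) (ε := r)).trans hrs
  obtain ⟨Y, K, hY, hK⟩ := exists_regularIntegrand_bound_atTop hτre hτ (max (‖α₀‖ + r) ‖β‖)
  obtain ⟨C, hC⟩ := ((isCompact_closedBall α₀ r).prod (isCompact_Icc (a := -Y) (b := Y))
    ).exists_bound_of_continuousOn (f := fun p : ℂ × ℝ => regularIntegrand τ p.1 β (I * p.2)) (by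
      rintro ⟨α, y⟩ ⟨hα, -⟩
      refine ContinuousAt.continuousWithinAt ?_
      obtain ⟨d1, d2⟩ := differentiableAt_regularIntegrand hτre hτ (hrs hα).1 hβ
        (z := I * y) (by simp)
      unfold regularIntegrand
      refine ContinuousAt.mul (by fun_prop) (ContinuousAt.mul ?_ ?_)
      · exact d1.continuousAt.comp (f := fun p : ℂ × ℝ => tauCenter τ + (p.1 + I * p.2))
          (x := (α, y)) (by fun_prop)
      · exact d2.continuousAt.comp (f := fun p : ℂ × ℝ => tauCenter τ + (β - I * p.2))
          (x := (α, y)) (by fun_prop))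
  have hη : 0 < 2 * Real.pi * min (-(τ * α₀).re / 2) (-(τ * β).re) := by
    have h1 := hα₀.1
    have h2 := hβ.1
    have : 0 < min (-(τ * α₀).re / 2) (-(τ * β).re) := lt_min (by linarith) (by linarith)
    positivity
  set η := 2 * Real.pi * min (-(τ * α₀).re / 2) (-(τ * β).re) with hηdef
  have hη1 : 2 * Real.pi * ((τ * α₀).re / 2) ≤ -η := by
    have := mul_le_mul_of_nonneg_left (min_le_left (-(τ * α₀).re / 2) (-(τ * β).re))
      Real.two_pi_pos.le
    linarith
  have hη2 : 2 * Real.pi * (τ * β).re ≤ -η := by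
    have := mul_le_mul_of_nonneg_left (min_le_right (-(τ * α₀).re / 2) (-(τ * β).re))
      Real.two_pi_pos.le
    linarith
  refine ⟨r, hr, fun y => max |K| (C * Real.exp (η * Y)) * Real.exp (-(η * |y|)),
    (integrable_exp_neg_mul_abs hη).const_mul _, fun α hα => (hball hα).1, fun α hα y => ?_⟩
  have hα1 : ‖α‖ ≤ max (‖α₀‖ + r) ‖β‖ := by
    have h1 := mem_ball_iff_norm.1 hα
    have h2 := norm_add_le α₀ (α - α₀)
    rw [add_sub_cancel] at h2
    exact le_max_of_le_left (by linarith)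
  have hα2 := (hball hα).2
  have hfin : ∀ {y c : ℝ}, 0 ≤ y → c ≤ -η → K * Real.exp (c * y) ≤
      max |K| (C * Real.exp (η * Y)) * Real.exp (-(η * |y|)) := by
    intro y c hy hc
    refine mul_le_mul ((le_abs_self K).trans (le_max_left _ _)) (Real.exp_le_exp.2 ?_)
      (Real.exp_pos _).le ((abs_nonneg K).trans (le_max_left _ _))
    rw [abs_of_nonneg hy]
    nlinarith
  rcases le_total Y y with hy | hy
  · refine (hK α β hα1 (le_max_right _ _) y hy).trans (hfin (hY.trans hy) ?_)
    nlinarith [Real.pi_pos]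
  rcases le_total y (-Y) with hy' | hy'
  · have h1 := hK β α (le_max_right _ _) hα1 (-y) (by linarith)
    rw [ofReal_neg, mul_neg, regularIntegrand_neg] at h1
    have h2 := hfin (y := -y) (by linarith) hη2
    rw [abs_neg] at h2
    exact h1.trans h2
  · have h1 := hC (α, y) ⟨Metric.ball_subset_closedBall hα, hy', hy⟩
    have hC0 := (norm_nonneg _).trans h1
    refine h1.trans ?_
    calc C = C * Real.exp (η * Y) * Real.exp (-(η * Y)) := by
          rw [mul_assoc, ← Real.exp_add, add_neg_cancel, Real.exp_zero, mul_one]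
      _ ≤ _ := by
          refine mul_le_mul (le_max_right _ _) (Real.exp_le_exp.2 ?_) (Real.exp_pos _).le
            ((abs_nonneg K).trans (le_max_left _ _))
          have := abs_le.2 ⟨hy', hy⟩
          nlinarith

lemma aestronglyMeasurable_regularIntegrand (hτre : τ.re < 0) (hτ : 0 < τ.im) {α β : ℂ}
    (hα : α ∈ parameterDomain τ) (hβ : β ∈ parameterDomain τ) :
    AEStronglyMeasurable fun y : ℝ => regularIntegrand τ α β (I * y) := by
  refine Continuous.aestronglyMeasurable (continuous_iff_continuousAt.2 fun y => ?_)
  obtain ⟨d1, d2⟩ := differentiableAt_regularIntegrand hτre hτ hα hβ (z := I * y) (by simp)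
  unfold regularIntegrand
  refine ContinuousAt.mul (by fun_prop) (ContinuousAt.mul ?_ ?_)
  · exact d1.continuousAt.comp (f := fun y : ℝ => tauCenter τ + (α + I * y)) (by fun_prop)
  · exact d2.continuousAt.comp (f := fun y : ℝ => tauCenter τ + (β - I * y)) (by fun_prop)

lemma integrable_regularIntegrand (hτre : τ.re < 0) (hτ : 0 < τ.im) {α β : ℂ}
    (hα : α ∈ parameterDomain τ) (hβ : β ∈ parameterDomain τ) :
    Integrable fun y : ℝ => regularIntegrand τ α β (I * y) := by
  obtain ⟨r, hr, g, hg, -, hb⟩ := exists_regularIntegrand_dominated hτre hτ hα hβ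
  exact hg.mono' (aestronglyMeasurable_regularIntegrand hτre hτ hα hβ)
    (.of_forall (hb α (Metric.mem_ball_self hr)))

lemma differentiableOn_integral_regularIntegrand (hτre : τ.re < 0) (hτ : 0 < τ.im) {β : ℂ}
    (hβ : β ∈ parameterDomain τ) :
    DifferentiableOn ℂ (fun α => ∫ y : ℝ, regularIntegrand τ α β (I * y)) (parameterDomain τ) := by
  intro α₀ hα₀
  obtain ⟨r, hr, g, hg, hsub, hb⟩ := exists_regularIntegrand_dominated hτre hτ hα₀ hβ
  refine (hasDerivAt_integral_of_dominated (F := fun α y => regularIntegrand τ α β (I * y)) hr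
    (fun α hα => aestronglyMeasurable_regularIntegrand hτre hτ (hsub hα) hβ)
    (fun y α hα => ?_) hg hb).differentiableAt.differentiableWithinAt
  obtain ⟨d1, -⟩ := differentiableAt_regularIntegrand hτre hτ (hsub hα) hβ (z := I * y) (by simp)
  unfold regularIntegrand
  refine ((DifferentiableAt.mul ?_ (by fun_prop)).const_mul _).differentiableWithinAt
  exact DifferentiableAt.comp α (g := (tauReciprocal · τ)) (f := fun α => tauCenter τ + (α + I * y))
    d1 (by fun_prop)

/-- The right hand side of the hyperbolic Ramanujan integral, with the removable singularities
removed. -/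
noncomputable def regularRamanujanValue (τ α β : ℂ) : ℂ :=
  -(tauConst τ * ((-I * τ) ^ (1 / 2 : ℂ))⁻¹) * (tauFactorial (1 / τ + α) τ *
    tauFactorial (1 / τ + β) τ * tauReciprocal (1 / τ + α + β) τ)

lemma regularRamanujanValue_comm (τ α β : ℂ) :
    regularRamanujanValue τ α β = regularRamanujanValue τ β α := by
  rw [regularRamanujanValue, regularRamanujanValue, add_right_comm, mul_comm (tauFactorial _ _)]

lemma integral_regularIntegrand_comm (τ α β : ℂ) :
    ∫ y : ℝ, regularIntegrand τ α β (I * y) = ∫ y : ℝ, regularIntegrand τ β α (I * y) := by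
  rw [← integral_neg_eq_self]
  simp_rw [ofReal_neg, mul_neg, regularIntegrand_neg]

lemma differentiableOn_regularRamanujanValue (hτre : τ.re < 0) (hτ : 0 < τ.im) {β : ℂ}
    (hβ : β ∈ parameterDomain τ) :
    DifferentiableOn ℂ (regularRamanujanValue τ · β) (parameterDomain τ) := by
  intro α hα
  have d1 := differentiableAt_tauFactorial hτ (not_isTauPole_one_div_add hτre hα.1)
  have d2 := differentiableAt_tauReciprocal hτ (not_isTauPole_reflected hτre hα hβ)
  unfold regularRamanujanValue
  refine (((DifferentiableAt.mul_const ?_ _).mul ?_).const_mul _).differentiableWithinAt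
  · exact DifferentiableAt.comp α (g := (tauFactorial · τ)) (f := fun α => 1 / τ + α)
      d1 (by fun_prop)
  · exact DifferentiableAt.comp α (g := (tauReciprocal · τ)) (f := fun α => 1 / τ + α + β)
      d2 (by fun_prop)

lemma integral_regularIntegrand_of_eventually (hτre : τ.re < 0) (hτ : 0 < τ.im) {α₀ β : ℂ}
    (hα₀ : α₀ ∈ parameterDomain τ) (hβ : β ∈ parameterDomain τ)
    (h : ∀ᶠ α in 𝓝 α₀, I * ∫ y : ℝ, regularIntegrand τ α β (I * y) = regularRamanujanValue τ α β)
    {α : ℂ} (hα : α ∈ parameterDomain τ) :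
    I * ∫ y : ℝ, regularIntegrand τ α β (I * y) = regularRamanujanValue τ α β :=
  (((differentiableOn_integral_regularIntegrand hτre hτ hβ).const_mul I).analyticOnNhd
    (isOpen_parameterDomain τ)).eqOn_of_preconnected_of_eventuallyEq
    ((differentiableOn_regularRamanujanValue hτre hτ hβ).analyticOnNhd (isOpen_parameterDomain τ))
    (convex_parameterDomain τ).isPreconnected hα₀ h hα

lemma IsSmallParameter.mem_parameterDomain (hτre : τ.re < 0) {α : ℂ}
    (hα : IsSmallParameter τ α) (h : α.re < 1 / 2) : α ∈ parameterDomain τ := by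
  refine ⟨hα.re_mul_neg, ?_⟩
  have h1 := one_div_re_neg hτre
  have e : (1 / 2 : ℂ).re = 1 / 2 := by norm_num
  rw [one_div_two_mul, add_re, re_ofReal_mul, sub_re, e]
  linarith

/-- The point 1/4 serves for every τ, being real, positive and below 1/2. -/
lemma eventually_isSmallParameter (hτre : τ.re < 0) (hτ : 0 < τ.im) :
    ∀ᶠ α in 𝓝 (1 / 4 : ℂ), IsSmallParameter τ α ∧ α.re < 1 / 2 := by
  have h4 : (1 / 4 : ℂ) = ((1 / 4 : ℝ) : ℂ) := by push_cast; rfl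
  have hτ0 := ne_zero_of_im_pos hτ
  have e1 : (1 / τ).im < 0 := by
    rw [one_div, inv_im]
    exact div_neg_of_neg_of_pos (by linarith) (normSq_pos.2 hτ0)
  have h1 : ∀ᶠ α in 𝓝 (1 / 4 : ℂ), (α + 1 / (2 * τ)).im < 0 := by
    refine (isOpen_lt (by fun_prop) continuous_const).mem_nhds ?_
    simp only [mem_ofPred_eq, h4, one_div_two_mul, add_im, im_ofReal_mul, ofReal_im]
    linarith
  have h2 : ∀ᶠ α in 𝓝 (1 / 4 : ℂ), (τ * α).re < 0 := by
    refine (isOpen_lt (by fun_prop) continuous_const).mem_nhds ?_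
    simp only [mem_ofPred_eq, h4, re_mul_ofReal]
    linarith
  have h3 : ∀ᶠ α in 𝓝 (1 / 4 : ℂ), 0 < (τ * α).im := by
    refine (isOpen_lt continuous_const (by fun_prop)).mem_nhds ?_
    simp only [mem_ofPred_eq, h4, im_mul_ofReal]
    linarith
  have h5 : ∀ᶠ α in 𝓝 (1 / 4 : ℂ), (τ * α).im < τ.im / 2 := by
    refine (isOpen_lt (by fun_prop) continuous_const).mem_nhds ?_
    simp only [mem_ofPred_eq, h4, im_mul_ofReal]
    linarith
  have h6 : ∀ᶠ α in 𝓝 (1 / 4 : ℂ), α.re < 1 / 2 := by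
    refine (isOpen_lt (by fun_prop) continuous_const).mem_nhds ?_
    simp only [mem_ofPred_eq, h4, ofReal_re]
    norm_num
  filter_upwards [h1, h2, h3, h5, h6] with α h1 h2 h3 h5 h6
  exact ⟨⟨h1, h2, h3, h5⟩, h6⟩

lemma regularRamanujanValue_of_isSmallParameter (hτre : τ.re < 0) (hτ : 0 < τ.im) {α β : ℂ}
    (hα : IsSmallParameter τ α) (hβ : IsSmallParameter τ β) :
    I * ∫ y : ℝ, regularIntegrand τ α β (I * y) = regularRamanujanValue τ α β := by
  have hD : ∀ {γ : ℂ}, IsSmallParameter τ γ → tauDenominator (1 / τ + γ) τ ≠ 0 := by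
    intro γ hγ
    rw [tauDenominator_one_div_add hτ]
    exact qPochhammerInf_ne_zero_of_norm_lt_one (norm_qPow_one_lt_one hτ)
      (norm_qPow_lt_one hγ.im_mul_pos)
  have hN : tauNumerator (1 / τ + α + β) τ ≠ 0 := by
    have e : 1 / τ + α + β = tauCenter τ + (α + β + 1 / (2 * τ) - 1 / 2) := by
      rw [tauCenter, one_div_two_mul]; push_cast; ring
    rw [e]
    refine tauNumerator_center_add_ne_zero hτ ?_
    have h1 := hα.im_add_lt
    have h2 := hβ.im_add_lt
    have e : (α + β + 1 / (2 * τ) - 1 / 2 + 1 / (2 * τ)) =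
      (α + 1 / (2 * τ)) + (β + 1 / (2 * τ)) - ((1 / 2 : ℝ) : ℂ) := by push_cast; ring
    rw [e, sub_im, add_im, ofReal_im]
    linarith
  rw [integral_regularIntegrand_of_isSmallParameter hτre hτ hα hβ, regularRamanujanValue,
    tauFactorial_eq_div hτ (hD hα), tauFactorial_eq_div hτ (hD hβ), tauReciprocal_eq_div hτ hN]
  ring

/-- Both parameters start near 1/4. The identity theorem on a convex domain frees α with β still
near 1/4, and then, by symmetry, β. -/
theorem integral_regularIntegrand (hτre : τ.re < 0) (hτ : 0 < τ.im) {α β : ℂ}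
    (hα : α ∈ parameterDomain τ) (hβ : β ∈ parameterDomain τ) :
    I * ∫ y : ℝ, regularIntegrand τ α β (I * y) = regularRamanujanValue τ α β := by
  have hev := eventually_isSmallParameter hτre hτ
  have h4 := hev.self_of_nhds.1.mem_parameterDomain hτre hev.self_of_nhds.2
  rw [integral_regularIntegrand_comm, regularRamanujanValue_comm]
  refine integral_regularIntegrand_of_eventually hτre hτ h4 hα ?_ hβ
  filter_upwards [hev] with β' hβ'
  rw [integral_regularIntegrand_comm, regularRamanujanValue_comm]
  refine integral_regularIntegrand_of_eventually hτre hτ h4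
    (hβ'.1.mem_parameterDomain hτre hβ'.2) ?_ hα
  filter_upwards [hev] with α' hα'
  exact regularRamanujanValue_of_isSmallParameter hτre hτ hα'.1 hβ'.1

/-- The hyperbolic Ramanujan integral in the case `Im τ > 0`. -/
theorem ramanujan_integral_of_im_pos (hτre : τ.re < 0) (hτ : 0 < τ.im) {α β : ℂ}
    (hα : α ∈ parameterDomain τ) (hβ : β ∈ parameterDomain τ) :
    Integrable (fun y : ℝ => ramanujanIntegrand τ α β (I * y)) ∧
      I * ∫ y : ℝ, ramanujanIntegrand τ α β (I * y) =
        -(tauConst τ / (-I * τ) ^ (1 / 2 : ℂ)) *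
          (tauFactorial (1 / τ + α) τ * tauFactorial (1 / τ + β) τ /
            tauFactorial (1 / τ + α + β) τ) := by
  refine ⟨(integrable_congr (ramanujanIntegrand_ae_eq hτ α β)).2
    (integrable_regularIntegrand hτre hτ hα hβ), ?_⟩
  -- The first condition is stable under addition, so 1/τ + α + β is no pole either, and the
  -- reciprocal there is an honest inverse.
  have hαβ : (τ * (α + β)).re < 0 := by
    rw [mul_add, add_re]; exact add_neg hα.1 hβ.1
  have hp := not_isTauPole_one_div_add hτre hαβ
  rw [← add_assoc] at hp
  have h1 := tauFactorial_mul_tauReciprocal hτ hp (not_isTauPole_reflected hτre hα hβ)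
  rw [integral_congr_ae (ramanujanIntegrand_ae_eq hτ α β), integral_regularIntegrand hτre hτ hα hβ,
    regularRamanujanValue, ← inv_eq_of_mul_eq_one_right h1]
  ring

end Continuation

/-! ### Estimates for 1 - exp(λt) on the line ℝ - iε. -/

section RowBounds

/-- The line `ℝ - i ε`, parametrized by its real part. -/
noncomputable def linePoint (ε s : ℝ) : ℂ := s - ε * I

lemma linePoint_re (ε s : ℝ) : (linePoint ε s).re = s := by simp [linePoint]

lemma linePoint_im (ε s : ℝ) : (linePoint ε s).im = -ε := by simp [linePoint]

lemma linePoint_ne_zero {ε : ℝ} (hε : 0 < ε) (s : ℝ) : linePoint ε s ≠ 0 := by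
  intro h
  have := linePoint_im ε s
  rw [h, zero_im] at this
  linarith

lemma inv_norm_linePoint_le {ε : ℝ} (hε : 0 < ε) (s : ℝ) : ‖linePoint ε s‖⁻¹ ≤ ε⁻¹ := by
  refine inv_anti₀ hε ?_
  have := abs_im_le_norm (linePoint ε s)
  rwa [linePoint_im, abs_neg, abs_of_pos hε] at this

@[fun_prop]
lemma continuous_linePoint (ε : ℝ) : Continuous (linePoint ε) := by
  unfold linePoint; fun_prop

/-- The line `ℝ - i ε` runs between the poles `0` and `2 π i / lam` of `1 / (1 - exp (lam t))`. -/
structure IsRowAdmissible (ε : ℝ) (lam : ℂ) : Prop where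
  re_neg : lam.re < 0
  lt_neg_im : ε < -(2 * Real.pi * I / lam).im

lemma IsRowAdmissible.ne_zero {ε : ℝ} {lam : ℂ} (h : IsRowAdmissible ε lam) : lam ≠ 0 := by
  rintro rfl; simpa using h.re_neg

lemma IsRowAdmissible.eventually {ε : ℝ} {lam : ℂ} (h : IsRowAdmissible ε lam) :
    ∀ᶠ l in 𝓝 lam, IsRowAdmissible ε l := by
  have h1 : ContinuousAt (fun l : ℂ => -(2 * Real.pi * I / l).im) lam := by
    refine (continuous_im.continuousAt.comp (f := fun l : ℂ => 2 * Real.pi * I / l) ?_).neg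
    exact continuousAt_const.div continuousAt_id h.ne_zero
  filter_upwards [h1.eventually (lt_mem_nhds h.lt_neg_im),
    continuous_re.continuousAt.eventually (gt_mem_nhds h.re_neg)] with l hl hl'
  exact ⟨hl', hl⟩

lemma exp_mul_linePoint_ne_one {ε : ℝ} (hε : 0 < ε) {lam : ℂ} (h : IsRowAdmissible ε lam) (s : ℝ) :
    1 - cexp (lam * linePoint ε s) ≠ 0 := by
  intro h0
  obtain ⟨n, hn⟩ := Complex.exp_eq_one_iff.1 (sub_eq_zero.1 h0).symm
  have hp := h.lt_neg_im
  have h1 : linePoint ε s = ((n : ℝ) : ℂ) * (2 * Real.pi * I / lam) := by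
    have := h.ne_zero
    field_simp
    push_cast
    linear_combination hn
  have h2 := congrArg Complex.im h1
  rw [linePoint_im, im_ofReal_mul] at h2
  rcases le_or_gt n 0 with hn0 | hn0
  · have : (n : ℝ) ≤ 0 := by exact_mod_cast hn0
    nlinarith
  · have : (1 : ℝ) ≤ n := by exact_mod_cast hn0
    nlinarith

lemma norm_one_sub_exp_ge {w : ℂ} (hw : 1 ≤ |w.re|) :
    1 / 4 * (1 + Real.exp w.re) ≤ ‖1 - cexp w‖ := by
  have h2 : (2 : ℝ) ≤ Real.exp 1 := by linarith [Real.add_one_le_exp (1 : ℝ)]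
  have hn : ‖cexp w‖ = Real.exp w.re := norm_exp w
  rcases le_abs.1 hw with h | h
  · have h1 := norm_sub_norm_le (cexp w) 1
    rw [norm_sub_rev, hn, norm_one] at h1
    have := Real.exp_le_exp.2 h
    linarith
  · have h1 := norm_sub_norm_le 1 (cexp w)
    rw [hn, norm_one] at h1
    have h3 : Real.exp w.re ≤ Real.exp (-1) := Real.exp_le_exp.2 (by linarith)
    have h4 : Real.exp (-1) ≤ 1 / 2 := by
      rw [Real.exp_neg, one_div]; exact inv_anti₀ two_pos h2
    linarith

/-- Uniformity over compact sets of λ serves the later limit in τ. If |Re(λt)| ≥ 1 the bound is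
elementary; otherwise s is confined to a fixed compact interval, where a continuous function without
zeros has a positive minimum. -/
lemma exists_norm_one_sub_exp_ge {ε : ℝ} (hε : 0 < ε) {K : Set ℂ} (hK : IsCompact K)
    (h : ∀ lam ∈ K, IsRowAdmissible ε lam) : ∃ c > 0, ∀ lam ∈ K, ∀ s : ℝ,
      c * (1 + Real.exp (lam.re * s)) ≤ ‖1 - cexp (lam * linePoint ε s)‖ := by
  rcases K.eq_empty_or_nonempty with rfl | hne
  · exact ⟨1, one_pos, by simp⟩
  obtain ⟨l₀, hl₀, hmax⟩ := hK.exists_isMaxOn hne continuous_re.continuousOn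
  obtain ⟨M, hM⟩ := hK.exists_bound_of_continuousOn (f := fun l : ℂ => l) continuousOn_id
  have hM0 : 0 ≤ M := (norm_nonneg _).trans (hM l₀ hl₀)
  have hm := (h l₀ hl₀).re_neg
  obtain ⟨x, hx, hmin⟩ := (hK.prod (isCompact_Icc (a := -((1 + ε * M) / -l₀.re))
    (b := (1 + ε * M) / -l₀.re))).exists_isMinOn
    (hne.prod ⟨0, by
      have : 0 ≤ (1 + ε * M) / -l₀.re := div_nonneg (by positivity) (by linarith)
      exact ⟨by linarith, this⟩⟩)
    (f := fun p : ℂ × ℝ => ‖1 - cexp (p.1 * linePoint ε p.2)‖ / (1 + Real.exp (p.1.re * p.2)))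
    (ContinuousOn.div (by fun_prop) (by fun_prop) fun p _ => by positivity)
  set c₀ := ‖1 - cexp (x.1 * linePoint ε x.2)‖ / (1 + Real.exp (x.1.re * x.2)) with hc₀
  have hc₀pos : 0 < c₀ :=
    div_pos (norm_pos_iff.2 (exp_mul_linePoint_ne_one hε (h _ hx.1) _)) (by positivity)
  refine ⟨min c₀ (1 / 4 * Real.exp (-(ε * M))), lt_min hc₀pos (by positivity),
    fun lam hl s => ?_⟩
  have hre : (lam * linePoint ε s).re = lam.re * s + ε * lam.im := by
    rw [mul_re, linePoint_re, linePoint_im]; ring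
  have him : |ε * lam.im| ≤ ε * M := by
    rw [abs_mul, abs_of_pos hε]
    exact mul_le_mul_of_nonneg_left ((abs_im_le_norm _).trans (hM lam hl)) hε.le
  rcases le_or_gt 1 |(lam * linePoint ε s).re| with h1 | h1
  · refine le_trans ?_ (norm_one_sub_exp_ge h1)
    rw [hre, Real.exp_add]
    have e1 : Real.exp (-(ε * M)) ≤ Real.exp (ε * lam.im) :=
      Real.exp_le_exp.2 (abs_le.1 him).1
    have e2 : Real.exp (-(ε * M)) ≤ 1 := Real.exp_le_one_iff.2 (by simp; positivity)
    calc _ ≤ 1 / 4 * Real.exp (-(ε * M)) * (1 + Real.exp (lam.re * s)) := by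
          gcongr; exact min_le_right _ _
      _ = 1 / 4 * (Real.exp (-(ε * M)) + Real.exp (lam.re * s) * Real.exp (-(ε * M))) := by ring
      _ ≤ _ := by gcongr
  · have hs : |s| ≤ (1 + ε * M) / -l₀.re := by
      rw [le_div_iff₀ (by linarith)]
      have h2 : |lam.re * s| ≤ 1 + ε * M := by
        have := abs_sub (lam.re * s + ε * lam.im) (ε * lam.im)
        rw [add_sub_cancel_right, ← hre] at this
        linarith
      rw [abs_mul, abs_of_neg (h lam hl).re_neg] at h2
      have h3 : lam.re ≤ l₀.re := hmax hl
      nlinarith [abs_nonneg s]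
    have h2 := hmin (a := (lam, s)) ⟨hl, abs_le.1 hs⟩
    have h3 : c₀ ≤ ‖1 - cexp (lam * linePoint ε s)‖ / (1 + Real.exp (lam.re * s)) := h2
    rw [le_div_iff₀ (by positivity)] at h3
    refine le_trans ?_ h3
    gcongr
    exact min_le_left _ _

/-- Of the two terms in 1 + exp(rs), the first is used for s ≥ 0 and the second for s ≤ 0. -/
lemma exp_mul_inv_one_add_exp_le {x r η : ℝ} (h1 : η ≤ -x) (h2 : η ≤ x - r) (s : ℝ) :
    Real.exp (x * s) * (1 + Real.exp (r * s))⁻¹ ≤ Real.exp (-(η * |s|)) := by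
  rw [← div_eq_mul_inv, div_le_iff₀ (by positivity), mul_add, mul_one, ← Real.exp_add]
  rcases le_total 0 s with hs | hs
  · rw [abs_of_nonneg hs]
    have : Real.exp (x * s) ≤ Real.exp (-(η * s)) := Real.exp_le_exp.2 (by nlinarith)
    linarith [Real.exp_pos (-(η * s) + r * s)]
  · rw [abs_of_nonpos hs]
    have : Real.exp (x * s) ≤ Real.exp (-(η * -s) + r * s) := Real.exp_le_exp.2 (by nlinarith)
    linarith [Real.exp_pos (-(η * -s))]

lemma exp_mul_inv_one_add_exp_mul_le {x r η : ℝ} (h1 : η ≤ 1 - x) (h2 : η ≤ x - r)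
    (s : ℝ) : Real.exp ((x - 1) * s) * ((1 + Real.exp (-1 * s))⁻¹ * (1 + Real.exp (r * s))⁻¹) ≤
      Real.exp (-(η * |s|)) := by
  rw [← mul_inv, ← div_eq_mul_inv, div_le_iff₀ (by positivity)]
  have e : Real.exp (-(η * |s|)) * ((1 + Real.exp (-1 * s)) * (1 + Real.exp (r * s))) =
      Real.exp (-(η * |s|)) + Real.exp (-(η * |s|) + -1 * s) + Real.exp (-(η * |s|) + r * s) +
      Real.exp (-(η * |s|) + -1 * s + r * s) := by
    simp only [Real.exp_add]; ring
  rw [e]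
  have p1 := Real.exp_pos (-(η * |s|))
  have p2 := Real.exp_pos (-(η * |s|) + -1 * s)
  have p3 := Real.exp_pos (-(η * |s|) + r * s)
  have p4 := Real.exp_pos (-(η * |s|) + -1 * s + r * s)
  rcases le_total 0 s with hs | hs
  · have : Real.exp ((x - 1) * s) ≤ Real.exp (-(η * |s|)) :=
      Real.exp_le_exp.2 (by rw [abs_of_nonneg hs]; nlinarith)
    linarith
  · have : Real.exp ((x - 1) * s) ≤ Real.exp (-(η * |s|) + -1 * s + r * s) :=
      Real.exp_le_exp.2 (by rw [abs_of_nonpos hs]; nlinarith)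
    linarith

lemma norm_exp_mul_linePoint (ε s : ℝ) (w : ℂ) :
    ‖cexp (w * linePoint ε s)‖ = Real.exp (ε * w.im) * Real.exp (w.re * s) := by
  rw [norm_exp, ← Real.exp_add, mul_re, linePoint_re, linePoint_im]
  congr 1; ring

end RowBounds

/-! ### Shifting horizontal lines, and residues by elementary integrals. -/

section LineShift

lemma norm_integral_vertical_le {g : ℂ → ℂ} {a b x C : ℝ} (hab : a ≤ b)
    (h : ∀ y ∈ Icc a b, ‖g (x + y * I)‖ ≤ C) : ‖∫ y in a..b, g (x + y * I)‖ ≤ C * (b - a) := by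
  have := intervalIntegral.norm_integral_le_of_norm_le_const (a := a) (b := b) (C := C)
    (f := fun y : ℝ => g (x + y * I)) (fun y hy => by
      rw [uIoc_of_le hab] at hy; exact h y ⟨hy.1.le, hy.2⟩)
  rwa [abs_of_nonneg (by linarith)] at this

/-- Shift of a horizontal contour inside a strip in which the integrand tends to `0`. -/
lemma integral_line_eq_integral_line {g : ℂ → ℂ} {a b : ℝ} (hab : a ≤ b)
    (hd : ∀ z : ℂ, a ≤ z.im → z.im ≤ b → DifferentiableAt ℂ g z) {ψ : ℝ → ℝ}
    (hψ : Tendsto ψ atTop (𝓝 0))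
    (hb : ∀ᶠ R in atTop, ∀ z : ℂ, |z.re| = R → a ≤ z.im → z.im ≤ b → ‖g z‖ ≤ ψ R)
    (ha' : Integrable fun s : ℝ => g (s + a * I)) (hb' : Integrable fun s : ℝ => g (s + b * I)) :
    ∫ s : ℝ, g (s + a * I) = ∫ s : ℝ, g (s + b * I) := by
  have hlim : Tendsto (fun R : ℝ => (∫ s in (-R)..R, g (s + a * I)) - ∫ s in (-R)..R, g (s + b * I))
      atTop (𝓝 ((∫ s : ℝ, g (s + a * I)) - ∫ s : ℝ, g (s + b * I))) :=
    (intervalIntegral_tendsto_integral ha' tendsto_neg_atTop_atBot tendsto_id).sub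
      (intervalIntegral_tendsto_integral hb' tendsto_neg_atTop_atBot tendsto_id)
  refine sub_eq_zero.1 (tendsto_nhds_unique hlim ?_)
  have h0 : Tendsto (fun R => 2 * (ψ R * (b - a))) atTop (𝓝 0) := by
    simpa using (hψ.mul_const (b - a)).const_mul 2
  refine squeeze_zero_norm' ?_ h0
  filter_upwards [hb, eventually_ge_atTop 0] with R hR hR0
  have h := integral_boundary_rect_eq_zero_of_differentiableOn g (-R + a * I : ℂ) (R + b * I) (by
    intro z hz
    rw [mem_reProdIm] at hz
    have h2 := hz.2
    simp only [add_im, neg_im, ofReal_im, neg_zero, mul_I_im, ofReal_re, zero_add] at h2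
    rw [uIcc_of_le hab] at h2
    exact (hd z h2.1 h2.2).differentiableWithinAt)
  simp only [add_im, neg_im, ofReal_im, neg_zero, mul_I_im, ofReal_re, zero_add, add_re, neg_re,
    mul_I_re, add_zero, smul_eq_mul] at h
  have b1 := norm_integral_vertical_le (g := g) (x := R) (C := ψ R) hab (fun y hy =>
    hR _ (by simp [abs_of_nonneg hR0]) (by simpa using hy.1) (by simpa using hy.2))
  have b2 := norm_integral_vertical_le (g := g) (x := -R) (C := ψ R) hab (fun y hy =>
    hR _ (by simp [abs_of_nonneg hR0]) (by simpa using hy.1) (by simpa using hy.2))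
  have e : (∫ s in (-R)..R, g (s + a * I)) - (∫ s in (-R)..R, g (s + b * I)) =
      I * (∫ y in a..b, g ((-R : ℝ) + y * I)) - I * ∫ y in a..b, g (R + y * I) := by
    linear_combination h
  rw [e]
  refine (norm_sub_le _ _).trans ?_
  rw [norm_mul, norm_mul, norm_I]
  linarith

lemma integrable_inv_sq_add_sq {u : ℝ} (hu : u ≠ 0) : Integrable fun s : ℝ => (s ^ 2 + u ^ 2)⁻¹ := by
  have h := (integrable_inv_one_add_sq.comp_div hu).const_mul ((u ^ 2)⁻¹)
  refine h.congr (.of_forall fun s => ?_)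
  simp only
  rw [← mul_inv]
  congr 1
  field_simp
  ring

lemma integral_univ_div_sq_add_sq {u : ℝ} (hu : 0 < u) : ∫ s : ℝ, u / (s ^ 2 + u ^ 2) = Real.pi := by
  have h := Measure.integral_comp_div (fun x : ℝ => (1 + x ^ 2)⁻¹) u
  rw [integral_univ_inv_one_add_sq, abs_of_pos hu, smul_eq_mul] at h
  have e : (fun s : ℝ => u / (s ^ 2 + u ^ 2)) = fun s => u⁻¹ * (1 + (s / u) ^ 2)⁻¹ := by
    funext s
    field_simp
    ring
  rw [e, integral_const_mul, h]
  field_simp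

lemma add_mul_I_ne_zero {u : ℝ} (hu : u ≠ 0) (s : ℝ) : (s + u * I : ℂ) ≠ 0 := by
  intro h
  have := congrArg Complex.im h
  simp at this
  exact hu this

lemma inv_sub_inv_norm_le {u v : ℝ} (hu : u ≠ 0) (hv : v ≠ 0) (s : ℝ) :
    ‖(s + u * I : ℂ)⁻¹ - (s + v * I : ℂ)⁻¹‖ ≤ |v - u| * ((s ^ 2 + u ^ 2)⁻¹ + (s ^ 2 + v ^ 2)⁻¹) := by
  have hn : ∀ x : ℝ, ‖(s + x * I : ℂ)‖ ^ 2 = s ^ 2 + x ^ 2 := fun x => by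
    rw [← normSq_eq_norm_sq, normSq_add_mul_I]
  rw [inv_sub_inv (add_mul_I_ne_zero hu s) (add_mul_I_ne_zero hv s), norm_div, norm_mul,
    ← hn u, ← hn v, show (s + v * I - (s + u * I) : ℂ) = ((v - u : ℝ) : ℂ) * I by push_cast; ring,
    norm_mul, norm_I, mul_one, norm_real, Real.norm_eq_abs, div_eq_mul_inv]
  gcongr
  have h1 := norm_pos_iff.2 (add_mul_I_ne_zero hu s)
  have h2 := norm_pos_iff.2 (add_mul_I_ne_zero hv s)
  generalize ‖(s + u * I : ℂ)‖ = A at *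
  generalize ‖(s + v * I : ℂ)‖ = B at *
  rw [mul_inv, ← inv_pow, ← inv_pow]
  nlinarith [sq_nonneg (A⁻¹ - B⁻¹), inv_pos.2 h1, inv_pos.2 h2, mul_pos (inv_pos.2 h1) (inv_pos.2 h2)]

lemma integrable_inv_sub_inv {u v : ℝ} (hu : u ≠ 0) (hv : v ≠ 0) :
    Integrable fun s : ℝ => (s + u * I : ℂ)⁻¹ - (s + v * I : ℂ)⁻¹ := by
  refine (((integrable_inv_sq_add_sq hu).add (integrable_inv_sq_add_sq hv)).const_mul |v - u|).mono'
    ?_ (.of_forall fun s => inv_sub_inv_norm_le hu hv s)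
  refine Continuous.aestronglyMeasurable (.sub (.inv₀ (by fun_prop) ?_) (.inv₀ (by fun_prop) ?_))
  · exact add_mul_I_ne_zero hu
  · exact add_mul_I_ne_zero hv

/-- Averaging over s ↦ -s removes the odd part and leaves Poisson kernels. -/
lemma inv_sub_inv_add_neg {u v : ℝ} (hu : u ≠ 0) (hv : v ≠ 0) (s : ℝ) :
    ((s + u * I : ℂ)⁻¹ - (s + v * I : ℂ)⁻¹) + (((-s : ℝ) + u * I : ℂ)⁻¹ - ((-s : ℝ) + v * I : ℂ)⁻¹) =
      2 * I * ((v / (s ^ 2 + v ^ 2) : ℝ) - (u / (s ^ 2 + u ^ 2) : ℝ)) := by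
  have key : ∀ {x : ℝ}, x ≠ 0 → (s + x * I : ℂ)⁻¹ + ((-s : ℝ) + x * I : ℂ)⁻¹ =
      -(2 * I * (x / (s ^ 2 + x ^ 2) : ℝ)) := by
    intro x hx
    have h1 := add_mul_I_ne_zero hx s
    have h2 := add_mul_I_ne_zero hx (-s)
    have h3 : ((s ^ 2 + x ^ 2 : ℝ) : ℂ) ≠ 0 := by
      rw [ofReal_ne_zero]; positivity
    push_cast at h2 h3 ⊢
    field_simp
    linear_combination 2 * x ^ 3 * I * I_sq
  linear_combination key hu - key hv

lemma two_mul_integral_inv_sub_inv {u v : ℝ} (hu : u ≠ 0) (hv : v ≠ 0) :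
    2 * ∫ s : ℝ, ((s + u * I : ℂ)⁻¹ - (s + v * I : ℂ)⁻¹) =
      2 * I * ((∫ s : ℝ, v / (s ^ 2 + v ^ 2) : ℝ) - (∫ s : ℝ, u / (s ^ 2 + u ^ 2) : ℝ)) := by
  have hi := integrable_inv_sub_inv hu hv
  have h1 : Integrable fun s : ℝ => ((v / (s ^ 2 + v ^ 2) : ℝ) : ℂ) :=
    ((integrable_inv_sq_add_sq hv).const_mul v).ofReal
  have h2 : Integrable fun s : ℝ => ((u / (s ^ 2 + u ^ 2) : ℝ) : ℂ) :=
    ((integrable_inv_sq_add_sq hu).const_mul u).ofReal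
  rw [two_mul]
  nth_rw 2 [← integral_neg_eq_self]
  rw [← integral_add hi hi.comp_neg]
  simp_rw [inv_sub_inv_add_neg hu hv]
  rw [integral_const_mul, integral_sub h1 h2, integral_complex_ofReal, integral_complex_ofReal]

/-- This is the residue needed later: the two poles lie on opposite sides of the line. A difference
is taken because a single simple pole is not absolutely integrable. -/
lemma integral_inv_sub_inv_of_opposite {u v : ℝ} (hu : 0 < u) (hv : v < 0) :
    ∫ s : ℝ, ((s + u * I : ℂ)⁻¹ - (s + v * I : ℂ)⁻¹) = -(2 * Real.pi * I) := by
  have h := two_mul_integral_inv_sub_inv hu.ne' hv.ne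
  have e : ∫ s : ℝ, v / (s ^ 2 + v ^ 2) = -Real.pi := by
    have := integral_univ_div_sq_add_sq (neg_pos.2 hv)
    simp_rw [neg_sq, neg_div] at this
    rw [integral_neg] at this
    linarith
  rw [e, integral_univ_div_sq_add_sq hu] at h
  push_cast at h
  linear_combination h / 2

lemma integral_inv_sub_inv_of_neg {u v : ℝ} (hu : u < 0) (hv : v < 0) :
    ∫ s : ℝ, ((s + u * I : ℂ)⁻¹ - (s + v * I : ℂ)⁻¹) = 0 := by
  have h := two_mul_integral_inv_sub_inv hu.ne hv.ne
  have e : ∀ {v : ℝ}, v < 0 → ∫ s : ℝ, v / (s ^ 2 + v ^ 2) = -Real.pi := by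
    intro v hv
    have := integral_univ_div_sq_add_sq (neg_pos.2 hv)
    simp_rw [neg_sq, neg_div] at this
    rw [integral_neg] at this
    linarith
  rw [e hv, e hu] at h
  linear_combination h / 2

end LineShift

/-! ### The integral whose exponential inverts a single factor 1 - exp(2πiw/λ). -/

section RowIntegral

variable {ε : ℝ} {lam w : ℂ}

lemma eq_of_exp_mul_eq_one (hε : 0 < ε) (h : IsRowAdmissible ε lam) {t : ℂ}
    (ht : 1 - cexp (lam * t) = 0) (h1 : -ε + (2 * Real.pi * I / lam).im ≤ t.im) (h2 : t.im ≤ -ε) :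
    t = 2 * Real.pi * I / lam := by
  obtain ⟨n, hn⟩ := Complex.exp_eq_one_iff.1 (sub_eq_zero.1 ht).symm
  have hp := h.lt_neg_im
  have h3 : t = ((n : ℝ) : ℂ) * (2 * Real.pi * I / lam) := by
    have := h.ne_zero
    field_simp
    push_cast
    linear_combination hn
  have h4 := congrArg Complex.im h3
  rw [im_ofReal_mul] at h4
  have hn1 : n = 1 := by
    by_contra hne
    rcases lt_or_gt_of_ne hne with hn0 | hn0
    · have : (n : ℝ) ≤ 0 := by exact_mod_cast Int.lt_add_one_iff.1 hn0
      nlinarith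
    · have : (2 : ℝ) ≤ n := by exact_mod_cast hn0
      nlinarith
  rw [h3, hn1, Int.cast_one, ofReal_one, one_mul]

lemma exists_norm_exp_div_le (hε : 0 < ε) (h : IsRowAdmissible ε lam) :
    ∃ C, 0 ≤ C ∧ ∀ (w : ℂ) (η : ℝ), η ≤ -w.re → η ≤ w.re - lam.re → ∀ s : ℝ,
      ‖cexp (w * linePoint ε s) / (1 - cexp (lam * linePoint ε s))‖ ≤
        C * Real.exp (ε * w.im) * Real.exp (-(η * |s|)) := by
  obtain ⟨c, hc, hb⟩ := exists_norm_one_sub_exp_ge hε (isCompact_singleton (x := lam))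
    (by rintro l rfl; exact h)
  refine ⟨c⁻¹, (inv_pos.2 hc).le, fun w η h1 h2 s => ?_⟩
  have h3 := hb lam rfl s
  rw [norm_div, norm_exp_mul_linePoint, div_eq_mul_inv]
  calc _ ≤ Real.exp (ε * w.im) * Real.exp (w.re * s) * (c * (1 + Real.exp (lam.re * s)))⁻¹ := by
        gcongr
    _ = c⁻¹ * Real.exp (ε * w.im) * (Real.exp (w.re * s) * (1 + Real.exp (lam.re * s))⁻¹) := by
        rw [mul_inv]; ring
    _ ≤ _ := by
        gcongr
        exact exp_mul_inv_one_add_exp_le h1 h2 s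

lemma exists_pos_le_of_mem_strip {x r : ℝ} (h1 : r < x) (h2 : x < 0) :
    ∃ η > 0, η ≤ -x ∧ η ≤ x - r :=
  ⟨min (-x) (x - r), lt_min (by linarith) (by linarith), min_le_left _ _, min_le_right _ _⟩

lemma continuous_exp_div (hε : 0 < ε) (h : IsRowAdmissible ε lam) (w : ℂ) :
    Continuous fun s : ℝ => cexp (w * linePoint ε s) / (1 - cexp (lam * linePoint ε s)) :=
  .div (by fun_prop) (by fun_prop) (exp_mul_linePoint_ne_one hε h)

lemma integrable_exp_div (hε : 0 < ε) (h : IsRowAdmissible ε lam) (h1 : lam.re < w.re)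
    (h2 : w.re < 0) :
    Integrable fun s : ℝ => cexp (w * linePoint ε s) / (1 - cexp (lam * linePoint ε s)) := by
  obtain ⟨C, -, hC⟩ := exists_norm_exp_div_le hε h
  obtain ⟨η, hη, h3, h4⟩ := exists_pos_le_of_mem_strip h1 h2
  exact ((integrable_exp_neg_mul_abs hη).const_mul _).mono'
    (continuous_exp_div hε h w).aestronglyMeasurable (.of_forall (hC w η h3 h4))

lemma exists_norm_exp_div_le_of_strip (h1 : lam.re < w.re) (h2 : w.re < 0) (a b : ℝ) :
    ∃ C η : ℝ, 0 < η ∧ ∀ᶠ R in atTop, ∀ z : ℂ, |z.re| = R → a ≤ z.im → z.im ≤ b →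
      ‖cexp (w * z) / (1 - cexp (lam * z))‖ ≤ C * Real.exp (-(η * R)) := by
  obtain ⟨η, hη, h3, h4⟩ := exists_pos_le_of_mem_strip h1 h2
  set H := max |a| |b|
  have hl : 0 < -lam.re := by linarith
  refine ⟨4 * Real.exp (‖w‖ * H) * Real.exp (‖lam‖ * H), η, hη, ?_⟩
  filter_upwards [eventually_ge_atTop ((1 + ‖lam‖ * H) / -lam.re)] with R hR z hz ha hb
  have him : |z.im| ≤ H := abs_le_max_abs_abs ha hb
  have hprod : ∀ v : ℂ, |v.im * z.im| ≤ ‖v‖ * H := fun v => by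
    rw [abs_mul]; exact mul_le_mul (abs_im_le_norm v) him (abs_nonneg _) (norm_nonneg _)
  have e1 : 1 ≤ |(lam * z).re| := by
    rw [div_le_iff₀ hl, ← hz] at hR
    have h5 := abs_sub_abs_le_abs_sub (lam.re * z.re) (lam.im * z.im)
    rw [← mul_re, abs_mul, abs_of_neg (neg_pos.1 hl)] at h5
    linarith [hprod lam]
  have e2 := norm_one_sub_exp_ge e1
  have e3 : Real.exp (-(‖lam‖ * H)) * (1 + Real.exp (lam.re * z.re)) ≤
      1 + Real.exp (lam * z).re := by
    have e4 : Real.exp (-(‖lam‖ * H)) ≤ 1 :=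
      Real.exp_le_one_iff.2 (neg_nonpos.2 ((abs_nonneg _).trans (hprod lam)))
    have e5 : Real.exp (-(‖lam‖ * H)) * Real.exp (lam.re * z.re) ≤ Real.exp (lam * z).re := by
      rw [← Real.exp_add, mul_re]
      exact Real.exp_le_exp.2 (by linarith [(abs_le.1 (hprod lam)).2])
    linarith
  have e6 : Real.exp (w * z).re ≤ Real.exp (‖w‖ * H) * Real.exp (w.re * z.re) := by
    rw [← Real.exp_add, mul_re]
    exact Real.exp_le_exp.2 (by linarith [(abs_le.1 (hprod w)).1])
  rw [norm_div, norm_exp, div_eq_mul_inv, ← hz]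
  calc _ ≤ Real.exp (‖w‖ * H) * Real.exp (w.re * z.re) *
        (1 / 4 * (Real.exp (-(‖lam‖ * H)) * (1 + Real.exp (lam.re * z.re))))⁻¹ := by
        gcongr; linarith
    _ = 4 * Real.exp (‖w‖ * H) * Real.exp (‖lam‖ * H) *
        (Real.exp (w.re * z.re) * (1 + Real.exp (lam.re * z.re))⁻¹) := by
        rw [mul_inv, mul_inv, Real.exp_neg, inv_inv, one_div, inv_inv]; ring
    _ ≤ _ := by
        gcongr
        exact exp_mul_inv_one_add_exp_le h3 h4 _

/-- The pole of `exp (w t) / (1 - exp (lam t))` at `p = 2 π i / lam` can be subtracted. -/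
lemma exists_differentiableAt_sub_pole (hε : 0 < ε) (h : IsRowAdmissible ε lam) (w : ℂ) :
    ∃ g : ℂ → ℂ, (∀ z : ℂ, -ε + (2 * Real.pi * I / lam).im ≤ z.im → z.im ≤ -ε →
      DifferentiableAt ℂ g z) ∧ ∀ z ≠ 2 * Real.pi * I / lam, g z =
        cexp (w * z) / (1 - cexp (lam * z)) +
          cexp (w * (2 * Real.pi * I / lam)) / lam * (z - 2 * Real.pi * I / lam)⁻¹ := by
  set p := 2 * Real.pi * I / lam with hp
  have hlam := h.ne_zero
  have hexp : cexp (lam * p) = 1 := by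
    rw [hp, mul_div_cancel₀ _ hlam, exp_two_pi_mul_I]
  let u : ℂ → ℂ := fun t => 1 - cexp (lam * t)
  have hup : u p = 0 := by simp [u, hexp]
  have hud : Differentiable ℂ u := by fun_prop
  have hd : HasDerivAt u (-lam) p := by
    have := (((hasDerivAt_id p).const_mul lam).cexp).const_sub 1
    simpa [hexp] using this
  have hh : Differentiable ℂ (dslope u p) :=
    differentiableOn_univ.1 ((differentiableOn_dslope univ_mem).2 hud.differentiableOn)
  have hhp : dslope u p p = -lam := by rw [dslope_same, hd.deriv]
  have hhne : ∀ z ≠ p, dslope u p z = (1 - cexp (lam * z)) / (z - p) := fun z hz => by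
    rw [dslope_of_ne _ hz, slope_def_field, hup, sub_zero]
  let k : ℂ → ℂ := fun t => cexp (w * t) / dslope u p t
  set S : Set ℂ := {z | dslope u p z ≠ 0} with hS
  have hSo : IsOpen S := isOpen_ne_fun hh.continuous continuous_const
  have hpS : p ∈ S := by rw [hS, mem_ofPred_eq, hhp]; exact neg_ne_zero.2 hlam
  have hk : DifferentiableOn ℂ k S := fun z hz =>
    (DifferentiableAt.div (by fun_prop) (hh z) hz).differentiableWithinAt
  have hkd := (differentiableOn_dslope (hSo.mem_nhds hpS)).2 hk
  refine ⟨dslope k p, fun z h1 h2 => ?_, fun z hz => ?_⟩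
  · refine hkd.differentiableAt (hSo.mem_nhds ?_)
    by_cases hz : z = p
    · rwa [hz]
    · rw [hS, mem_ofPred_eq, hhne z hz]
      exact div_ne_zero (fun h0 => hz (eq_of_exp_mul_eq_one hε h h0 h1 h2)) (sub_ne_zero.2 hz)
  · have hz' := sub_ne_zero.2 hz
    rw [dslope_of_ne _ hz, slope_def_field]
    simp only [k]
    rw [hhp, hhne z hz]
    by_cases h0 : 1 - cexp (lam * z) = 0
    · rw [h0]
      simp only [zero_div, div_zero]
      field_simp
      ring
    · field_simp
      ring

/-- The integral of `exp (w t) / (1 - exp (lam t))`, multiplied by the difference factor of the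
shift of the contour by one period. -/
theorem one_sub_exp_mul_integral_exp_div (hε : 0 < ε) (h : IsRowAdmissible ε lam)
    (h1 : lam.re < w.re) (h2 : w.re < 0) :
    (1 - cexp (w * (2 * Real.pi * I / lam))) *
      ∫ s : ℝ, cexp (w * linePoint ε s) / (1 - cexp (lam * linePoint ε s)) =
      2 * Real.pi * I / lam * cexp (w * (2 * Real.pi * I / lam)) := by
  obtain ⟨g₀, hg₀, hg₀'⟩ := exists_differentiableAt_sub_pole hε h w
  obtain ⟨C, η, hη, hC⟩ := exists_norm_exp_div_le_of_strip h1 h2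
    (-ε + (2 * Real.pi * I / lam).im) (-ε)
  have hint := integrable_exp_div hε h h1 h2
  have hlam := h.ne_zero
  have hexp : cexp (lam * (2 * Real.pi * I / lam)) = 1 := by
    rw [mul_div_cancel₀ _ hlam, exp_two_pi_mul_I]
  have hP := h.lt_neg_im
  set p := 2 * Real.pi * I / lam with hp
  set r := cexp (w * p) / lam with hr
  set f : ℂ → ℂ := fun z => cexp (w * z) / (1 - cexp (lam * z)) with hf
  -- Subtracting an equal pole at p', above the strip, makes the correction decay like 1/z² and
  -- hence integrable, without creating a pole between the two lines.
  set p' : ℂ := p.re + I with hp'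
  have hpre : p'.re = p.re := by simp [hp']
  have hpim : p'.im = 1 := by simp [hp']
  set g : ℂ → ℂ := fun z => g₀ z - r * (z - p')⁻¹ with hg
  have hgz : ∀ z ≠ p, g z = f z + r * ((z - p)⁻¹ - (z - p')⁻¹) := fun z hz => by
    simp only [hg, hg₀' z hz, hf]; ring
  -- The lower line is the upper one translated by p, and since exp(λp) = 1 the integrand is
  -- multiplied by exp(wp).
  have hlow : ∀ s : ℝ, f (s + p.re + (-ε + p.im : ℝ) * I) = cexp (w * p) * f (linePoint ε s) := by
    intro s
    have e : (s + p.re + (-ε + p.im : ℝ) * I : ℂ) = linePoint ε s + p := by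
      rw [linePoint]
      conv_rhs => rw [← re_add_im p]
      push_cast; ring
    simp only [hf]
    rw [e, mul_add, mul_add, exp_add, exp_add, hexp, mul_one]
    ring
  have hup : ∀ s : ℝ, f (s + (-ε : ℝ) * I) = f (linePoint ε s) := by
    intro s; rw [linePoint]; push_cast; ring_nf
  have hsub : ∀ (s c : ℝ), (s + p.re + c * I - p : ℂ) = s + (c - p.im : ℝ) * I := by
    intro s c
    apply Complex.ext <;> simp
  have hsub' : ∀ (s c : ℝ), (s + p.re + c * I - p' : ℂ) = s + (c - 1 : ℝ) * I := by
    intro s c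
    rw [hp']; push_cast; ring
  have hne : ∀ (s : ℝ) {c : ℝ}, c ≠ p.im → (s + c * I : ℂ) ≠ p := by
    intro s c hc h0
    have := congrArg Complex.im h0
    simp at this
    exact hc this
  have hline : ∀ {c : ℝ}, c ≠ p.im → ∀ s : ℝ, g ((s + p.re : ℝ) + c * I) =
      f (s + p.re + c * I) + r * ((s + (c - p.im : ℝ) * I : ℂ)⁻¹ - (s + (c - 1 : ℝ) * I : ℂ)⁻¹) := by
    intro c hc s
    rw [hgz _ (hne _ hc)]
    rw [← hsub, ← hsub']
    push_cast
    rfl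
  have n1 : -ε + p.im ≠ p.im := by linarith
  have n2 : -ε ≠ p.im := by linarith
  have hfup : Integrable fun s : ℝ => f (s + p.re + (-ε : ℝ) * I) := by
    have := hint.comp_add_right p.re
    refine this.congr (.of_forall fun s => ?_)
    have := hup (s + p.re)
    simp only [hf] at this ⊢
    rw [← this]
    push_cast; rfl
  have hflow : Integrable fun s : ℝ => f (s + p.re + (-ε + p.im : ℝ) * I) := by
    simp_rw [hlow]
    exact hint.const_mul _
  have hrup := (integrable_inv_sub_inv (u := -ε - p.im) (v := -ε - 1) (by linarith)
    (by linarith)).const_mul r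
  have hrlow := (integrable_inv_sub_inv (u := -ε + p.im - p.im) (v := -ε + p.im - 1) (by linarith)
    (by linarith)).const_mul r
  have key := integral_line_eq_integral_line (g := g) (a := -ε + p.im) (b := -ε)
    (ψ := fun R => C * Real.exp (-(η * R)) + ‖r‖ * ((R - |p.re|)⁻¹ + (R - |p.re|)⁻¹)) (by linarith)
    (fun z ha hb => by
      refine (hg₀ z ha hb).sub (((differentiableAt_id.sub_const _).inv ?_).const_mul _)
      intro h0
      have := congrArg Complex.im h0
      simp only [sub_im, hpim, zero_im] at this
      linarith)
    (by
      have t1 : Tendsto (fun R : ℝ => (R - |p.re|)⁻¹) atTop (𝓝 0) :=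
        tendsto_inv_atTop_zero.comp (tendsto_atTop_add_const_right _ _ tendsto_id)
      have t2 : Tendsto (fun R : ℝ => Real.exp (-(η * R))) atTop (𝓝 0) :=
        Real.tendsto_exp_neg_atTop_nhds_zero.comp (tendsto_id.const_mul_atTop hη)
      simpa using (t2.const_mul C).add ((t1.add t1).const_mul ‖r‖))
    (by
      filter_upwards [hC, eventually_gt_atTop |p.re|] with R hR hRp z hz ha hb
      have hge : ∀ c : ℂ, c.re = p.re → ‖(z - c)⁻¹‖ ≤ (R - |p.re|)⁻¹ := by
        intro c hc
        rw [norm_inv]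
        refine inv_anti₀ (by linarith) ?_
        have h3 := abs_re_le_norm (z - c)
        have h4 := abs_sub_abs_le_abs_sub z.re p.re
        rw [sub_re, hc] at h3
        linarith
      have hzp : z ≠ p := by rintro rfl; linarith
      rw [hgz z hzp]
      refine (norm_add_le _ _).trans (add_le_add (hR z hz ha hb) ?_)
      rw [norm_mul]
      gcongr
      exact (norm_sub_le _ _).trans (add_le_add (hge p rfl) (hge p' hpre)))
    (by
      have := (hflow.add hrlow).comp_sub_right p.re
      refine this.congr (.of_forall fun s => ?_)
      have h3 := hline n1 (s - p.re)
      rw [sub_add_cancel] at h3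
      exact h3.symm)
    (by
      have := (hfup.add hrup).comp_sub_right p.re
      refine this.congr (.of_forall fun s => ?_)
      have h3 := hline n2 (s - p.re)
      rw [sub_add_cancel] at h3
      exact h3.symm)
  rw [← integral_add_right_eq_self _ p.re,
    ← integral_add_right_eq_self (fun s : ℝ => g (s + (-ε : ℝ) * I)) p.re] at key
  simp_rw [hline n1, hline n2] at key
  -- The lower line has both p and p' above it, contributing 0; the upper line separates them,
  -- contributing -2πi.
  rw [integral_add hflow hrlow, integral_add hfup hrup, integral_const_mul, integral_const_mul,
    integral_inv_sub_inv_of_neg (by linarith) (by linarith),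
    integral_inv_sub_inv_of_opposite (by linarith) (by linarith)] at key
  simp_rw [hlow] at key
  rw [integral_const_mul] at key
  have e : ∫ s : ℝ, f (s + p.re + (-ε : ℝ) * I) = ∫ s : ℝ, f (linePoint ε s) := by
    rw [← integral_add_right_eq_self (fun s => f (linePoint ε s)) p.re]
    congr 1
    funext s
    rw [← hup]
    push_cast; rfl
  rw [e] at key
  change (1 - cexp (w * p)) * ∫ s : ℝ, f (linePoint ε s) = _
  have e2 : 2 * Real.pi * I * r = p * cexp (w * p) := by rw [hr, hp]; ring
  linear_combination e2 - key

/-- The integral of `exp (w t) / (t (1 - exp (lam t)))` along `ℝ - i ε`. -/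
noncomputable def rowIntegral (ε : ℝ) (lam w : ℂ) : ℂ :=
  ∫ s : ℝ, cexp (w * linePoint ε s) / (1 - cexp (lam * linePoint ε s)) / linePoint ε s

lemma exists_norm_rowIntegrand_le (hε : 0 < ε) (h : IsRowAdmissible ε lam) :
    ∃ C, 0 ≤ C ∧ ∀ (w : ℂ) (η : ℝ), η ≤ -w.re → η ≤ w.re - lam.re → ∀ s : ℝ,
      ‖cexp (w * linePoint ε s) / (1 - cexp (lam * linePoint ε s)) / linePoint ε s‖ ≤
        C * Real.exp (ε * w.im) * Real.exp (-(η * |s|)) := by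
  obtain ⟨C, hC0, hC⟩ := exists_norm_exp_div_le hε h
  refine ⟨C * ε⁻¹, by positivity, fun w η h1 h2 s => ?_⟩
  rw [norm_div, div_eq_mul_inv]
  calc _ ≤ C * Real.exp (ε * w.im) * Real.exp (-(η * |s|)) * ε⁻¹ := by
        exact mul_le_mul (hC w η h1 h2 s) (inv_norm_linePoint_le hε s) (by positivity)
          (by positivity)
    _ = _ := by ring

lemma continuous_rowIntegrand (hε : 0 < ε) (h : IsRowAdmissible ε lam) (w : ℂ) :
    Continuous fun s : ℝ =>
      cexp (w * linePoint ε s) / (1 - cexp (lam * linePoint ε s)) / linePoint ε s :=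
  (continuous_exp_div hε h w).div (by fun_prop) (linePoint_ne_zero hε)

/-- Differentiation in w cancels the factor 1/t, leaving the integral evaluated in
`one_sub_exp_mul_integral_exp_div`. -/
lemma hasDerivAt_rowIntegral (hε : 0 < ε) (h : IsRowAdmissible ε lam) (h1 : lam.re < w.re)
    (h2 : w.re < 0) : HasDerivAt (rowIntegral ε lam)
      (∫ s : ℝ, cexp (w * linePoint ε s) / (1 - cexp (lam * linePoint ε s))) w := by
  obtain ⟨C, hC0, hC⟩ := exists_norm_rowIntegrand_le hε h
  obtain ⟨η, hη, h3, h4⟩ := exists_pos_le_of_mem_strip h1 h2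
  have key := hasDerivAt_integral_of_dominated (r := η / 2) (a₀ := w) (half_pos hη)
    (F := fun w s => cexp (w * linePoint ε s) / (1 - cexp (lam * linePoint ε s)) / linePoint ε s)
    (fun a _ => (continuous_rowIntegrand hε h a).aestronglyMeasurable)
    (fun s => Differentiable.differentiableOn (by fun_prop))
    (g := fun s => C * Real.exp (ε * (w.im + η / 2)) * Real.exp (-(η / 2 * |s|)))
    ((integrable_exp_neg_mul_abs (half_pos hη)).const_mul _) (fun a ha s => by
      have hn := mem_ball_iff_norm.1 ha
      have b1 := abs_le.1 ((abs_re_le_norm (a - w)).trans hn.le)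
      have b2 := abs_le.1 ((abs_im_le_norm (a - w)).trans hn.le)
      rw [sub_re] at b1
      rw [sub_im] at b2
      refine (hC a (η / 2) (by linarith) (by linarith) s).trans ?_
      gcongr
      linarith)
  refine key.congr_deriv (integral_congr_ae (.of_forall fun s => ?_))
  have hd : HasDerivAt (fun a => cexp (a * linePoint ε s) / (1 - cexp (lam * linePoint ε s)) /
      linePoint ε s) (cexp (w * linePoint ε s) * linePoint ε s /
        (1 - cexp (lam * linePoint ε s)) / linePoint ε s) w :=
    (((hasDerivAt_mul_const (linePoint ε s)).cexp).div_const _).div_const _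
  simp only [hd.deriv]
  have := linePoint_ne_zero hε s
  field_simp

/-- Evaluation of the exponential of the integral of `exp (w t) / (t (1 - exp (lam t)))`. -/
theorem one_sub_exp_mul_exp_rowIntegral (hε : 0 < ε) (h : IsRowAdmissible ε lam)
    (h1 : lam.re < w.re) (h2 : w.re < 0) :
    (1 - cexp (w * (2 * Real.pi * I / lam))) * cexp (rowIntegral ε lam w) = 1 := by
  set p := 2 * Real.pi * I / lam with hp
  have hP : p.im < 0 := by linarith [h.lt_neg_im]
  -- The point w is moved down to -i∞. Along this path the product has zero derivative, by the
  -- evaluation of the differentiated integral, and both factors tend to 1.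
  let v : ℝ → ℂ := fun y => w - I * y
  have hvre : ∀ y, (v y).re = w.re := fun y => by simp [v]
  have hvim : ∀ y, (v y).im = w.im - y := fun y => by simp [v]
  have hv : ∀ y, HasDerivAt v (-I) y := fun y => by
    simpa using (((hasDerivAt_id y).ofReal_comp).const_mul I).const_sub w
  let Φ : ℝ → ℂ := fun y => (1 - cexp (v y * p)) * cexp (rowIntegral ε lam (v y))
  have hΦ : ∀ y, HasDerivAt Φ 0 y := by
    intro y
    have a1 : lam.re < (v y).re := by rwa [hvre]
    have a2 : (v y).re < 0 := by rwa [hvre]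
    have d1 := (((hv y).mul_const p).cexp).const_sub 1
    have d2 := (HasDerivAt.comp (𝕜 := ℝ) y (hasDerivAt_rowIntegral hε h a1 a2) (hv y)).cexp
    have e := one_sub_exp_mul_integral_exp_div hε h a1 a2
    rw [← hp] at e
    refine (d1.mul d2).congr_deriv ?_
    simp only [Function.comp_apply]
    linear_combination -(cexp (rowIntegral ε lam (v y)) * I) * e
  have hconst : ∀ y, Φ y = Φ 0 := fun y =>
    is_const_of_deriv_eq_zero (fun y => (hΦ y).differentiableAt) (fun y => (hΦ y).deriv) y 0
  have hlim : Tendsto Φ atTop (𝓝 ((1 - 0) * cexp 0)) := by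
    refine Tendsto.mul (tendsto_const_nhds.sub ?_) ((continuous_exp.tendsto 0).comp ?_)
    · rw [tendsto_zero_iff_norm_tendsto_zero]
      have e : ∀ y, ‖cexp (v y * p)‖ = Real.exp ((w * p).re + p.im * y) := fun y => by
        rw [norm_exp]; congr 1; simp [v]; ring
      simp_rw [e]
      exact Real.tendsto_exp_atBot.comp
        (tendsto_atBot_add_const_left _ _ (tendsto_id.const_mul_atTop_of_neg hP))
    · obtain ⟨C, hC0, hC⟩ := exists_norm_rowIntegrand_le hε h
      obtain ⟨η, hη, h3, h4⟩ := exists_pos_le_of_mem_strip h1 h2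
      have hb : ∀ y, ‖rowIntegral ε lam (v y)‖ ≤
          C * Real.exp (ε * (w.im - y)) * ∫ s : ℝ, Real.exp (-(η * |s|)) := by
        intro y
        rw [← integral_const_mul]
        refine norm_integral_le_of_norm_le ((integrable_exp_neg_mul_abs hη).const_mul _)
          (.of_forall fun s => ?_)
        have := hC (v y) η (by rwa [hvre]) (by rwa [hvre]) s
        rwa [hvim] at this
      refine squeeze_zero_norm hb ?_
      have t : Tendsto (fun y => Real.exp (ε * (w.im - y))) atTop (𝓝 0) :=
        Real.tendsto_exp_atBot.comp (Tendsto.const_mul_atBot hε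
          (tendsto_atBot_add_const_left _ _ tendsto_neg_atTop_atBot))
      simpa using (t.const_mul C).mul_const (∫ s : ℝ, Real.exp (-(η * |s|)))
  have hΦ0 : Φ = fun _ => Φ 0 := funext hconst
  rw [hΦ0] at hlim
  have := tendsto_nhds_unique hlim tendsto_const_nhds
  simpa [Φ, v] using this.symm

end RowIntegral

/-! ### The integral representation of the logarithm and its difference equations. -/

section LogIntegral

variable {ε : ℝ} {τ z : ℂ}

/-- The line `ℝ - i ε` separates the poles of the kernel of `tauLog` in the lower half plane from
the pole at the origin. -/
structure IsLineAdmissible (ε : ℝ) (τ : ℂ) : Prop where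
  pos : 0 < ε
  left : IsRowAdmissible ε (-1)
  right : IsRowAdmissible ε (1 / τ)

/-- The strip in which the `τ`-shifted factorial has neither zeros nor poles. -/
def tauStrip (τ : ℂ) : Set ℂ := {z | (1 / τ).re < z.re ∧ z.re < 1}

/-- The kernel of the integral representation of `log [z; τ]_∞`. -/
noncomputable def tauLogKernel (ε : ℝ) (z τ : ℂ) (s : ℝ) : ℂ :=
  cexp ((z - 1) * linePoint ε s) / (1 - cexp (-1 * linePoint ε s)) /
    (1 - cexp (1 / τ * linePoint ε s)) / linePoint ε s

/-- The logarithm of the `τ`-shifted factorial in the strip `tauStrip τ`. -/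
noncomputable def tauLog (ε : ℝ) (z τ : ℂ) : ℂ := -∫ s : ℝ, tauLogKernel ε z τ s

lemma continuous_tauLogKernel (h : IsLineAdmissible ε τ) (z : ℂ) :
    Continuous (tauLogKernel ε z τ) :=
  (((Continuous.div (by fun_prop) (by fun_prop) (exp_mul_linePoint_ne_one h.pos h.left)).div
    (by fun_prop) (exp_mul_linePoint_ne_one h.pos h.right))).div (by fun_prop)
    (linePoint_ne_zero h.pos)

lemma exists_norm_tauLogKernel_le (hε : 0 < ε) (h1 : IsRowAdmissible ε (-1)) {K : Set ℂ}
    (hK : IsCompact K) (h : ∀ lam ∈ K, IsRowAdmissible ε lam) :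
    ∃ C, 0 ≤ C ∧ ∀ (z τ : ℂ) (η : ℝ), 1 / τ ∈ K → η ≤ 1 - z.re → η ≤ z.re - (1 / τ).re → ∀ s : ℝ,
      ‖tauLogKernel ε z τ s‖ ≤ C * Real.exp (ε * z.im) * Real.exp (-(η * |s|)) := by
  obtain ⟨c, hc, hb⟩ := exists_norm_one_sub_exp_ge hε hK h
  obtain ⟨d, hd, hb'⟩ := exists_norm_one_sub_exp_ge hε (isCompact_singleton (x := (-1 : ℂ)))
    (by rintro l rfl; exact h1)
  refine ⟨d⁻¹ * c⁻¹ * ε⁻¹, by positivity, fun z τ η hK h2 h3 s => ?_⟩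
  have b1 := hb' _ rfl s
  have b2 := hb _ hK s
  have b3 := inv_norm_linePoint_le hε s
  rw [neg_re, one_re] at b1
  have hexp := norm_exp_mul_linePoint ε s (z - 1)
  rw [sub_im, one_im, sub_zero, sub_re, one_re] at hexp
  rw [tauLogKernel, norm_div, norm_div, norm_div, hexp, div_eq_mul_inv, div_eq_mul_inv,
    div_eq_mul_inv]
  calc _ ≤ Real.exp (ε * z.im) * Real.exp ((z.re - 1) * s) *
        (d * (1 + Real.exp (-1 * s)))⁻¹ * (c * (1 + Real.exp ((1 / τ).re * s)))⁻¹ * ε⁻¹ := by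
        refine mul_le_mul ?_ b3 (by positivity) (by positivity)
        gcongr
    _ = d⁻¹ * c⁻¹ * ε⁻¹ * Real.exp (ε * z.im) * (Real.exp ((z.re - 1) * s) *
        ((1 + Real.exp (-1 * s))⁻¹ * (1 + Real.exp ((1 / τ).re * s))⁻¹)) := by
        rw [mul_inv, mul_inv]; ring
    _ ≤ _ := by
        gcongr
        exact exp_mul_inv_one_add_exp_mul_le h2 h3 s

/-- The logarithm tends to `0` exponentially in the lower half of the strip. -/
lemma exists_norm_tauLog_le (hε : 0 < ε) (h1 : IsRowAdmissible ε (-1)) {K : Set ℂ}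
    (hK : IsCompact K) (h : ∀ lam ∈ K, IsRowAdmissible ε lam) {η : ℝ} (hη : 0 < η) :
    ∃ C, 0 ≤ C ∧ ∀ z τ : ℂ, 1 / τ ∈ K → η ≤ 1 - z.re → η ≤ z.re - (1 / τ).re →
      ‖tauLog ε z τ‖ ≤ C * Real.exp (ε * z.im) := by
  obtain ⟨C, hC0, hC⟩ := exists_norm_tauLogKernel_le hε h1 hK h
  refine ⟨C * ∫ s : ℝ, Real.exp (-(η * |s|)),
    mul_nonneg hC0 (integral_nonneg fun s => (Real.exp_pos _).le), fun z τ hτ h2 h3 => ?_⟩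
  rw [tauLog, norm_neg, mul_right_comm, ← integral_const_mul]
  exact norm_integral_le_of_norm_le ((integrable_exp_neg_mul_abs hη).const_mul _)
    (.of_forall (hC z τ η hτ h2 h3))

lemma exists_pos_le_of_mem_tauStrip (hz : z ∈ tauStrip τ) :
    ∃ η > 0, η ≤ 1 - z.re ∧ η ≤ z.re - (1 / τ).re :=
  ⟨min (1 - z.re) (z.re - (1 / τ).re), lt_min (by linarith [hz.2]) (by linarith [hz.1]),
    min_le_left _ _, min_le_right _ _⟩

lemma integrable_tauLogKernel (h : IsLineAdmissible ε τ) (hz : z ∈ tauStrip τ) :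
    Integrable (tauLogKernel ε z τ) := by
  obtain ⟨C, -, hC⟩ := exists_norm_tauLogKernel_le h.pos h.left (isCompact_singleton (x := 1 / τ))
    (by rintro l rfl; exact h.right)
  obtain ⟨η, hη, h3, h4⟩ := exists_pos_le_of_mem_tauStrip hz
  exact ((integrable_exp_neg_mul_abs hη).const_mul _).mono'
    (continuous_tauLogKernel h z).aestronglyMeasurable (.of_forall (hC z τ η rfl h3 h4))

lemma IsLineAdmissible.ne_zero (h : IsLineAdmissible ε τ) : τ ≠ 0 := by
  rintro rfl; exact h.right.ne_zero (by simp)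

lemma IsLineAdmissible.exists_compact (h : IsLineAdmissible ε τ) :
    ∃ K : Set ℂ, IsCompact K ∧ (∀ lam ∈ K, IsRowAdmissible ε lam) ∧ 1 / τ ∈ K ∧
      ∀ᶠ σ in 𝓝 τ, 1 / σ ∈ K := by
  obtain ⟨K, hK, hKc, hKs⟩ := exists_mem_nhds_isCompact_mapsTo (X := ℂ) (Y := ℂ)
    (f := id) continuous_id h.right.eventually
  have hc : ContinuousAt (fun σ : ℂ => 1 / σ) τ :=
    continuousAt_const.div continuousAt_id h.ne_zero
  exact ⟨K, hKc, fun l hl => hKs hl, mem_of_mem_nhds hK, hc hK⟩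

lemma IsLineAdmissible.eventually (h : IsLineAdmissible ε τ) :
    ∀ᶠ σ in 𝓝 τ, IsLineAdmissible ε σ := by
  obtain ⟨K, -, hK, -, hev⟩ := h.exists_compact
  filter_upwards [hev] with σ hσ using ⟨h.pos, h.left, hK _ hσ⟩

lemma continuousAt_one_div_re (h : IsLineAdmissible ε τ) :
    ContinuousAt (fun p : ℂ × ℂ => (1 / p.2).re) (z, τ) :=
  continuous_re.continuousAt.comp (f := fun p : ℂ × ℂ => 1 / p.2)
    (continuousAt_const.div (by fun_prop) h.ne_zero)

lemma eventually_mem_tauStrip (h : IsLineAdmissible ε τ) (hz : z ∈ tauStrip τ) :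
    ∀ᶠ p : ℂ × ℂ in 𝓝 (z, τ), p.1 ∈ tauStrip p.2 := by
  have h1 := (continuousAt_one_div_re (z := z) h).eventually_lt
    (g := fun p : ℂ × ℂ => p.1.re) (by fun_prop) hz.1
  have h2 := ContinuousAt.eventually_lt (f := fun p : ℂ × ℂ => p.1.re) (g := fun _ => (1 : ℝ))
    (x₀ := (z, τ)) (by fun_prop) continuousAt_const hz.2
  filter_upwards [h1, h2] with p h1 h2 using ⟨h1, h2⟩

lemma continuousAt_tauLog (h : IsLineAdmissible ε τ) (hz : z ∈ tauStrip τ) :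
    ContinuousAt (fun p : ℂ × ℂ => tauLog ε p.1 p.2) (z, τ) := by
  obtain ⟨K, hKc, hK, -, hKev⟩ := h.exists_compact
  obtain ⟨C, hC0, hC⟩ := exists_norm_tauLogKernel_le h.pos h.left hKc hK
  obtain ⟨η, hη, h3, h4⟩ := exists_pos_le_of_mem_tauStrip hz
  have hsnd : Tendsto (fun p : ℂ × ℂ => p.2) (𝓝 (z, τ)) (𝓝 τ) := continuous_snd.tendsto (z, τ)
  have e1 : ∀ᶠ p : ℂ × ℂ in 𝓝 (z, τ), η / 2 < 1 - p.1.re :=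
    ContinuousAt.eventually_lt (f := fun _ => η / 2) (x₀ := (z, τ)) continuousAt_const
      (by fun_prop) (by dsimp only; linarith)
  have e2 : ∀ᶠ p : ℂ × ℂ in 𝓝 (z, τ), η / 2 < p.1.re - (1 / p.2).re :=
    ContinuousAt.eventually_lt (f := fun _ => η / 2) (g := fun p : ℂ × ℂ => p.1.re - (1 / p.2).re)
      (x₀ := (z, τ)) continuousAt_const
      (ContinuousAt.sub (by fun_prop) (continuousAt_one_div_re h)) (by dsimp only; linarith)
  have e3 : ∀ᶠ p : ℂ × ℂ in 𝓝 (z, τ), p.1.im < z.im + 1 :=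
    ContinuousAt.eventually_lt (f := fun p : ℂ × ℂ => p.1.im) (x₀ := (z, τ)) (by fun_prop)
      continuousAt_const (by dsimp only; linarith)
  refine ContinuousAt.neg (continuousAt_of_dominated
    (bound := fun s => C * Real.exp (ε * (z.im + 1)) * Real.exp (-(η / 2 * |s|))) ?_ ?_
    ((integrable_exp_neg_mul_abs (half_pos hη)).const_mul _) (.of_forall fun s => ?_))
  · filter_upwards [hsnd.eventually h.eventually] with p hp
    exact (continuous_tauLogKernel hp p.1).aestronglyMeasurable
  · filter_upwards [hsnd.eventually hKev, e1, e2, e3] with p hp e1 e2 e3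
    refine .of_forall fun s => (hC p.1 p.2 (η / 2) hp e1.le e2.le s).trans ?_
    have := h.pos
    gcongr
  · unfold tauLogKernel
    have e : ContinuousAt (fun p : ℂ × ℂ => 1 / p.2) (z, τ) :=
      continuousAt_const.div (by fun_prop) h.ne_zero
    exact ContinuousAt.div_const (ContinuousAt.div (by fun_prop)
      (continuousAt_const.sub (e.mul_const _).cexp) (exp_mul_linePoint_ne_one h.pos h.right s)) _

lemma differentiableAt_tauLog (h : IsLineAdmissible ε τ) (hz : z ∈ tauStrip τ) :
    DifferentiableAt ℂ (tauLog ε · τ) z := by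
  obtain ⟨C, hC0, hC⟩ := exists_norm_tauLogKernel_le h.pos h.left (isCompact_singleton (x := 1 / τ))
    (by rintro l rfl; exact h.right)
  obtain ⟨η, hη, h3, h4⟩ := exists_pos_le_of_mem_tauStrip hz
  have hε := h.pos
  refine (hasDerivAt_integral_of_dominated (r := η / 2) (a₀ := z) (half_pos hη)
    (F := fun z s => tauLogKernel ε z τ s)
    (fun a _ => (continuous_tauLogKernel h a).aestronglyMeasurable)
    (fun s => Differentiable.differentiableOn (by unfold tauLogKernel; fun_prop))
    (g := fun s => C * Real.exp (ε * (z.im + η / 2)) * Real.exp (-(η / 2 * |s|)))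
    ((integrable_exp_neg_mul_abs (half_pos hη)).const_mul _) (fun a ha s => ?_)
    ).differentiableAt.neg
  have hn := mem_ball_iff_norm.1 ha
  have b1 := abs_le.1 ((abs_re_le_norm (a - z)).trans hn.le)
  have b2 := abs_le.1 ((abs_im_le_norm (a - z)).trans hn.le)
  rw [sub_re] at b1
  rw [sub_im] at b2
  refine (hC a τ (η / 2) rfl (by linarith) (by linarith) s).trans ?_
  gcongr
  linarith

/-- Differencing with step 1 cancels the factor 1 - exp(-t) of the kernel and leaves a `rowIntegral`
with λ = 1/τ. In `exp_tauLog_eq_mul` the step 1/τ cancels the other factor, leaving λ = -1. -/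
lemma exp_tauLog_add_one (h : IsLineAdmissible ε τ) (h1 : (1 / τ).re < z.re) (h2 : z.re < 0) :
    cexp (tauLog ε (z + 1) τ) = (1 - qPow τ z) * cexp (tauLog ε z τ) := by
  have hz : z ∈ tauStrip τ := ⟨h1, by linarith⟩
  have hz' : z + 1 ∈ tauStrip τ := by
    constructor <;> rw [add_re, one_re] <;> linarith
  have hrow : tauLog ε z τ = tauLog ε (z + 1) τ + rowIntegral ε (1 / τ) z := by
    rw [← sub_eq_iff_eq_add', tauLog, tauLog, neg_sub_neg,
      ← integral_sub (integrable_tauLogKernel h hz') (integrable_tauLogKernel h hz), rowIntegral]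
    refine integral_congr_ae (.of_forall fun s => ?_)
    have n1 := exp_mul_linePoint_ne_one h.pos h.left s
    simp only [tauLogKernel]
    rw [← sub_div, ← sub_div, ← sub_div]
    congr 2
    rw [div_eq_iff n1, mul_sub, mul_one, ← exp_add]
    congr 2 <;> ring
  have key := one_sub_exp_mul_exp_rowIntegral h.pos h.right h1 h2
  have e : z * (2 * Real.pi * I / (1 / τ)) = 2 * Real.pi * I * τ * z := by
    rw [div_div_eq_mul_div, div_one]; ring
  rw [e] at key
  rw [hrow, exp_add, qPow]
  linear_combination -cexp (tauLog ε (z + 1) τ) * key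

lemma exp_tauLog_eq_mul (h : IsLineAdmissible ε τ) (h1 : 0 < z.re) (h2 : z.re < 1) :
    cexp (tauLog ε z τ) = (1 - cexp (-(2 * Real.pi * I * z))) * cexp (tauLog ε (z + 1 / τ) τ) := by
  have hτ := h.right.re_neg
  have hz : z ∈ tauStrip τ := ⟨by linarith, h2⟩
  have hz' : z + 1 / τ ∈ tauStrip τ := by
    constructor <;> rw [add_re] <;> linarith
  have hrow : tauLog ε (z + 1 / τ) τ = tauLog ε z τ + rowIntegral ε (-1) (z - 1) := by
    rw [← sub_eq_iff_eq_add', tauLog, tauLog, neg_sub_neg,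
      ← integral_sub (integrable_tauLogKernel h hz) (integrable_tauLogKernel h hz'), rowIntegral]
    refine integral_congr_ae (.of_forall fun s => ?_)
    have n1 := exp_mul_linePoint_ne_one h.pos h.right s
    simp only [tauLogKernel]
    rw [← sub_div, ← sub_div, ← sub_div]
    congr 1
    rw [div_eq_iff n1, div_mul_eq_mul_div, mul_sub, mul_one, ← exp_add]
    congr 3
    ring_nf
  have key := one_sub_exp_mul_exp_rowIntegral h.pos h.left (w := z - 1)
    (by simpa using h1) (by simpa using h2)
  have e : cexp ((z - 1) * (2 * Real.pi * I / -1)) = cexp (-(2 * Real.pi * I * z)) := by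
    rw [show (z - 1) * (2 * Real.pi * I / -1) = -(2 * Real.pi * I * z) + 2 * Real.pi * I by ring,
      exp_add, exp_two_pi_mul_I, mul_one]
  rw [e] at key
  rw [hrow, exp_add]
  linear_combination -cexp (tauLog ε z τ) * key

end LogIntegral

/-! ### The integral representation agrees with the quotient of products for Im τ > 0. -/

section Identification

variable {ε : ℝ} {τ z : ℂ}

/-- The region in which both infinite products are nonzero. -/
structure IsLowerPoint (τ z : ℂ) : Prop where
  im_neg : z.im < 0
  im_mul_pos : 0 < (τ * z).im

lemma norm_exp_neg_two_pi_I_mul (z : ℂ) :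
    ‖cexp (-(2 * Real.pi * I * z))‖ = Real.exp (2 * Real.pi * z.im) := by
  rw [norm_exp]
  congr 1
  rw [show -(2 * Real.pi * I * z) = ((2 * Real.pi : ℝ) : ℂ) * (-(I * z)) by push_cast; ring,
    re_ofReal_mul, neg_re, I_mul_re, neg_neg]

lemma norm_qPow (τ z : ℂ) : ‖qPow τ z‖ = Real.exp (-(2 * Real.pi * (τ * z).im)) := by
  rw [qPow, norm_exp]
  congr 1
  rw [show 2 * Real.pi * I * τ * z = ((2 * Real.pi : ℝ) : ℂ) * (I * (τ * z)) by push_cast; ring,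
    re_ofReal_mul, I_mul_re, mul_neg]

lemma IsLowerPoint.tauNumerator_ne_zero (hτ : 0 < τ.im) (hz : IsLowerPoint τ z) :
    tauNumerator z τ ≠ 0 := by
  refine qPochhammerInf_ne_zero_of_norm_lt_one (norm_qTildePow_one_lt_one hτ) ?_
  rw [norm_exp_neg_two_pi_I_mul, Real.exp_lt_one_iff]
  have := hz.im_neg
  have := Real.pi_pos
  nlinarith

lemma IsLowerPoint.tauDenominator_ne_zero (hτ : 0 < τ.im) (hz : IsLowerPoint τ z) :
    tauDenominator z τ ≠ 0 :=
  qPochhammerInf_ne_zero_of_norm_lt_one (norm_qPow_one_lt_one hτ) (norm_qPow_lt_one hz.im_mul_pos)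

lemma IsLowerPoint.add_one (hτ : 0 < τ.im) (hz : IsLowerPoint τ z) : IsLowerPoint τ (z + 1) :=
  ⟨by simpa using hz.im_neg, by
    rw [mul_add, mul_one, add_im]; exact add_pos hz.im_mul_pos hτ⟩

lemma one_div_im_neg (hτ : 0 < τ.im) : (1 / τ).im < 0 := by
  rw [one_div, inv_im]
  exact div_neg_of_neg_of_pos (by linarith) (normSq_pos.2 (ne_zero_of_im_pos hτ))

lemma IsLowerPoint.add_one_div (hτ : 0 < τ.im) (hz : IsLowerPoint τ z) :
    IsLowerPoint τ (z + 1 / τ) :=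
  ⟨by rw [add_im]; linarith [hz.im_neg, one_div_im_neg hτ], by
    rw [mul_add, mul_one_div_cancel (ne_zero_of_im_pos hτ), add_im, one_im, add_zero]
    exact hz.im_mul_pos⟩

/-- The quotient of the product and the integral representation. -/
noncomputable def logDefect (ε : ℝ) (τ z : ℂ) : ℂ :=
  tauNumerator z τ / (tauDenominator z τ * cexp (tauLog ε z τ))

lemma logDefect_add_one (hτ : 0 < τ.im) (h : IsLineAdmissible ε τ)
    (h1 : (1 / τ).re < z.re) (h2 : z.re < 0) : logDefect ε τ (z + 1) = logDefect ε τ z := by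
  have e1 := tauNumerator_add_int z τ 1
  rw [Int.cast_one] at e1
  rw [logDefect, logDefect, e1, exp_tauLog_add_one h h1 h2, tauDenominator_eq_mul hτ z]
  congr 1
  ring

lemma logDefect_add_one_div (hτ : 0 < τ.im) (h : IsLineAdmissible ε τ) (hz : IsLowerPoint τ z)
    (h1 : 0 < z.re) (h2 : z.re < 1) : logDefect ε τ (z + 1 / τ) = logDefect ε τ z := by
  have e1 := tauDenominator_add_int_div (ne_zero_of_im_pos hτ) z 1
  rw [Int.cast_one] at e1
  have e2 := tauNumerator_eq_mul hτ z
  have hX : 1 - cexp (-(2 * Real.pi * I * z)) ≠ 0 := fun h0 => by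
    rw [h0, zero_mul] at e2
    exact hz.tauNumerator_ne_zero hτ e2
  rw [logDefect, logDefect, e1, exp_tauLog_eq_mul h h1 h2, e2, mul_left_comm,
    mul_div_mul_left _ _ hX]

/-- No point of the orbit of `z` under the translations by `1` and `1 / τ` is purely imaginary. -/
def IsGeneric (τ z : ℂ) : Prop := ∀ m n : ℤ, z.re + m + n * (1 / τ).re ≠ 0

lemma IsGeneric.add_one (h : IsGeneric τ z) : IsGeneric τ (z + 1) := by
  intro m n
  have := h (m + 1) n
  push_cast at this
  rw [add_re, one_re]
  convert this using 2
  ring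

lemma IsGeneric.add_one_div (h : IsGeneric τ z) : IsGeneric τ (z + 1 / τ) := by
  intro m n
  have := h m (n + 1)
  push_cast at this
  rw [add_re]
  convert this using 1
  ring

lemma IsGeneric.re_ne_zero (h : IsGeneric τ z) : z.re ≠ 0 := by
  simpa using h 0 0

/-- `w` lies in the right part of the strip and is equivalent to `z`. -/
structure IsOrbitPoint (ε : ℝ) (τ z w : ℂ) : Prop where
  lower : IsLowerPoint τ w
  generic : IsGeneric τ w
  re_lt_one : w.re < 1
  defect_eq : logDefect ε τ w = logDefect ε τ z

/-- The step 1 is available only while Re w < 0, and then keeps Re w < 1. Genericity prevents the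
orbit from stopping on Re w = 0. -/
lemma IsOrbitPoint.exists_re_pos (hτ : 0 < τ.im) (h : IsLineAdmissible ε τ) {w : ℂ}
    (hw : IsOrbitPoint ε τ z w) (hw' : (1 / τ).re < w.re) :
    ∃ v, IsOrbitPoint ε τ z v ∧ 0 < v.re ∧ v.im = w.im := by
  have key : ∀ (k : ℕ) (w : ℂ), -(k : ℝ) < w.re → IsOrbitPoint ε τ z w → (1 / τ).re < w.re →
      ∃ v, IsOrbitPoint ε τ z v ∧ 0 < v.re ∧ v.im = w.im := by
    intro k
    induction k with
    | zero => exact fun w hk hw _ => ⟨w, hw, by simpa using hk, rfl⟩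
    | succ k ih =>
      intro w hk hw hw'
      rcases lt_or_gt_of_ne hw.generic.re_ne_zero with h0 | h0
      · obtain ⟨v, hv, hv0, hvi⟩ := ih (w + 1) (by push_cast at hk; simp; linarith)
          ⟨hw.lower.add_one hτ, hw.generic.add_one, by simpa using h0,
            (logDefect_add_one hτ h hw' h0).trans hw.defect_eq⟩
          (by rw [add_re, one_re]; linarith)
        exact ⟨v, hv, hv0, by simpa using hvi⟩
      · exact ⟨w, hw, h0, rfl⟩
  obtain ⟨k, hk⟩ := exists_nat_gt (-w.re)
  exact key k w (by linarith) hw hw'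

/-- One step 1/τ followed by enough steps 1 returns to the right part of the strip and lowers the
imaginary part by -Im(1/τ) > 0. -/
lemma exists_isOrbitPoint (hτ : 0 < τ.im) (h : IsLineAdmissible ε τ) (hz : z ∈ tauStrip τ)
    (hl : IsLowerPoint τ z) (hg : IsGeneric τ z) (k : ℕ) :
    ∃ w, IsOrbitPoint ε τ z w ∧ 0 < w.re ∧ w.im = z.im + k * (1 / τ).im := by
  induction k with
  | zero =>
    obtain ⟨v, hv, hv0, hvi⟩ := IsOrbitPoint.exists_re_pos hτ h (w := z) ⟨hl, hg, hz.2, rfl⟩ hz.1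
    exact ⟨v, hv, hv0, by simpa using hvi⟩
  | succ k ih =>
    obtain ⟨w, hw, hw0, hwi⟩ := ih
    have hr := h.right.re_neg
    obtain ⟨v, hv, hv0, hvi⟩ := IsOrbitPoint.exists_re_pos hτ h (w := w + 1 / τ) (z := z)
      ⟨hw.lower.add_one_div hτ, hw.generic.add_one_div, by rw [add_re]; linarith [hw.re_lt_one],
        (logDefect_add_one_div hτ h hw.lower hw0 hw.re_lt_one).trans hw.defect_eq⟩
      (by rw [add_re]; linarith)
    refine ⟨v, hv, hv0, ?_⟩
    rw [hvi, add_im, hwi]; push_cast; ring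

/-- The bound on `tauLog` degenerates at the edges of the strip. If Re w ≤ 1/2 the point w keeps a
fixed distance from both edges, and otherwise w + 1/τ does. -/
lemma exists_orbit_in_substrip (hτ : 0 < τ.im) (h : IsLineAdmissible ε τ) (hz : z ∈ tauStrip τ)
    (hl : IsLowerPoint τ z) (hg : IsGeneric τ z) (k : ℕ) :
    ∃ w, logDefect ε τ w = logDefect ε τ z ∧ w.im ≤ z.im + k * (1 / τ).im ∧
      min (-(1 / τ).re) (1 / 2) ≤ 1 - w.re ∧
      min (-(1 / τ).re) (1 / 2) ≤ w.re - (1 / τ).re := by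
  obtain ⟨w, hw, hw0, hwi⟩ := exists_isOrbitPoint hτ h hz hl hg k
  have hr := h.right.re_neg
  have m1 := min_le_left (-(1 / τ).re) (1 / 2)
  have m2 := min_le_right (-(1 / τ).re) (1 / 2)
  rcases le_total w.re (1 / 2) with h2 | h2
  · exact ⟨w, hw.defect_eq, hwi.le, by linarith, by linarith⟩
  · refine ⟨w + 1 / τ, (logDefect_add_one_div hτ h hw.lower hw0 hw.re_lt_one).trans hw.defect_eq,
      ?_, ?_, ?_⟩
    · rw [add_im]; linarith [one_div_im_neg hτ]
    · rw [add_re]; linarith [hw.re_lt_one]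
    · rw [add_re]; linarith

/-- The quotient is constant along the orbit. As Im w → -∞ with Re w bounded below, Re τ < 0 forces
Im(τw) → ∞, so both products and the exponential tend to 1. -/
lemma logDefect_eq_one (hτre : τ.re < 0) (hτ : 0 < τ.im) (h : IsLineAdmissible ε τ)
    (hz : z ∈ tauStrip τ) (hl : IsLowerPoint τ z) (hg : IsGeneric τ z) : logDefect ε τ z = 1 := by
  choose w hw hwi h1 h2 using exists_orbit_in_substrip hτ h hz hl hg
  have hr := h.right.re_neg
  have hη : 0 < min (-(1 / τ).re) (1 / 2) := lt_min (by linarith) (by norm_num)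
  set η := min (-(1 / τ).re) (1 / 2)
  obtain ⟨C, hC0, hC⟩ := exists_norm_tauLog_le h.pos h.left (isCompact_singleton (x := 1 / τ))
    (by rintro l rfl; exact h.right) hη
  have him : Tendsto (fun k => (w k).im) atTop atBot := by
    refine tendsto_atBot_mono hwi (tendsto_atBot_add_const_left _ _ ?_)
    exact tendsto_natCast_atTop_atTop.atTop_mul_const_of_neg (one_div_im_neg hτ)
  have hqim : Tendsto (fun k => (τ * w k).im) atTop atTop := by
    have hlow : ∀ k, τ.re * (w k).im + τ.im * (1 / τ).re ≤ (τ * w k).im := by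
      intro k
      rw [mul_im]
      have := mul_le_mul_of_nonneg_left (show (1 / τ).re ≤ (w k).re by linarith [h2 k]) hτ.le
      linarith
    exact tendsto_atTop_mono hlow (tendsto_atTop_add_const_right _ _
      (him.const_mul_atBot_of_neg hτre))
  have tL : Tendsto (fun k => tauLog ε (w k) τ) atTop (𝓝 0) := by
    refine squeeze_zero_norm (fun k => hC (w k) τ rfl (h1 k) (h2 k)) ?_
    simpa using (Real.tendsto_exp_atBot.comp (him.const_mul_atBot h.pos)).const_mul C
  have tX : Tendsto (fun k => cexp (-(2 * Real.pi * I * w k))) atTop (𝓝 0) := by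
    rw [tendsto_zero_iff_norm_tendsto_zero]
    simp_rw [norm_exp_neg_two_pi_I_mul]
    exact Real.tendsto_exp_atBot.comp (him.const_mul_atBot Real.two_pi_pos)
  have tq : Tendsto (fun k => qPow τ (w k)) atTop (𝓝 0) := by
    rw [tendsto_zero_iff_norm_tendsto_zero]
    simp_rw [norm_qPow]
    exact Real.tendsto_exp_neg_atTop_nhds_zero.comp (hqim.const_mul_atTop Real.two_pi_pos)
  have tN : Tendsto (fun k => tauNumerator (w k) τ) atTop (𝓝 1) := by
    rw [← qPochhammerInf_zero_left (qTildePow τ 1)]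
    exact ((continuous_qPochhammerInf (norm_qTildePow_one_lt_one hτ)).tendsto 0).comp tX
  have tD : Tendsto (fun k => tauDenominator (w k) τ) atTop (𝓝 1) := by
    rw [← qPochhammerInf_zero_left (qPow τ 1)]
    exact ((continuous_qPochhammerInf (norm_qPow_one_lt_one hτ)).tendsto 0).comp tq
  have tG : Tendsto (fun k => logDefect ε τ (w k)) atTop (𝓝 (1 / (1 * cexp 0))) :=
    tN.div (tD.mul ((continuous_exp.tendsto 0).comp tL)) (by simp)
  simp_rw [hw] at tG
  simpa using tendsto_nhds_unique tendsto_const_nhds tG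

lemma countable_not_isGeneric (τ : ℂ) : {x : ℝ | ∃ m n : ℤ, x + m + n * (1 / τ).re = 0}.Countable := by
  refine (countable_range fun p : ℤ × ℤ => -(p.1 : ℝ) - p.2 * (1 / τ).re).mono ?_
  rintro x ⟨m, n, h⟩
  exact ⟨(m, n), by simp only; linarith⟩

/-- The integral representation of the `τ`-shifted factorial in the upper half plane. -/
theorem tauNumerator_eq_mul_exp_tauLog (hτre : τ.re < 0) (hτ : 0 < τ.im)
    (h : IsLineAdmissible ε τ) (hz : z ∈ tauStrip τ) :
    tauNumerator z τ = tauDenominator z τ * cexp (tauLog ε z τ) := by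
  have hr := h.right.re_neg
  have hconv : Convex ℝ (tauStrip τ) :=
    (convex_halfSpace_gt (f := re) ⟨add_re, fun c x => by simp⟩ _).inter
      (convex_halfSpace_lt (f := re) ⟨add_re, fun c x => by simp⟩ _)
  have hopen : IsOpen (tauStrip τ) :=
    (isOpen_lt continuous_const continuous_re).inter (isOpen_lt continuous_re continuous_const)
  have han1 : AnalyticOnNhd ℂ (tauNumerator · τ) (tauStrip τ) :=
    (differentiable_tauNumerator hτ).differentiableOn.analyticOnNhd hopen
  have han2 : AnalyticOnNhd ℂ (fun z => tauDenominator z τ * cexp (tauLog ε z τ)) (tauStrip τ) :=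
    DifferentiableOn.analyticOnNhd (fun z hz => (((differentiable_tauDenominator hτ) z).mul
      (differentiableAt_tauLog h hz).cexp).differentiableWithinAt) hopen
  have hz₀ : (1 / 2 - I : ℂ) ∈ tauStrip τ := by
    have e : (1 / 2 - I : ℂ).re = 1 / 2 := by norm_num
    constructor <;> rw [e] <;> linarith
  refine han1.eqOn_of_preconnected_of_frequently_eq han2 hconv.isPreconnected hz₀ ?_ hz
  intro hne
  have hlow : ∀ᶠ w in 𝓝 (1 / 2 - I : ℂ), IsLowerPoint τ w := by
    have e1 : ∀ᶠ w in 𝓝 (1 / 2 - I : ℂ), w.im < 0 :=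
      ContinuousAt.eventually_lt (by fun_prop) continuousAt_const (by norm_num)
    have e2 : ∀ᶠ w in 𝓝 (1 / 2 - I : ℂ), 0 < (τ * w).im := by
      refine ContinuousAt.eventually_lt continuousAt_const (by fun_prop) ?_
      norm_num [mul_im]
      linarith
    filter_upwards [e1, e2] with w h1 h2 using ⟨h1, h2⟩
  -- If the two sides differed on a punctured neighbourhood of 1/2 - i, every point there would be
  -- non-generic. A horizontal segment, however, contains only countably many such points.
  have hbad : ∀ᶠ w in 𝓝[≠] (1 / 2 - I : ℂ), ∃ m n : ℤ, w.re + m + n * (1 / τ).re = 0 := by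
    filter_upwards [hne, nhdsWithin_le_nhds hlow, nhdsWithin_le_nhds (hopen.mem_nhds hz₀)]
      with w h1 h2 h3
    by_contra hg
    push Not at hg
    refine h1 ?_
    have := logDefect_eq_one hτre hτ h h3 h2 hg
    rwa [logDefect, div_eq_one_iff_eq
      (mul_ne_zero (h2.tauDenominator_ne_zero hτ) (exp_ne_zero _))] at this
  have hpath : Tendsto (fun x : ℝ => (1 / 2 - I + x : ℂ)) (𝓝[>] 0) (𝓝[≠] (1 / 2 - I)) := by
    refine tendsto_nhdsWithin_iff.2 ⟨?_, ?_⟩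
    · have : Tendsto (fun x : ℝ => (1 / 2 - I + x : ℂ)) (𝓝 0) (𝓝 (1 / 2 - I + (0 : ℝ))) :=
        Continuous.tendsto (by fun_prop) 0
      rw [ofReal_zero, add_zero] at this
      exact this.mono_left nhdsWithin_le_nhds
    · filter_upwards [self_mem_nhdsWithin] with x hx h0
      have hx : 0 < x := hx
      have : (x : ℂ) = 0 := by simpa using h0
      exact hx.ne' (ofReal_eq_zero.1 this)
  obtain ⟨r, hr0, hsub⟩ := mem_nhdsGT_iff_exists_Ioo_subset.1 (hpath.eventually hbad)
  have hcount : (Ioo 0 r).Countable := by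
    refine (((countable_not_isGeneric τ).preimage (f := fun x : ℝ => 1 / 2 + x)
      fun a b hab => by simpa using hab)).mono fun x hx => ?_
    simpa using hsub hx
  have := hcount.measure_zero volume
  rw [Real.volume_Ioo, sub_zero, ENNReal.ofReal_eq_zero] at this
  exact absurd this (not_le.2 hr0)

end Identification

/-! ### Continuity up to real τ, and the limit of the integral. -/

section RealParameter

variable {ε : ℝ} {τ z a α β : ℂ}

lemma exists_isLineAdmissible (hτre : τ.re < 0) : ∃ ε, IsLineAdmissible ε τ := by
  have hpi := Real.pi_gt_three
  have e1 : (2 * Real.pi * I / -1 : ℂ).im = -(2 * Real.pi) := by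
    rw [div_neg, div_one, neg_im, show (2 * Real.pi * I : ℂ) = ((2 * Real.pi : ℝ) : ℂ) * I by
      push_cast; ring, im_ofReal_mul, I_im, mul_one]
  have e2 : (2 * Real.pi * I / (1 / τ) : ℂ).im = 2 * Real.pi * τ.re := by
    rw [div_div_eq_mul_div, div_one, show (2 * Real.pi * I * τ : ℂ) =
      ((2 * Real.pi : ℝ) : ℂ) * (I * τ) by push_cast; ring, im_ofReal_mul, I_mul_im]
  have m1 := min_le_left 1 (-τ.re)
  have m2 := min_le_right 1 (-τ.re)
  -- The first poles below the real axis lie at depths 2π and -2π Re τ.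
  refine ⟨min 1 (-τ.re), lt_min one_pos (by linarith), ⟨by simp, ?_⟩, ⟨one_div_re_neg hτre, ?_⟩⟩
  · rw [e1]; linarith
  · rw [e2]; nlinarith

/-- The integral representation of the `τ`-shifted factorial. -/
theorem tauFactorial_eq_exp_tauLog (hτre : τ.re < 0) (hτ : 0 ≤ τ.im) (h : IsLineAdmissible ε τ)
    (hz : z ∈ tauStrip τ) : tauFactorial z τ = cexp (tauLog ε z τ) := by
  refine tauFactorial_eq_of_tendsto hτ ?_
  have hsnd : Tendsto (fun p : ℂ × ℂ => p.2) (𝓝 (z, τ)) (𝓝 τ) := continuous_snd.tendsto (z, τ)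
  refine Tendsto.congr' ?_ ((continuousAt_tauLog h hz).cexp.tendsto.mono_left nhdsWithin_le_nhds)
  filter_upwards [self_mem_nhdsWithin, nhdsWithin_le_nhds (hsnd.eventually h.eventually),
    nhdsWithin_le_nhds (eventually_mem_tauStrip h hz), nhdsWithin_le_nhds
      (hsnd.eventually (continuous_re.continuousAt.eventually (gt_mem_nhds hτre)))]
    with p hp h1 h2 h3
  rw [tauNumerator_eq_mul_exp_tauLog h3 hp.1 h1 h2, mul_div_cancel_left₀ _ hp.2]

lemma tauFactorial_ne_zero (hτre : τ.re < 0) (hτ : 0 ≤ τ.im) (hz : z ∈ tauStrip τ) :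
    tauFactorial z τ ≠ 0 := by
  obtain ⟨ε, h⟩ := exists_isLineAdmissible hτre
  rw [tauFactorial_eq_exp_tauLog hτre hτ h hz]
  exact exp_ne_zero _

/-- Continuity of the `τ`-shifted factorial on the closed upper half plane. -/
lemma tendsto_tauFactorial (hτre : τ.re < 0) (hτ : 0 ≤ τ.im) {w : ℂ → ℂ} (hw : ContinuousAt w τ)
    (hz : w τ ∈ tauStrip τ) :
    Tendsto (fun σ => tauFactorial (w σ) σ) (𝓝[{σ | 0 < σ.im}] τ) (𝓝 (tauFactorial (w τ) τ)) := by
  obtain ⟨ε, h⟩ := exists_isLineAdmissible hτre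
  have hp : ContinuousAt (fun σ => (w σ, σ)) τ := hw.prodMk continuousAt_id
  rw [tauFactorial_eq_exp_tauLog hτre hτ h hz]
  have hlim : ContinuousAt (fun σ => cexp (tauLog ε (w σ) σ)) τ :=
    ((continuousAt_tauLog h hz).comp_of_eq hp rfl).cexp
  refine Tendsto.congr' ?_ (hlim.tendsto.mono_left nhdsWithin_le_nhds)
  filter_upwards [self_mem_nhdsWithin, nhdsWithin_le_nhds h.eventually,
    nhdsWithin_le_nhds (hp.eventually (eventually_mem_tauStrip h hz)),
    nhdsWithin_le_nhds (continuous_re.continuousAt.eventually (gt_mem_nhds hτre))]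
    with σ h1 h2 h3 h4
  exact (tauFactorial_eq_exp_tauLog h4 (le_of_lt h1) h2 h3).symm

lemma continuous_tauFactorial_line (hτre : τ.re < 0) (hτ : 0 ≤ τ.im) (ha : a ∈ tauStrip τ) {b : ℂ}
    (hb : b.re = 0) : Continuous fun y : ℝ => tauFactorial (a + b * y) τ := by
  obtain ⟨ε, h⟩ := exists_isLineAdmissible hτre
  have hmem : ∀ y : ℝ, a + b * y ∈ tauStrip τ := by
    intro y
    have e : (a + b * y).re = a.re := by simp [hb]
    exact ⟨by rw [e]; exact ha.1, by rw [e]; exact ha.2⟩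
  simp_rw [fun y => tauFactorial_eq_exp_tauLog hτre hτ h (hmem y)]
  refine continuous_iff_continuousAt.2 fun y => ContinuousAt.cexp ?_
  exact (differentiableAt_tauLog h (hmem y)).continuousAt.comp (f := fun y : ℝ => a + b * y)
    (by fun_prop)

lemma tauCenter_re (τ : ℂ) : (tauCenter τ).re = (1 + (1 / τ).re) / 2 := by
  have h := congrArg re (two_mul_tauCenter τ)
  rw [show (2 : ℂ) = ((2 : ℝ) : ℂ) by norm_num, re_ofReal_mul, add_re, one_re] at h
  linarith

lemma tauCenter_add_mem_tauStrip (ha : |a.re| < (1 - (1 / τ).re) / 2) :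
    tauCenter τ + a ∈ tauStrip τ := by
  have := abs_lt.1 ha
  constructor <;> rw [add_re, tauCenter_re] <;> linarith

lemma not_isTauPole_of_mem_tauStrip (hτre : τ.re < 0) (hz : z ∈ tauStrip τ) : ¬ IsTauPole z τ :=
  fun h => not_lt.2 (re_of_isTauPole hτre h) hz.1

lemma tauReciprocal_eq_inv (hτre : τ.re < 0) (hτ : 0 < τ.im) (hz : z ∈ tauStrip τ) :
    tauReciprocal z τ = (tauFactorial z τ)⁻¹ := by
  refine (inv_eq_of_mul_eq_one_right (tauFactorial_mul_tauReciprocal hτ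
    (not_isTauPole_of_mem_tauStrip hτre hz) (not_isTauPole_of_mem_tauStrip hτre ?_))).symm
  rw [two_mul_tauCenter]
  constructor
  · simp only [sub_re, add_re, one_re]; linarith [hz.2]
  · simp only [sub_re, add_re, one_re]; linarith [hz.1]

lemma tauFactorial_center_mul (hτre : τ.re < 0) (hτ : 0 < τ.im)
    (ha : |a.re| < (1 - (1 / τ).re) / 2) :
    tauFactorial (tauCenter τ + a) τ * tauFactorial (tauCenter τ - a) τ =
      tauConst τ * cexp (Real.pi * I * τ * a ^ 2) := by
  have hmem := tauCenter_add_mem_tauStrip ha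
  have h := tauReciprocal_eq_inv hτre hτ hmem
  have h0 := tauFactorial_ne_zero hτre hτ.le hmem
  have hC := tauConst_ne_zero τ
  rw [tauReciprocal, show 2 * tauCenter τ - (tauCenter τ + a) = tauCenter τ - a by ring,
    add_sub_cancel_left, exp_neg] at h
  have hE := exp_ne_zero (Real.pi * I * τ * a ^ 2)
  generalize cexp (Real.pi * I * τ * a ^ 2) = E at h hE ⊢
  field_simp at h
  linear_combination h

lemma ramanujanIntegrand_eq_regularIntegrand (hτre : τ.re < 0) (hτ : 0 < τ.im)
    (hα : |α.re| < (1 - (1 / τ).re) / 2) (hβ : |β.re| < (1 - (1 / τ).re) / 2) (hz : z.re = 0) :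
    ramanujanIntegrand τ α β z = regularIntegrand τ α β z := by
  have h0 : |z.re| < (1 - (1 / τ).re) / 2 := by
    rw [hz, abs_zero]; linarith [one_div_re_neg hτre]
  have h1 : |(α + z).re| < (1 - (1 / τ).re) / 2 := by rwa [add_re, hz, add_zero]
  have h2 : |(β - z).re| < (1 - (1 / τ).re) / 2 := by rwa [sub_re, hz, sub_zero]
  change tauFactorial (tauCenter τ + z) τ * tauFactorial (tauCenter τ - z) τ /
    (tauFactorial (tauCenter τ + α + z) τ * tauFactorial (tauCenter τ + β - z) τ) = _
  rw [tauFactorial_center_mul hτre hτ h0, regularIntegrand, add_assoc, add_sub_assoc,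
    tauReciprocal_eq_inv hτre hτ (tauCenter_add_mem_tauStrip h1),
    tauReciprocal_eq_inv hτre hτ (tauCenter_add_mem_tauStrip h2), div_eq_mul_inv, mul_inv]

/-- As in `regularIntegrand_eq_of_ne_zero`, reflecting the α-factor isolates the decay, but the rest
is now expressed by `tauLog`, which stays bounded when τ becomes real. -/
lemma regularIntegrand_eq_exp (hτre : τ.re < 0) (hτ : 0 < τ.im) (h : IsLineAdmissible ε τ)
    (hα : |α.re| < (1 - (1 / τ).re) / 2) (hβ : |β.re| < (1 - (1 / τ).re) / 2) (hz : z.re = 0) :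
    regularIntegrand τ α β z = cexp (-(2 * Real.pi * I * τ * α * z) - Real.pi * I * τ * α ^ 2 +
      tauLog ε (tauCenter τ + -α - z) τ - tauLog ε (tauCenter τ + β - z) τ) := by
  have h1 : |(-α - z).re| < (1 - (1 / τ).re) / 2 := by
    rwa [sub_re, hz, sub_zero, neg_re, abs_neg]
  have h2 : |(β - z).re| < (1 - (1 / τ).re) / 2 := by rwa [sub_re, hz, sub_zero]
  have hC := tauConst_ne_zero τ
  rw [regularIntegrand, tauReciprocal_eq_inv hτre hτ (tauCenter_add_mem_tauStrip h2), tauReciprocal,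
    show 2 * tauCenter τ - (tauCenter τ + (α + z)) = tauCenter τ + (-α - z) by ring,
    tauFactorial_eq_exp_tauLog hτre hτ.le h (tauCenter_add_mem_tauStrip h1),
    tauFactorial_eq_exp_tauLog hτre hτ.le h (tauCenter_add_mem_tauStrip h2), ← exp_neg,
    add_sub_cancel_left, add_sub_assoc (tauCenter τ) (-α), add_sub_assoc (tauCenter τ) β]
  have e : -(2 * Real.pi * I * τ * α * z) - Real.pi * I * τ * α ^ 2 +
      tauLog ε (tauCenter τ + (-α - z)) τ - tauLog ε (tauCenter τ + (β - z)) τ =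
      Real.pi * I * τ * z ^ 2 + (tauLog ε (tauCenter τ + (-α - z)) τ +
      -(Real.pi * I * τ * (α + z) ^ 2) + -tauLog ε (tauCenter τ + (β - z)) τ) := by ring
  rw [e, exp_add (Real.pi * I * τ * z ^ 2), exp_add, exp_add]
  field_simp

lemma continuousAt_tauCenter (hτ : τ ≠ 0) : ContinuousAt tauCenter τ := by
  unfold tauCenter
  exact continuousAt_const.add (continuousAt_const.div (by fun_prop) (mul_ne_zero two_ne_zero hτ))

lemma continuousAt_one_div (hτ : τ ≠ 0) : ContinuousAt (fun σ : ℂ => 1 / σ) τ :=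
  continuousAt_const.div continuousAt_id hτ

lemma eventually_abs_re_lt (hτ : τ ≠ 0) {x : ℝ} (hx : x < (1 - (1 / τ).re) / 2) :
    ∀ᶠ σ in 𝓝 τ, x < (1 - (1 / σ).re) / 2 := by
  have : ContinuousAt (fun σ : ℂ => (1 - (1 / σ).re) / 2) τ :=
    (continuousAt_const.sub (continuous_re.continuousAt.comp (continuousAt_one_div hτ))).div_const _
  exact this.eventually (lt_mem_nhds hx)

/-- The constant must not depend on σ near τ: estimates through the products would not survive |q| →
1. -/
lemma exists_norm_tauLog_center_le (h : IsLineAdmissible ε τ)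
    (ha : |a.re| < (1 - (1 / τ).re) / 2) :
    ∃ B, ∀ᶠ σ in 𝓝 τ, ∀ y : ℝ, 0 ≤ y → ‖tauLog ε (tauCenter σ + a - I * y) σ‖ ≤ B := by
  obtain ⟨K, hKc, hK, -, hKev⟩ := h.exists_compact
  obtain ⟨x, hax, hx⟩ := exists_between ha
  obtain ⟨C, hC0, hC⟩ := exists_norm_tauLog_le h.pos h.left hKc hK (sub_pos.2 hax)
  have him : ∀ᶠ σ in 𝓝 τ, (tauCenter σ).im < (tauCenter τ).im + 1 :=
    (continuous_im.continuousAt.comp (continuousAt_tauCenter h.ne_zero)).eventually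
      (gt_mem_nhds (by simp))
  refine ⟨C * Real.exp (ε * ((tauCenter τ).im + 1 + a.im)), ?_⟩
  filter_upwards [hKev, him, eventually_abs_re_lt h.ne_zero hx] with σ h1 h2 h3 y hy
  have hre : (tauCenter σ + a - I * y).re = (1 + (1 / σ).re) / 2 + a.re := by
    rw [← tauCenter_re]; simp
  have h4 := abs_le.1 (le_refl |a.re|)
  refine (hC _ σ h1 (by rw [hre]; linarith) (by rw [hre]; linarith)).trans ?_
  have him : (tauCenter σ + a - I * y).im = (tauCenter σ).im + a.im - y := by simp
  have := h.pos
  rw [him]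
  gcongr
  linarith

lemma exists_ramanujanIntegrand_bound (hτre : τ.re < 0)
    (hα : |α.re| < (1 - (1 / τ).re) / 2) (hβ : |β.re| < (1 - (1 / τ).re) / 2)
    (hα' : (τ * α).re < 0) :
    ∃ K η : ℝ, 0 < η ∧ ∀ᶠ σ in 𝓝[{σ | 0 < σ.im}] τ, ∀ y : ℝ, 0 ≤ y →
      ‖regularIntegrand σ α β (I * y)‖ ≤ K * Real.exp (-(η * y)) := by
  obtain ⟨ε, h⟩ := exists_isLineAdmissible hτre
  have hτ0 := h.ne_zero
  obtain ⟨B₁, hB₁⟩ := exists_norm_tauLog_center_le h (a := -α) (by rwa [neg_re, abs_neg])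
  obtain ⟨B₂, hB₂⟩ := exists_norm_tauLog_center_le h hβ
  have e1 : ∀ᶠ σ in 𝓝 τ, ‖(Real.pi * I * σ * α ^ 2 : ℂ)‖ < ‖(Real.pi * I * τ * α ^ 2 : ℂ)‖ + 1 :=
    ContinuousAt.eventually_lt (by fun_prop) continuousAt_const (by simp)
  have e2 : ∀ᶠ σ in 𝓝 τ, (σ * α).re < (τ * α).re / 2 :=
    ContinuousAt.eventually_lt (by fun_prop) continuousAt_const (by linarith)
  -- Half of the rate 2π|Re(τα)| is given up in order to have one rate for all σ near τ.
  refine ⟨Real.exp (‖(Real.pi * I * τ * α ^ 2 : ℂ)‖ + 1 + B₁ + B₂), Real.pi * -(τ * α).re,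
    mul_pos Real.pi_pos (by linarith), ?_⟩
  filter_upwards [self_mem_nhdsWithin, nhdsWithin_le_nhds hB₁, nhdsWithin_le_nhds hB₂,
    nhdsWithin_le_nhds e1, nhdsWithin_le_nhds e2, nhdsWithin_le_nhds h.eventually,
    nhdsWithin_le_nhds (eventually_abs_re_lt hτ0 hα),
    nhdsWithin_le_nhds (eventually_abs_re_lt hτ0 hβ),
    nhdsWithin_le_nhds (continuous_re.continuousAt.eventually (gt_mem_nhds hτre))]
    with σ h1 h2 h3 h4 h5 h6 h7 h8 h9 y hy
  rw [regularIntegrand_eq_exp h9 h1 h6 h7 h8 (by simp), norm_exp, ← Real.exp_add, Real.exp_le_exp,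
    sub_re, add_re, sub_re]
  have b0 : (-(2 * Real.pi * I * σ * α * (I * y))).re = 2 * Real.pi * y * (σ * α).re := by
    rw [← re_ofReal_mul]
    congr 1
    push_cast; linear_combination -(2 * Real.pi * σ * α * y) * I_sq
  have b1 := (abs_le.1 ((abs_re_le_norm _).trans h4.le)).1
  have b2 := (abs_le.1 ((abs_re_le_norm _).trans (h2 y hy))).2
  have b3 := (abs_le.1 ((abs_re_le_norm _).trans (h3 y hy))).1
  have b4 : Real.pi * y * (σ * α).re ≤ Real.pi * y * ((τ * α).re / 2) :=
    mul_le_mul_of_nonneg_left h5.le (mul_nonneg Real.pi_pos.le hy)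
  rw [b0]
  linarith

lemma exists_integrable_bound (hτre : τ.re < 0)
    (hα : |α.re| < (1 - (1 / τ).re) / 2) (hβ : |β.re| < (1 - (1 / τ).re) / 2)
    (hα' : (τ * α).re < 0) (hβ' : (τ * β).re < 0) :
    ∃ g : ℝ → ℝ, Integrable g ∧ ∀ᶠ σ in 𝓝[{σ | 0 < σ.im}] τ, ∀ y : ℝ,
      ‖ramanujanIntegrand σ α β (I * y)‖ ≤ g y := by
  obtain ⟨K₁, η₁, hη₁, hb₁⟩ := exists_ramanujanIntegrand_bound hτre hα hβ hα'
  obtain ⟨K₂, η₂, hη₂, hb₂⟩ := exists_ramanujanIntegrand_bound hτre hβ hα hβ'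
  have hτ0 : τ ≠ 0 := by rintro rfl; simp at hτre
  refine ⟨fun y => |K₁| * Real.exp (-(η₁ * |y|)) + |K₂| * Real.exp (-(η₂ * |y|)),
    ((integrable_exp_neg_mul_abs hη₁).const_mul _).add
      ((integrable_exp_neg_mul_abs hη₂).const_mul _), ?_⟩
  filter_upwards [self_mem_nhdsWithin, hb₁, hb₂,
    nhdsWithin_le_nhds (eventually_abs_re_lt hτ0 hα),
    nhdsWithin_le_nhds (eventually_abs_re_lt hτ0 hβ),
    nhdsWithin_le_nhds (continuous_re.continuousAt.eventually (gt_mem_nhds hτre))]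
    with σ h1 h2 h3 h4 h5 h6 y
  rw [ramanujanIntegrand_eq_regularIntegrand h6 h1 h4 h5 (by simp)]
  have p1 := mul_nonneg (abs_nonneg K₁) (Real.exp_pos (-(η₁ * |y|))).le
  have p2 := mul_nonneg (abs_nonneg K₂) (Real.exp_pos (-(η₂ * |y|))).le
  rcases le_total 0 y with hy | hy
  · have h7 := h2 y hy
    have h8 := mul_le_mul_of_nonneg_right (le_abs_self K₁) (Real.exp_pos (-(η₁ * y))).le
    rw [abs_of_nonneg hy] at p1 p2 ⊢
    linarith
  · have h7 := h3 (-y) (by linarith)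
    rw [ofReal_neg, mul_neg, regularIntegrand_neg] at h7
    have h8 := mul_le_mul_of_nonneg_right (le_abs_self K₂) (Real.exp_pos (-(η₂ * -y))).le
    rw [abs_of_nonpos hy] at p1 p2 ⊢
    linarith

/-- For τ < 0 the first condition means Re α > 0, so the second becomes a bound on |Re α|. All
factorials in the integrand are then evaluated in the strip without zeros and poles. -/
lemma abs_re_lt_of_mem_parameterDomain (hτre : τ.re < 0) (hτ : τ.im = 0)
    (hα : α ∈ parameterDomain τ) : 0 < α.re ∧ |α.re| < (1 - (1 / τ).re) / 2 := by
  have h1 := hα.1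
  have h2 := hα.2
  have e : (1 / 2 : ℂ).re = 1 / 2 := by norm_num
  rw [mul_re, hτ, zero_mul, sub_zero] at h1
  rw [one_div_two_mul, add_re, re_ofReal_mul, sub_re, e] at h2
  have h3 : 0 < α.re := pos_of_mul_neg_right h1 hτre.le
  exact ⟨h3, by rw [abs_of_pos h3]; linarith⟩

/-- The hyperbolic Ramanujan integral in the case `τ < 0`. -/
theorem ramanujan_integral_of_im_eq_zero (hτre : τ.re < 0) (hτ : τ.im = 0)
    (hα : α ∈ parameterDomain τ) (hβ : β ∈ parameterDomain τ) :
    Integrable (fun y : ℝ => ramanujanIntegrand τ α β (I * y)) ∧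
      I * ∫ y : ℝ, ramanujanIntegrand τ α β (I * y) =
        -(tauConst τ / (-I * τ) ^ (1 / 2 : ℂ)) *
          (tauFactorial (1 / τ + α) τ * tauFactorial (1 / τ + β) τ /
            tauFactorial (1 / τ + α + β) τ) := by
  have hτ0 : τ ≠ 0 := by rintro rfl; simp at hτre
  have hτ' : 0 ≤ τ.im := hτ.ge
  have hr := one_div_re_neg hτre
  obtain ⟨hα0, hα1⟩ := abs_re_lt_of_mem_parameterDomain hτre hτ hα
  obtain ⟨hβ0, hβ1⟩ := abs_re_lt_of_mem_parameterDomain hτre hτ hβ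
  have hα2 := (abs_lt.1 hα1).2
  have hβ2 := (abs_lt.1 hβ1).2
  have h01 : |(0 : ℂ).re| < (1 - (1 / τ).re) / 2 := by
    rw [zero_re, abs_zero]; linarith
  have hne : (𝓝[{σ : ℂ | 0 < σ.im}] τ).NeBot := by
    rw [← mem_closure_iff_nhdsWithin_neBot, closure_setOfPred_lt_im]
    exact hτ'
  obtain ⟨g, hg, hb⟩ := exists_integrable_bound hτre hα1 hβ1 hα.1 hβ.1
  have hmem : ∀ {a : ℂ} (y : ℝ), |a.re| < (1 - (1 / τ).re) / 2 →
      tauCenter τ + a + I * y ∈ tauStrip τ ∧ tauCenter τ + a - I * y ∈ tauStrip τ := by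
    intro a y ha
    rw [add_assoc, add_sub_assoc]
    exact ⟨tauCenter_add_mem_tauStrip (by simpa using ha),
      tauCenter_add_mem_tauStrip (by simpa using ha)⟩
  have hc := continuousAt_tauCenter hτ0
  have hlim : ∀ y : ℝ, Tendsto (fun σ => ramanujanIntegrand σ α β (I * y))
      (𝓝[{σ | 0 < σ.im}] τ) (𝓝 (ramanujanIntegrand τ α β (I * y))) := by
    intro y
    have m0 := hmem (a := 0) y h01
    rw [add_zero] at m0
    have t1 := tendsto_tauFactorial (w := fun σ => tauCenter σ + I * y) hτre hτ' (by fun_prop) m0.1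
    have t2 := tendsto_tauFactorial (w := fun σ => tauCenter σ - I * y) hτre hτ' (by fun_prop) m0.2
    have t3 := tendsto_tauFactorial (w := fun σ => tauCenter σ + α + I * y) hτre hτ' (by fun_prop)
      (hmem y hα1).1
    have t4 := tendsto_tauFactorial (w := fun σ => tauCenter σ + β - I * y) hτre hτ' (by fun_prop)
      (hmem y hβ1).2
    exact (t1.mul t2).div (t3.mul t4) (mul_ne_zero (tauFactorial_ne_zero hτre hτ' (hmem y hα1).1)
      (tauFactorial_ne_zero hτre hτ' (hmem y hβ1).2))
  have hcont : Continuous fun y : ℝ => ramanujanIntegrand τ α β (I * y) := by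
    have key : ∀ {a : ℂ}, |a.re| < (1 - (1 / τ).re) / 2 →
        (Continuous fun y : ℝ => tauFactorial (tauCenter τ + a + I * y) τ) ∧
        Continuous fun y : ℝ => tauFactorial (tauCenter τ + a - I * y) τ := by
      intro a ha
      have h := tauCenter_add_mem_tauStrip ha
      refine ⟨continuous_tauFactorial_line hτre hτ' h I_re, ?_⟩
      simpa only [neg_mul, ← sub_eq_add_neg] using
        continuous_tauFactorial_line hτre hτ' h (b := -I) (by simp)
    have k0 := key h01
    rw [add_zero] at k0
    exact (k0.1.mul k0.2).div ((key hα1).1.mul (key hβ1).2) fun y =>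
      mul_ne_zero (tauFactorial_ne_zero hτre hτ' (hmem y hα1).1)
        (tauFactorial_ne_zero hτre hτ' (hmem y hβ1).2)
  refine ⟨hg.mono' hcont.aestronglyMeasurable (.of_forall fun y =>
    le_of_tendsto (hlim y).norm (hb.mono fun σ h => h y)), ?_⟩
  -- The conditions are open in τ, so the case Im σ > 0 applies with the same α and β for all such σ
  -- near τ.
  have hdom : ∀ {γ : ℂ}, γ ∈ parameterDomain τ →
      ∀ᶠ σ in 𝓝[{σ : ℂ | 0 < σ.im}] τ, γ ∈ parameterDomain σ := by
    intro γ hγ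
    have e1 : ∀ᶠ σ in 𝓝 τ, (σ * γ).re < 0 :=
      ContinuousAt.eventually_lt (by fun_prop) continuousAt_const hγ.1
    have e2 : ∀ᶠ σ in 𝓝 τ, (γ - 1 / 2 + 1 / (2 * σ)).re < 0 := by
      refine ContinuousAt.eventually_lt ?_ continuousAt_const hγ.2
      refine continuous_re.continuousAt.comp (f := fun σ : ℂ => γ - 1 / 2 + 1 / (2 * σ)) ?_
      exact continuousAt_const.add (continuousAt_const.div (by fun_prop)
        (mul_ne_zero two_ne_zero hτ0))
    exact nhdsWithin_le_nhds (e1.and e2)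
  have hev : ∀ᶠ σ in 𝓝[{σ : ℂ | 0 < σ.im}] τ,
      Integrable (fun y : ℝ => ramanujanIntegrand σ α β (I * y)) ∧
      I * ∫ y : ℝ, ramanujanIntegrand σ α β (I * y) =
        -(tauConst σ / (-I * σ) ^ (1 / 2 : ℂ)) *
          (tauFactorial (1 / σ + α) σ * tauFactorial (1 / σ + β) σ /
            tauFactorial (1 / σ + α + β) σ) := by
    filter_upwards [self_mem_nhdsWithin, hdom hα, hdom hβ,
      nhdsWithin_le_nhds (continuous_re.continuousAt.eventually (gt_mem_nhds hτre))]
      with σ h1 h2 h3 h4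
    exact ramanujan_integral_of_im_pos h4 h1 h2 h3
  have hL : Tendsto (fun σ => I * ∫ y : ℝ, ramanujanIntegrand σ α β (I * y))
      (𝓝[{σ | 0 < σ.im}] τ) (𝓝 (I * ∫ y : ℝ, ramanujanIntegrand τ α β (I * y))) :=
    (tendsto_integral_filter_of_dominated_convergence g
      (hev.mono fun σ h => h.1.aestronglyMeasurable)
      (hb.mono fun σ h => .of_forall h) hg (.of_forall hlim)).const_mul I
  have ho := continuousAt_one_div hτ0
  have m1 : 1 / τ + α ∈ tauStrip τ := by constructor <;> rw [add_re] <;> linarith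
  have m2 : 1 / τ + β ∈ tauStrip τ := by constructor <;> rw [add_re] <;> linarith
  have m3 : 1 / τ + α + β ∈ tauStrip τ := by
    constructor <;> rw [add_re, add_re] <;> linarith
  have t1 := tendsto_tauFactorial (w := fun σ => 1 / σ + α) hτre hτ' (ho.add_const _) m1
  have t2 := tendsto_tauFactorial (w := fun σ => 1 / σ + β) hτre hτ' (ho.add_const _) m2
  have t3 := tendsto_tauFactorial (w := fun σ => 1 / σ + α + β) hτre hτ'
    ((ho.add_const _).add_const _) m3
  -- For τ < 0 the number -iτ lies on the positive imaginary axis, off the branch cut, so the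
  -- principal root passes to the limit.
  have hslit : -I * τ ∈ slitPlane := by
    refine mem_slitPlane_iff.2 (Or.inr ?_)
    rw [neg_mul, neg_im, I_mul_im]
    linarith
  have hconst : ContinuousAt (fun σ : ℂ => tauConst σ / (-I * σ) ^ (1 / 2 : ℂ)) τ := by
    refine ContinuousAt.div ?_ ?_ ?_
    · unfold tauConst qPow qTildePow
      exact ContinuousAt.mul (by fun_prop)
        (((continuousAt_const.div continuousAt_id hτ0)).neg.cexp)
    · exact ContinuousAt.comp (g := fun x : ℂ => x ^ (1 / 2 : ℂ)) (f := fun σ : ℂ => -I * σ)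
        (continuousAt_cpow_const hslit) (by fun_prop)
    · rw [Ne, cpow_eq_zero_iff, not_and_or]
      exact Or.inl (slitPlane_ne_zero hslit)
  have hR := (hconst.tendsto.mono_left nhdsWithin_le_nhds).neg.mul
    ((t1.mul t2).div t3 (tauFactorial_ne_zero hτre hτ' m3))
  exact tendsto_nhds_unique hL (hR.congr' (hev.mono fun σ h => h.2.symm))

end RealParameter

/-- The contour integral of `f` from `-i∞` to `i∞` along the imaginary axis is
`i * ∫ y : ℝ, f (i y)`. The square root is the principal branch. -/
theorem theorem3p4 (τ α β : ℂ) (hτre : τ.re < 0) (hτim : 0 ≤ τ.im)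
    (hα : (τ * α).re < 0) (hβ : (τ * β).re < 0)
    (hα' : (α - 1 / 2 + 1 / (2 * τ)).re < 0) (hβ' : (β - 1 / 2 + 1 / (2 * τ)).re < 0) :
    MeasureTheory.Integrable (fun y : ℝ => ramanujanIntegrand τ α β (Complex.I * y)) ∧
      Complex.I * ∫ y : ℝ, ramanujanIntegrand τ α β (Complex.I * y) =
        -(qPow τ (-1 / 24) * qTildePow τ (1 / 24) / (-Complex.I * τ) ^ (1 / 2 : ℂ)) *
          (tauFactorial (1 / τ + α) τ * tauFactorial (1 / τ + β) τ /
            tauFactorial (1 / τ + α + β) τ) := by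
  rcases hτim.lt_or_eq with h | h
  · exact ramanujan_integral_of_im_pos hτre h ⟨hα, hα'⟩ ⟨hβ, hβ'⟩
  · exact ramanujan_integral_of_im_eq_zero hτre h.symm ⟨hα, hα'⟩ ⟨hβ, hβ'⟩
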